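/- Let $N=2^n$. Element Distinctness for a function $f:\{0,1\}^n\to\{0,1\}^n$ asks to decide whether $f$ is one-to-one and, if it is not, to output a pair $i\ne j$ with $f(i)=f(j)$. We work in the quantum circuit model: in each time-slice, one- and two-qubit gates act on pairwise disjoint sets of qubits; the size of a circuit is its number of gates, its space (width) is its number of qubits including ancillas, and its time (depth) is its number of time-slices. A circuit computes $f$ if it implements $U_f:|x\rangle|y\rangle\mapsto|x\rangle|y\oplus f(x)\rangle$, with ancillas that start and end in $|0\rangle$. Theorem. Given a circuit of size $\mathrm{poly}(\log N)$ (with $\mathrm{poly}(\log N)$ ancillas) computing $f$, Element Distinctness for $f$ can be solved in space $\tilde O(S)$ and time $T=\tilde O(N/S)$ for any $1\le S\le N$; hence $ST=\tilde O(N)$. Precisely: there is an algorithm which, given $n$, $S$ and a number $a$, outputs a circuit template made of Hadamard, $T$ and CNOT gates and of (possibly simultaneous) calls to an unspecified circuit on $2n+a$ qubits, such that the following holds. For every $c$ there is a $k$ such that for all $n$, $a$ and $S$ with $1\le S\le 2^n$, all $f:\{0,1\}^n\to\{0,1\}^n$, and every quantum circuit $C$ computing $f$ with $a\le c(n+1)^c$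 ancillas and size at most $c(n+1)^c$, each of whose time-slices contains a gate, inserting $C$ into the template for $(n,S,a)$ gives a quantum circuit of width at most $k\,S\,(n+1)^k$, of depth at most $k\,(N/S)\,(n+1)^k$, and with (width)$\cdot$(depth) at most $k\,N\,(n+1)^k$, which, started in $|0\cdots0\rangle$ and measured at the end, outputs with probability at least $2/3$ a correct answer: either "$f$ is one-to-one", when this is the case, or a pair $i\neq j$ with $f(i)=f(j)$. -/

import Mathlib

noncomputable section

namespace QC

/-- Bit strings of length `w`; they label the computational basis of `w` qubits. -/
abbrev Bits (w : ℕ) : Type := Fin w → Bool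

/-- Vectors of amplitudes on `w` qubits. -/
abbrev State (w : ℕ) : Type := Bits w → ℂ

/-- The computational basis vector `|x⟩`. -/
def ket {w : ℕ} (x : Bits w) : State w := fun z => if z = x then 1 else 0

/-- An elementary gate on `w` wires: an arbitrary unitary acting on one wire, or an arbitrary
unitary acting on an ordered pair of distinct wires. -/
inductive Gate (w : ℕ) : Type
  | one (U : Matrix.unitaryGroup Bool ℂ) (q : Fin w) : Gate w
  | two (U : Matrix.unitaryGroup (Bool × Bool) ℂ) (q r : Fin w) (h : q ≠ r) : Gate w

namespace Gate

/-- The wires a gate acts on. -/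
def support {w : ℕ} : Gate w → Finset (Fin w)
  | one _ q => {q}
  | two _ q r _ => {q, r}

/-- The action of a gate on a state vector (identity on the other wires). -/
def apply {w : ℕ} : Gate w → State w → State w
  | one U q, ψ => fun x => ∑ b : Bool, U.1 (x q) b * ψ (Function.update x q b)
  | two U q r _, ψ => fun x => ∑ b : Bool × Bool,
      U.1 (x q, x r) b * ψ (Function.update (Function.update x q b.1) r b.2)

/-- The same gate with its wires renamed along an injection. -/
def map {m w : ℕ} (e : Fin m ↪ Fin w) : Gate m → Gate w
  | one U q => one U (e q)
  | two U q r h => two U (e q) (e r) (fun he => h (e.injective he))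

end Gate

/-- A quantum circuit on `w` wires, as the list of its time-slices, each of which is a list of
gates. -/
abbrev Circuit (w : ℕ) : Type := List (List (Gate w))

namespace Circuit

/-- Every time-slice contains at least one gate, and the gates within one time-slice act on
pairwise disjoint sets of wires. -/
def WellFormed {w : ℕ} (C : Circuit w) : Prop :=
  ∀ L ∈ C,
    L ≠ [] ∧ L.Pairwise (fun g g' => Disjoint g.support g'.support)

/-- The number of time-slices. -/
def depth {w : ℕ} (C : Circuit w) : ℕ := C.length

/-- The total number of gates. -/
def size {w : ℕ} (C : Circuit w) : ℕ := (List.map List.length C).sum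

/-- The number of qubits (inputs and ancillas). -/
def width {w : ℕ} (_ : Circuit w) : ℕ := w

/-- The linear map implemented by a circuit (first time-slice first). -/
def run {w : ℕ} (C : Circuit w) (ψ : State w) : State w :=
  List.foldl (fun φ L => List.foldl (fun χ g => Gate.apply g χ) φ L) ψ C

/-- The circuit `C`, on two `n`-qubit registers and `a` ancillas, implements
`U_f : |x⟩|y⟩ ↦ |x⟩|y ⊕ f x⟩`, with the ancillas starting and ending in `|0⟩`. -/
def Computes {n a : ℕ} (C : Circuit (n + n + a)) (f : Bits n → Bits n) : Prop :=
  ∀ x y : Bits n,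
    C.run (ket (Fin.append (Fin.append x y) (fun _ => false))) =
      ket (Fin.append (Fin.append x (fun i => xor (y i) (f x i))) (fun _ => false))

end Circuit

/-- The Hadamard gate. -/
def hadamard : Matrix.unitaryGroup Bool ℂ :=
  ⟨Matrix.of fun b c => ((if b && c then -1 else 1 : ℝ) / Real.sqrt 2 : ℝ), by
    rw [Matrix.mem_unitaryGroup_iff]
    have h : ((Real.sqrt 2 : ℝ) : ℂ) * (Real.sqrt 2 : ℝ) = 2 := by
      rw [← Complex.ofReal_mul, Real.mul_self_sqrt (by norm_num)]; norm_num
    have h0 : ((Real.sqrt 2 : ℝ) : ℂ) ≠ 0 := by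
      intro h'; rw [h'] at h; norm_num at h
    ext b c
    cases b <;> cases c <;>
      simp [Matrix.mul_apply, Matrix.star_apply, neg_div, ← mul_inv, h] <;> norm_num⟩

/-- The `T` gate `diag(1, exp(iπ/4))`. -/
def tGate : Matrix.unitaryGroup Bool ℂ :=
  ⟨Matrix.diagonal fun b => if b then Complex.exp (((Real.pi / 4 : ℝ) : ℂ) * Complex.I) else 1, by
    rw [Matrix.mem_unitaryGroup_iff, Matrix.star_eq_conjTranspose,
      Matrix.diagonal_conjTranspose, Matrix.diagonal_mul_diagonal, ← Matrix.diagonal_one]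
    congr 1
    ext b
    cases b
    · simp
    · simp only [if_true, Pi.star_apply, Complex.star_def]
      rw [Complex.mul_conj, Complex.normSq_eq_norm_sq, Complex.norm_exp_ofReal_mul_I]
      simp⟩

/-- The controlled-not gate `|b⟩|c⟩ ↦ |b⟩|c ⊕ b⟩`. -/
def cnotGate : Matrix.unitaryGroup (Bool × Bool) ℂ :=
  ⟨Matrix.of fun p q => if p = (q.1, xor q.2 q.1) then 1 else 0, by
    rw [Matrix.mem_unitaryGroup_iff]
    ext ⟨b, b'⟩ ⟨c, c'⟩
    cases b <;> cases b' <;> cases c <;> cases c' <;>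
      simp [Matrix.mul_apply, Matrix.star_apply, Fintype.sum_prod_type]⟩

/-- Gates of a fixed finite universal gate set, placed on `w` wires. -/
inductive BasicGate (w : ℕ) : Type
  | had (q : Fin w) : BasicGate w
  | t (q : Fin w) : BasicGate w
  | cnot (q r : Fin w) (h : q ≠ r) : BasicGate w

/-- A basic gate as an elementary gate. -/
def BasicGate.toGate {w : ℕ} : BasicGate w → Gate w
  | had q => .one hadamard q
  | t q => .one tGate q
  | cnot q r h => .two cnotGate q r h

/-- A step of a circuit template on `w` wires with a placeholder for an `m`-wire circuit:
either one time-slice of basic gates, or a number of simultaneous calls of the placeholder circuit,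
each call specifying which wires it is attached to. -/
inductive Step (m w : ℕ) : Type
  | gates (L : List (BasicGate w)) : Step m w
  | calls (L : List (Fin m ↪ Fin w)) : Step m w

/-- Replace the placeholder by the circuit `C`: a step of simultaneous calls becomes
`C.depth` time-slices, in which the copies of `C` are executed in parallel. -/
def Step.instantiate {m w : ℕ} (C : Circuit m) : Step m w → List (List (Gate w))
  | gates L => [L.map BasicGate.toGate]
  | calls L => List.map (fun K : List (Gate m) => L.flatMap fun e => K.map (Gate.map e)) C

/-- Description of a basic gate by natural numbers. -/
def BasicGate.code {w : ℕ} : BasicGate w → List ℕ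
  | had q => [0, q.val]
  | t q => [1, q.val]
  | cnot q r _ => [2, q.val, r.val]

/-- Description of a step by natural numbers. -/
def Step.code {m w : ℕ} : Step m w → Bool × List (List ℕ)
  | gates L => (false, L.map BasicGate.code)
  | calls L => (true, L.map fun e => List.ofFn fun i => (e i).val)

/-- A circuit template with a placeholder for a circuit on `n + n + a` wires (two `n`-qubit
registers and `a` ancillas). Its wires are two `n`-qubit output registers, one output flag, and
`work` further qubits. -/
structure Template (n a : ℕ) : Type where
  work : ℕ
  steps : List (Step (n + n + a) (n + n + 1 + work))

/-- The finite description of a template. -/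
def Template.code {n a : ℕ} (P : Template n a) : ℕ × List (Bool × List (List ℕ)) :=
  (P.work, P.steps.map Step.code)

/-- The circuit obtained from a template by inserting `C` at each call. -/
def Template.instantiate {n a : ℕ} (P : Template n a) (C : Circuit (n + n + a)) :
    Circuit (n + n + 1 + P.work) :=
  P.steps.flatMap (Step.instantiate C)

/-- First output register of a measured bit string. -/
def outFst {n r : ℕ} (z : Bits (n + n + 1 + r)) : Bits n :=
  fun i => z (Fin.castAdd r (Fin.castAdd 1 (Fin.castAdd n i)))

/-- Second output register of a measured bit string. -/
def outSnd {n r : ℕ} (z : Bits (n + n + 1 + r)) : Bits n :=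
  fun i => z (Fin.castAdd r (Fin.castAdd 1 (Fin.natAdd n i)))

/-- Output flag of a measured bit string. -/
def outFlag {n r : ℕ} (z : Bits (n + n + 1 + r)) : Bool :=
  z (Fin.castAdd r (Fin.natAdd (n + n) 0))

/-- The measured bit string is a correct answer to Element Distinctness for `f`: either the flag is
`0` and `f` is one-to-one, or the flag is `1` and the output registers hold a colliding pair. -/
def CorrectAnswer {n r : ℕ} (f : Bits n → Bits n) (z : Bits (n + n + 1 + r)) : Prop :=
  (outFlag z = false ∧ Function.Injective f) ∨
  (outFlag z = true ∧ outFst z ≠ outSnd z ∧ f (outFst z) = f (outSnd z))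

open Classical in
/-- Started in `|0…0⟩` and measured at the end in the computational basis, the circuit outputs a
correct answer to Element Distinctness for `f` with probability at least `2/3`. -/
def SolvesED {n r : ℕ} (Q : Circuit (n + n + 1 + r)) (f : Bits n → Bits n) : Prop :=
  (2 / 3 : ℝ) ≤ ∑ z : Bits (n + n + 1 + r),
    if CorrectAnswer f z then ‖Q.run (ket fun _ => false) z‖ ^ 2 else 0

end QC

end

noncomputable section
namespace QC

/-! ### Uniform circuit families -/

/-! Let 2^l be the largest power of two that is at most S, with l ≤ n, and cut the domain into
2^(n-l) blocks of 2^l arguments. Every collision lies in the union of two blocks, possibly equal.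
Grover search over pairs of blocks runs over about (N/2^l)^2 candidates and so needs O(N/S)
iterations; it remains to make one iteration cost only polylogarithmic depth on Õ(S) wires. Given a
pair of blocks, `oracle` fans the search register out to 2^(l+1) rows, evaluates f in all rows by
simultaneous calls, sorts the records with the value as leading part by a bitonic network, compares
neighbours, and sorts once more with the outcome as leading bit, so that a colliding pair, if there
is one, arrives in row 0 (`exec_oracle`).

Everything inside the oracle is reversible: an operation either is a call or adds a polynomial over
𝔽₂ of degree at most two to a wire that it does not read, hence is an involution, and the reversed
program uncomputes (`exec_reverse`). Each sorting stage writes to a region of its own. Programs have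
a classical semantics `exec` on memories; `runProg_memKet` shows that the actual circuit, built from
Hadamard, T and CNOT gates and copies of C, maps basis states accordingly, provided the ancillas of
every call are clean (`CallsClean`). Superpositions are then handled by linearity. Region 0 contains
the output, regions 1 + k the search registers, and the regions from `workBase` on the work space,
which is zero between oracle calls.

The number of marked pairs is unknown. Therefore searches with 2^k iterations are run for all k ≤ n
- l + 1. Two dummy bits in the register, required to be 1, keep the marked fraction at most 1/4 and
the Grover angle at most π/6; then some k reaches success probability 3/4 (`exists_good_power`,
`exists_searchAmp_ge`). Nothing is measured in between: each search has a fresh register and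
afterwards copies its pair coherently to the output unless a pair is already there. The invariant
`StateOK` says that the branches remain orthogonal and that the weight of those with an output is at
least the success probability of each search made so far. An announced collision is always genuine,
so the error is one-sided.

For uniformity the template is obtained by decoding an explicit numerical description. This
description is primitive recursive, and decoding followed by encoding returns it because all
operations are valid. The depth is a geometric sum of numbers of iterations, times a polylogarithmic
number of layers, times the depth of C plus a constant. -/

/-- A logical wire: region, row and column. -/
abbrev Addr : Type := ℕ × ℕ × ℕ

/-- A number of simultaneous operations of one kind, each given by the wires it acts on. -/
abbrev Layer : Type := ℕ × List (List Addr)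

namespace Kind

abbrev call : ℕ := 0
abbrev had : ℕ := 1
abbrev zed : ℕ := 2
abbrev copy : ℕ := 3
abbrev one : ℕ := 4
abbrev mux : ℕ := 5
abbrev gt : ℕ := 6
abbrev eq : ℕ := 7
abbrev and : ℕ := 8
abbrev notCopy : ℕ := 9
abbrev nor : ℕ := 10
abbrev andNot : ℕ := 11

/-- The operations of kind at least `3` add a polynomial over `𝔽₂`, in the wires after the first
one, to the first wire. These are the lists of monomials. -/
def monTable : List (List (List ℕ)) :=
  [[[0]], [[]], [[2], [0, 1], [0, 2]], [[0], [2], [0, 1], [0, 2], [1, 2]], [[2], [0, 2], [1, 2]],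
    [[0, 1]], [[], [0]], [[], [0], [1], [0, 1]], [[0], [0, 1]]]

/-- Doubly controlled phase flip. -/
def cczPats (a b c : ℕ) : List (ℕ × List ℕ) :=
  [(1, [a]), (1, [b]), (1, [c]), (2, [a, b])] ++ List.replicate 7 (1, [b]) ++
  [(2, [b, c]), (1, [c]), (2, [a, b]), (2, [b, c])] ++ List.replicate 7 (1, [c]) ++
  [(2, [a, c]), (2, [b, c])] ++ List.replicate 7 (1, [c]) ++ [(2, [b, c])]

/-- Phase flip. -/
def zPats : List (ℕ × List ℕ) := List.replicate 4 (1, [0])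

/-- Basic gates that add a monomial of degree at most two to wire `0`. -/
def monPats : List ℕ → List (ℕ × List ℕ)
  | [] => [(0, [0])] ++ zPats ++ [(0, [0])]
  | [i] => [(2, [i + 1, 0])]
  | i :: j :: _ => [(0, [0])] ++ cczPats (i + 1) (j + 1) 0 ++ [(0, [0])]

/-- The sequence of basic gates that implements an operation. -/
def patTable : List (List (ℕ × List ℕ)) :=
  [[], [(0, [0])], zPats] ++ monTable.map fun m => m.flatMap monPats

def pats (κ : ℕ) : List (ℕ × List ℕ) := patTable.getD κ []

end Kind

/-- A layer of `cnt` operations. -/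
def lay (κ cnt : ℕ) (F : ℕ → List Addr) : Layer := (κ, (List.range cnt).map F)

/-- A sequence of `w` layers of `cnt` operations each. -/
def loop (κ w cnt : ℕ) (F : ℕ → ℕ → List Addr) : List Layer :=
  (List.range w).map fun b => lay κ cnt (F b)

/-- Lower end of the `u`-th comparator of a stage with half block length `d`. -/
def lo (d u : ℕ) : ℕ := u / d * (2 * d) + u % d

/-- Upper end of the `u`-th comparator of a stage with half block length `d`. -/
def hi (st : Bool × ℕ) (u : ℕ) : ℕ :=
  u / st.2 * (2 * st.2) + if st.1 then 2 * st.2 - 1 - u % st.2 else st.2 + u % st.2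

/-- The stages of the bitonic sorting network on `2 ^ L` positions. A mirrored stage compares
positions that are symmetric within a block, the others positions at a fixed distance. -/
def stages (L : ℕ) : List (Bool × ℕ) :=
  (List.range L).flatMap fun p =>
    (true, 2 ^ p) :: (List.range p).map fun r => (false, 2 ^ (p - 1 - r))

/-- One stage of `h` comparators on records of `w` bits, from region `ρ` to region `ρ + 1`. -/
def stageProg (ρ w h : ℕ) (st : Bool × ℕ) : List Layer :=
  loop Kind.gt w h (fun b u => [(ρ + 1, lo st.2 u, w + b + 1), (ρ, lo st.2 u, b), (ρ, hi st u, b),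
    (ρ + 1, lo st.2 u, w + b)]) ++
  loop Kind.mux w h (fun b u => [(ρ + 1, lo st.2 u, b), (ρ + 1, lo st.2 u, w + w), (ρ, hi st u, b),
    (ρ, lo st.2 u, b)]) ++
  loop Kind.mux w h (fun b u => [(ρ + 1, hi st u, b), (ρ + 1, lo st.2 u, w + w), (ρ, lo st.2 u, b),
    (ρ, hi st u, b)])

/-- The sorting network with the given stages. -/
def sortProg (ρ w h : ℕ) (sts : List (Bool × ℕ)) : List Layer :=
  (List.range sts.length).flatMap fun t => stageProg (ρ + t) w h (sts.getD t (false, 1))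

/-- Number of search qubits, when `2 ^ l` is the block length. -/
def qbits (n l : ℕ) : ℕ := 2 * (n - l) + 2

/-- First work region. -/
def workBase (n : ℕ) : ℕ := n + 3

/-- Distribution of the search register to all rows. -/
def fanProg (n l k : ℕ) : List Layer :=
  loop Kind.copy (qbits n l) 1 (fun b _ => [(workBase n, 0, b), (1 + k, 0, b)]) ++
  (List.range (l + 1)).flatMap fun j => loop Kind.copy (qbits n l) (2 ^ j)
    (fun b u => [(workBase n, 2 ^ j + u, b), (workBase n, u, b)])

/-- Preparation of the arguments in all rows, and the calls. -/
def loadProg (n l a : ℕ) : List Layer :=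
  loop Kind.one l (2 ^ l) (fun b u => [(workBase n + 1, hi (false, 2 ^ b) u, b)]) ++
  loop Kind.copy (n - l) (2 ^ (l + 1)) (fun b u =>
    [(workBase n + 1, u, l + b), (workBase n, u, u / 2 ^ l * (n - l) + b)]) ++
  [lay Kind.call (2 ^ (l + 1)) fun u =>
    (List.range (n + n + a)).map fun j => (workBase n + 1, u, j)]

/-- Number of stages of the sorting network. -/
def nStages (l : ℕ) : ℕ := (stages (l + 1)).length

/-- Region of the sorted records. -/
def sortedReg (n l : ℕ) : ℕ := workBase n + 1 + nStages l

/-- Comparison of neighbouring sorted records. -/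
def adjProg (n l : ℕ) : List Layer :=
  loop Kind.copy (2 * n) (2 ^ (l + 1) - 1) (fun b u =>
    [(sortedReg n l + 1, u, b), (sortedReg n l, u + 1, b)]) ++
  loop Kind.and 1 (2 ^ (l + 1) - 1) (fun _ u =>
    [(sortedReg n l + 1, u, 2 * n), (workBase n, u, 2 * (n - l)),
      (workBase n, u, 2 * (n - l) + 1)]) ++
  loop Kind.eq (2 * n) (2 ^ (l + 1) - 1) (fun j u =>
    [(sortedReg n l + 1, u, 2 * n + j + 1), (sortedReg n l, u, 2 * n - 1 - j),
      (sortedReg n l + 1, u, 2 * n - 1 - j), (sortedReg n l + 1, u, 2 * n + j)]) ++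
  loop Kind.copy n (2 ^ (l + 1)) (fun b u =>
    [(sortedReg n l + 2, u, b), (sortedReg n l, u, b)]) ++
  loop Kind.copy n (2 ^ (l + 1)) (fun b u =>
    [(sortedReg n l + 2, u, n + b), (sortedReg n l + 1, u, b)]) ++
  loop Kind.notCopy 1 (2 ^ (l + 1)) (fun _ u =>
    [(sortedReg n l + 2, u, 2 * n), (sortedReg n l + 1, u, 3 * n)]) ++
  loop Kind.copy 1 (2 ^ (l + 1)) (fun _ u =>
    [(sortedReg n l + 2, u, 2 * n), (sortedReg n l + 1, u, 4 * n)])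

/-- Row `0` of this region holds a pair of arguments, and a flag that is `0` if they collide. -/
def pairReg (n l : ℕ) : ℕ := sortedReg n l + 2 + nStages l

/-- The search for a collision within a pair of blocks. -/
def oracle (n l a k : ℕ) : List Layer :=
  fanProg n l k ++ loadProg n l a ++ sortProg (workBase n + 1) (2 * n) (2 ^ l) (stages (l + 1)) ++
  adjProg n l ++ sortProg (sortedReg n l + 2) (2 * n + 1) (2 ^ l) (stages (l + 1))

/-- Test whether the search register is zero. -/
def zeroTest (n l k : ℕ) : List Layer :=
  loop Kind.one 1 1 (fun _ _ => [(workBase n, 0, 0)]) ++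
  loop Kind.andNot (qbits n l) 1 (fun b _ =>
    [(workBase n, 0, b + 1), (workBase n, 0, b), (1 + k, 0, b)])

/-- Hadamard gates on the search register. -/
def hadLayer (n l k : ℕ) : Layer := lay Kind.had (qbits n l) fun b => [(1 + k, 0, b)]

/-- A phase flip on one wire. -/
def zedLayer (z : Addr) : Layer := lay Kind.zed 1 fun _ => [z]

/-- One Grover iteration. -/
def groverIter (n l a k : ℕ) : List Layer :=
  (oracle n l a k ++ [zedLayer (pairReg n l, 0, 2 * n)] ++ (oracle n l a k).reverse) ++
  ([hadLayer n l k] ++ (zeroTest n l k ++ [zedLayer (workBase n, 0, qbits n l)] ++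
    (zeroTest n l k).reverse) ++ [hadLayer n l k])

/-- Copy a colliding pair to the output, if there is none yet. -/
def extract (n l k : ℕ) : List Layer :=
  loop Kind.nor 1 1 (fun _ _ => [(1 + k, 0, qbits n l), (pairReg n l, 0, 2 * n), (0, 0, 2 * n)]) ++
  loop Kind.and (2 * n) 1 (fun b _ =>
    [(0, 0, b), (1 + k, 0, qbits n l), (pairReg n l, 0, b)]) ++
  loop Kind.copy 1 1 (fun _ _ => [(0, 0, 2 * n), (1 + k, 0, qbits n l)])

/-- Grover search with `2 ^ k` iterations on the `k`-th register. -/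
def searchRun (n l a k : ℕ) : List Layer :=
  [hadLayer n l k] ++ (List.range (2 ^ k)).flatMap (fun _ => groverIter n l a k) ++
  (oracle n l a k ++ extract n l k ++ (oracle n l a k).reverse)

/-- The whole algorithm. -/
def program (n l a : ℕ) : List Layer :=
  (List.range (n - l + 2)).flatMap (searchRun n l a)

/-- Number of regions. -/
def nRegions (n l : ℕ) : ℕ := n + 2 * nStages l + 7

/-- Number of columns. -/
def nCols (n a : ℕ) : ℕ := 4 * n + a + 3

/-- Physical wire of a logical wire. -/
def enc (R W : ℕ) (v : Addr) : ℕ := (v.1 * R + v.2.1) * W + v.2.2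

/-- Code of the steps that implement a layer. -/
def layerCode (R W : ℕ) (ℓ : Layer) : List (Bool × List (List ℕ)) :=
  if ℓ.1 = 0 then [(true, ℓ.2.map fun ws => ws.map (enc R W))]
  else (Kind.pats ℓ.1).map fun p =>
    (false, ℓ.2.map fun ws => p.1 :: p.2.map fun i => enc R W (ws.getD i (0, 0, 0)))

/-- Logarithm of the block length. -/
def logBlock (n S : ℕ) : ℕ := Nat.findGreatest (fun i => 2 ^ i ≤ S) n

/-- Code of the steps of the algorithm. -/
def stepCodes (n l a : ℕ) : List (Bool × List (List ℕ)) :=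
  (program n l a).flatMap (layerCode (2 ^ (l + 1)) (nCols n a))

/-- Number of work wires. -/
def workWires (n l a : ℕ) : ℕ := nRegions n l * 2 ^ (l + 1) * nCols n a - (n + n + 1)

/-! ### Computability -/

-- With primitive recursiveness registered as a `fun_prop` property, computability of the whole
-- family reduces to closure rules for arithmetic and list combinators.
attribute [fun_prop] Primrec

section Primrec

variable {α β γ : Type*} [Primcodable α] [Primcodable β] [Primcodable γ]

@[fun_prop] theorem primrec_id : Primrec fun x : α => x := Primrec.id

attribute [fun_prop] Primrec.const Primrec.comp Primrec.pair

@[fun_prop] theorem primrec_fst {f : α → β × γ} (h : Primrec f) : Primrec fun x => (f x).1 :=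
  Primrec.fst.comp h

@[fun_prop] theorem primrec_snd {f : α → β × γ} (h : Primrec f) : Primrec fun x => (f x).2 :=
  Primrec.snd.comp h

@[fun_prop] theorem primrec_add {f g : α → ℕ} (hf : Primrec f) (hg : Primrec g) :
    Primrec fun x => f x + g x := Primrec.nat_add.comp hf hg

@[fun_prop] theorem primrec_sub {f g : α → ℕ} (hf : Primrec f) (hg : Primrec g) :
    Primrec fun x => f x - g x := Primrec.nat_sub.comp hf hg

@[fun_prop] theorem primrec_mul {f g : α → ℕ} (hf : Primrec f) (hg : Primrec g) :
    Primrec fun x => f x * g x := Primrec.nat_mul.comp hf hg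

@[fun_prop] theorem primrec_div {f g : α → ℕ} (hf : Primrec f) (hg : Primrec g) :
    Primrec fun x => f x / g x := Primrec.nat_div.comp hf hg

@[fun_prop] theorem primrec_mod {f g : α → ℕ} (hf : Primrec f) (hg : Primrec g) :
    Primrec fun x => f x % g x := Primrec.nat_mod.comp hf hg

@[fun_prop] theorem primrec_pow {f g : α → ℕ} (hf : Primrec f) (hg : Primrec g) :
    Primrec fun x => f x ^ g x :=
  (Primrec₂.unpaired'.1 Nat.Primrec.pow).comp hf hg

@[fun_prop] theorem primrec_range {f : α → ℕ} (hf : Primrec f) :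
    Primrec fun x => List.range (f x) := Primrec.list_range.comp hf

@[fun_prop] theorem primrec_cons {f : α → β} {g : α → List β} (hf : Primrec f) (hg : Primrec g) :
    Primrec fun x => f x :: g x := Primrec.list_cons.comp hf hg

@[fun_prop] theorem primrec_append {f g : α → List β} (hf : Primrec f) (hg : Primrec g) :
    Primrec fun x => f x ++ g x := Primrec.list_append.comp hf hg

@[fun_prop] theorem primrec_map {f : α → List β} {g : α → β → γ} (hf : Primrec f)
    (hg : Primrec fun p : α × β => g p.1 p.2) : Primrec fun x => (f x).map (g x) :=
  Primrec.list_map hf hg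

@[fun_prop] theorem primrec_flatMap {f : α → List β} {g : α → β → List γ} (hf : Primrec f)
    (hg : Primrec fun p : α × β => g p.1 p.2) : Primrec fun x => (f x).flatMap (g x) :=
  Primrec.list_flatMap hf hg

@[fun_prop] theorem primrec_reverse {f : α → List β} (hf : Primrec f) :
    Primrec fun x => (f x).reverse := Primrec.list_reverse.comp hf

@[fun_prop] theorem primrec_length {f : α → List β} (hf : Primrec f) :
    Primrec fun x => (f x).length := Primrec.list_length.comp hf

@[fun_prop] theorem primrec_getD {f : α → List β} {g : α → ℕ} (d : β) (hf : Primrec f)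
    (hg : Primrec g) : Primrec fun x => (f x).getD (g x) d := (Primrec.list_getD d).comp hf hg

theorem primrec_ite_bool {c : α → Bool} {f g : α → β} (hc : Primrec c) (hf : Primrec f)
    (hg : Primrec g) : Primrec fun x => if c x then f x else g x :=
  (Primrec.cond hc hf hg).of_eq fun x => by cases c x <;> rfl

@[fun_prop] theorem primrec_lay {κ cnt : α → ℕ} {F : α → ℕ → List Addr} (hκ : Primrec κ)
    (hc : Primrec cnt) (hF : Primrec fun p : α × ℕ => F p.1 p.2) :
    Primrec fun x => lay (κ x) (cnt x) (F x) := by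
  unfold lay; fun_prop

@[fun_prop] theorem primrec_loop {κ w cnt : α → ℕ} {F : α → ℕ → ℕ → List Addr} (hκ : Primrec κ)
    (hw : Primrec w) (hc : Primrec cnt) (hF : Primrec fun p : (α × ℕ) × ℕ => F p.1.1 p.1.2 p.2) :
    Primrec fun x => loop (κ x) (w x) (cnt x) (F x) := by
  exact primrec_map (by fun_prop) (primrec_lay (F := fun (q : α × ℕ) => F q.1 q.2) (by fun_prop)
    (by fun_prop) hF)

@[fun_prop] theorem primrec_lo {d u : α → ℕ} (hd : Primrec d) (hu : Primrec u) :
    Primrec fun x => lo (d x) (u x) := by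
  unfold lo; fun_prop

@[fun_prop] theorem primrec_hi {st : α → Bool × ℕ} {u : α → ℕ} (hs : Primrec st) (hu : Primrec u) :
    Primrec fun x => hi (st x) (u x) := by
  unfold hi
  refine primrec_add (by fun_prop) (primrec_ite_bool (by fun_prop) (by fun_prop) (by fun_prop))

@[fun_prop] theorem primrec_stages {L : α → ℕ} (h : Primrec L) : Primrec fun x => stages (L x) := by
  unfold stages; fun_prop

@[fun_prop] theorem primrec_stageProg {ρ w h : α → ℕ} {st : α → Bool × ℕ} (h1 : Primrec ρ)
    (h2 : Primrec w) (h3 : Primrec h) (h4 : Primrec st) :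
    Primrec fun x => stageProg (ρ x) (w x) (h x) (st x) := by
  unfold stageProg; fun_prop

@[fun_prop] theorem primrec_sortProg {ρ w h : α → ℕ} {st : α → List (Bool × ℕ)} (h1 : Primrec ρ)
    (h2 : Primrec w) (h3 : Primrec h) (h4 : Primrec st) :
    Primrec fun x => sortProg (ρ x) (w x) (h x) (st x) := by
  unfold sortProg; fun_prop

@[fun_prop] theorem primrec_oracle {n l a k : α → ℕ} (hn : Primrec n) (hl : Primrec l)
    (ha : Primrec a) (hk : Primrec k) : Primrec fun x => oracle (n x) (l x) (a x) (k x) := by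
  unfold oracle fanProg loadProg adjProg sortedReg nStages workBase qbits; fun_prop

@[fun_prop] theorem primrec_groverIter {n l a k : α → ℕ} (hn : Primrec n) (hl : Primrec l)
    (ha : Primrec a) (hk : Primrec k) : Primrec fun x => groverIter (n x) (l x) (a x) (k x) := by
  unfold groverIter zedLayer zeroTest hadLayer pairReg sortedReg nStages workBase qbits; fun_prop

@[fun_prop] theorem primrec_searchRun {n l a k : α → ℕ} (hn : Primrec n) (hl : Primrec l)
    (ha : Primrec a) (hk : Primrec k) : Primrec fun x => searchRun (n x) (l x) (a x) (k x) := by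
  unfold searchRun hadLayer extract pairReg sortedReg nStages workBase qbits; fun_prop

@[fun_prop] theorem primrec_program {n l a : α → ℕ} (hn : Primrec n) (hl : Primrec l)
    (ha : Primrec a) : Primrec fun x => program (n x) (l x) (a x) := by
  unfold program; fun_prop

theorem primrec_layerCode {R W : α → ℕ} {ℓ : α → Layer} (hR : Primrec R) (hW : Primrec W)
    (hl : Primrec ℓ) : Primrec fun x => layerCode (R x) (W x) (ℓ x) := by
  unfold layerCode
  refine Primrec.ite (Primrec.eq.comp (by fun_prop) (by fun_prop)) ?_ ?_
  · unfold enc; fun_prop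
  · unfold Kind.pats enc; fun_prop

@[fun_prop] theorem primrec_stepCodes {n l a : α → ℕ} (hn : Primrec n) (hl : Primrec l)
    (ha : Primrec a) : Primrec fun x => stepCodes (n x) (l x) (a x) := by
  unfold stepCodes nCols
  exact primrec_flatMap (by fun_prop) (primrec_layerCode (by fun_prop) (by fun_prop) (by fun_prop))

@[fun_prop] theorem primrec_workWires {n l a : α → ℕ} (hn : Primrec n) (hl : Primrec l)
    (ha : Primrec a) : Primrec fun x => workWires (n x) (l x) (a x) := by
  unfold workWires nRegions nStages nCols; fun_prop

@[fun_prop] theorem primrec_logBlock {n S : α → ℕ} (hn : Primrec n) (hS : Primrec S) :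
    Primrec fun x => logBlock (n x) (S x) := by
  refine Primrec.nat_findGreatest hn ?_
  exact PrimrecRel.comp Primrec.nat_le (by fun_prop) (by fun_prop)

end Primrec

/-- The numerical description of the template is computable. -/
theorem computable_template_code :
    Computable fun p : ℕ × ℕ × ℕ =>
      (workWires p.1 (logBlock p.1 p.2.1) p.2.2, stepCodes p.1 (logBlock p.1 p.2.1) p.2.2) := by
  refine Primrec.to_comp ?_
  fun_prop

/-! ### Classical semantics -/

/-- Contents of the logical wires. -/
abbrev Mem : Type := Addr → Bool

namespace Kind

def monomials (κ : ℕ) : List (List ℕ) := monTable.getD (κ - 3) []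

/-- Value of a monomial of degree at most two. -/
def evalMon (e : List Bool) : List ℕ → Bool
  | [] => true
  | [i] => e.getD i false
  | i :: j :: _ => e.getD i false && e.getD j false

/-- Value of the polynomial of an operation. -/
def poly (κ : ℕ) (e : List Bool) : Bool :=
  ((monomials κ).map (evalMon e)).foldr xor false

@[simp] theorem poly_copy (x : Bool) : poly copy [x] = x := by cases x <;> rfl
@[simp] theorem poly_one (e : List Bool) : poly one e = true := rfl
@[simp] theorem poly_mux (c x y : Bool) : poly mux [c, x, y] = if c then x else y := by
  cases c <;> cases x <;> cases y <;> rfl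
@[simp] theorem poly_gt (x y g : Bool) :
    poly gt [x, y, g] = if x == y then g else x := by
  cases x <;> cases y <;> cases g <;> rfl
@[simp] theorem poly_eq (x y g : Bool) : poly eq [x, y, g] = (g && (x == y)) := by
  cases x <;> cases y <;> cases g <;> rfl
@[simp] theorem poly_and (x y : Bool) : poly and [x, y] = (x && y) := by
  cases x <;> cases y <;> rfl
@[simp] theorem poly_notCopy (x : Bool) : poly notCopy [x] = !x := by cases x <;> rfl
@[simp] theorem poly_nor (x y : Bool) : poly nor [x, y] = (!x && !y) := by
  cases x <;> cases y <;> rfl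
@[simp] theorem poly_andNot (x y : Bool) : poly andNot [x, y] = (x && !y) := by
  cases x <;> cases y <;> rfl

/-- Number of wires of an operation, for calls of a circuit on `m` wires. -/
def arity (m κ : ℕ) : ℕ := [m, 1, 1, 2, 1, 4, 4, 4, 3, 2, 3, 3].getD κ 0

end Kind

section Exec

variable {n : ℕ} (f : Bits n → Bits n)

/-- The effect of a call. -/
def callAct (ws : List Addr) (σ : Mem) : Mem := fun v =>
  if h : n ≤ ws.idxOf v ∧ ws.idxOf v < n + n then
    xor (σ v) (f (fun j => (ws.map σ).getD j false) ⟨ws.idxOf v - n, by omega⟩)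
  else σ v

/-- The effect of a polynomial operation. -/
def polyAct (κ : ℕ) : List Addr → Mem → Mem
  | [], σ => σ
  | z :: cs, σ => Function.update σ z (xor (σ z) (Kind.poly κ (cs.map σ)))

/-- The effect of an operation. -/
def act (κ : ℕ) (ws : List Addr) (σ : Mem) : Mem :=
  if κ = 0 then callAct f ws σ else polyAct κ ws σ

def execLayer (ℓ : Layer) (σ : Mem) : Mem := ℓ.2.foldl (fun τ ws => act f ℓ.1 ws τ) σ

/-- The effect of a classical program. -/
def exec (P : List Layer) (σ : Mem) : Mem := P.foldl (fun τ ℓ => execLayer f ℓ τ) σ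

@[simp] theorem exec_nil (σ : Mem) : exec f [] σ = σ := rfl

@[simp] theorem exec_cons (ℓ : Layer) (P : List Layer) (σ : Mem) :
    exec f (ℓ :: P) σ = exec f P (execLayer f ℓ σ) := rfl

theorem exec_append (P Q : List Layer) (σ : Mem) :
    exec f (P ++ Q) σ = exec f Q (exec f P σ) := List.foldl_append

/-- The wires of a program. -/
def wires (P : List Layer) : List Addr := P.flatMap fun ℓ => ℓ.2.flatten

theorem act_of_notMem (κ : ℕ) {ws : List Addr} {v : Addr} (hl : κ = 0 → n + n ≤ ws.length)
    (hv : v ∉ ws) (σ : Mem) : act f κ ws σ v = σ v := by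
  unfold act
  split_ifs with h0
  · unfold callAct
    rw [dif_neg]
    -- An absent wire has index `ws.length`, which the length hypothesis keeps outside the target
    -- window from `n` to `n + n`.
    rw [List.idxOf_eq_length hv]
    have := hl h0
    omega
  · cases ws with
    | nil => rfl
    | cons z cs =>
      simp only [List.mem_cons, not_or] at hv
      simp [polyAct, hv.1]

theorem act_congr (κ : ℕ) {ws : List Addr} {σ τ : Mem} (h : ∀ v ∈ ws, σ v = τ v) :
    ∀ v ∈ ws, act f κ ws σ v = act f κ ws τ v := by
  intro v hv
  have hm : ws.map σ = ws.map τ := List.map_congr_left h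
  unfold act
  split_ifs
  · unfold callAct
    rw [h v hv, hm]
  · cases ws with
    | nil => exact h v hv
    | cons z cs =>
      have hc : cs.map σ = cs.map τ := by simpa using (List.cons.inj hm).2
      by_cases hz : v = z
      · subst hz; simp [polyAct, hc, h v hv]
      · simp [polyAct, hz, h v hv]

/-- A call leaves its argument register unchanged, and a polynomial operation does not read its
target since the wires are distinct. So the second application adds the same value again. -/
theorem act_act (κ : ℕ) {ws : List Addr} (hn : ws.Nodup) (hl : κ = 0 → n + n ≤ ws.length)
    (σ : Mem) : act f κ ws (act f κ ws σ) = σ := by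
  unfold act
  split_ifs with h0
  · have hl := hl h0
    have hx : ∀ j : Fin n, ((ws.map (callAct f ws σ)).getD j false) = (ws.map σ).getD j false := by
      intro j
      have hj : (j : ℕ) < ws.length := by omega
      simp only [List.getD_eq_getElem?_getD, List.getElem?_map, List.getElem?_eq_getElem hj,
        Option.map_some, Option.getD_some, callAct, List.Nodup.idxOf_getElem hn]
      rw [dif_neg (by omega)]
    funext v
    by_cases h : n ≤ ws.idxOf v ∧ ws.idxOf v < n + n
    · have h2 : callAct f ws (callAct f ws σ) v = xor (callAct f ws σ v)
          (f (fun j => (ws.map (callAct f ws σ)).getD j false) ⟨ws.idxOf v - n, by omega⟩) :=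
        dif_pos h
      have h1 : callAct f ws σ v = xor (σ v)
          (f (fun j => (ws.map σ).getD j false) ⟨ws.idxOf v - n, by omega⟩) := dif_pos h
      rw [h2, funext hx, h1]
      simp
    · have h2 : callAct f ws (callAct f ws σ) v = callAct f ws σ v := dif_neg h
      have h1 : callAct f ws σ v = σ v := dif_neg h
      rw [h2, h1]
  · cases ws with
    | nil => rfl
    | cons z cs =>
      have hz : z ∉ cs := (List.nodup_cons.1 hn).1
      have hc : ∀ b, cs.map (Function.update σ z b) = cs.map σ := fun b =>
        List.map_congr_left fun v hv => Function.update_of_ne (ne_of_mem_of_not_mem hv hz) _ _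
      simp [polyAct, hc]

/-- Well-formed layers, for calls of a circuit on `m` wires and logical wires satisfying `B`. -/
structure Layer.OK (m : ℕ) (B : Addr → Prop) (ℓ : Layer) : Prop where
  ne_nil : ℓ.2 ≠ []
  nodup : ℓ.2.flatten.Nodup
  kind : ℓ.1 < 12
  length : ∀ ws ∈ ℓ.2, ws.length = Kind.arity m ℓ.1
  bounded : ∀ ws ∈ ℓ.2, ∀ v ∈ ws, B v

variable {f} {a : ℕ} {B : Addr → Prop}

theorem foldl_act_of_notMem {κ : ℕ} {L : List (List Addr)} {v : Addr}
    (hl : ∀ ws ∈ L, κ = 0 → n + n ≤ ws.length) (hv : v ∉ L.flatten) (σ : Mem) :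
    L.foldl (fun τ ws => act f κ ws τ) σ v = σ v := by
  induction L generalizing σ with
  | nil => rfl
  | cons ws L ih =>
    simp only [List.flatten_cons, List.mem_append, not_or] at hv
    rw [List.foldl_cons, ih (fun ws h => hl ws (List.mem_cons_of_mem _ h)) hv.2,
      act_of_notMem f κ (hl ws List.mem_cons_self) hv.1]

/-- The operations of a layer use disjoint wires: earlier ones do not affect what `ws` reads, and
later ones do not affect what it wrote. -/
theorem foldl_act_of_mem {κ : ℕ} {L : List (List Addr)} {v : Addr} {ws : List Addr}
    (hl : ∀ ws ∈ L, κ = 0 → n + n ≤ ws.length) (hn : L.flatten.Nodup) (hw : ws ∈ L) (hv : v ∈ ws)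
    (σ : Mem) :
    L.foldl (fun τ ws => act f κ ws τ) σ v = act f κ ws σ v := by
  induction L generalizing σ with
  | nil => simp at hw
  | cons ws' L ih =>
    have hl' : ∀ ws ∈ L, κ = 0 → n + n ≤ ws.length := fun ws h => hl ws (List.mem_cons_of_mem _ h)
    rw [List.flatten_cons, List.nodup_append] at hn
    rw [List.foldl_cons]
    rcases List.mem_cons.1 hw with rfl | hw
    · rw [foldl_act_of_notMem hl' (fun h => hn.2.2 v hv v h rfl)]
    · rw [ih hl' hn.2.1 hw]
      refine act_congr f κ (fun x hx => ?_) v hv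
      refine act_of_notMem f κ (hl ws' List.mem_cons_self) (fun h => ?_) σ
      exact hn.2.2 x h x (List.mem_flatten.2 ⟨ws, hw, hx⟩) rfl

namespace Layer.OK

variable {ℓ : Layer} (h : ℓ.OK (n + n + a) B)
include h

theorem le_length : ∀ ws ∈ ℓ.2, ℓ.1 = 0 → n + n ≤ ws.length := by
  intro ws hw h0
  have := h.length ws hw
  rw [h0] at this
  simp [Kind.arity] at this
  omega

theorem nodup_of_mem {ws : List Addr} (hw : ws ∈ ℓ.2) : ws.Nodup :=
  (List.nodup_flatten.1 h.nodup).1 ws hw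

theorem exec_of_notMem {v : Addr} (hv : v ∉ ℓ.2.flatten) (σ : Mem) : execLayer f ℓ σ v = σ v :=
  foldl_act_of_notMem h.le_length hv σ

theorem exec_of_mem {v : Addr} {ws : List Addr} (hw : ws ∈ ℓ.2) (hv : v ∈ ws) (σ : Mem) :
    execLayer f ℓ σ v = act f ℓ.1 ws σ v :=
  foldl_act_of_mem h.le_length h.nodup hw hv σ

theorem exec_exec (σ : Mem) : execLayer f ℓ (execLayer f ℓ σ) = σ := by
  funext v
  by_cases hv : v ∈ ℓ.2.flatten
  · obtain ⟨ws, hw, hvw⟩ := List.mem_flatten.1 hv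
    rw [h.exec_of_mem hw hvw,
      act_congr f ℓ.1 (fun x hx => h.exec_of_mem (f := f) hw hx σ) v hvw,
      act_act f ℓ.1 (h.nodup_of_mem hw) (h.le_length ws hw)]
  · rw [h.exec_of_notMem hv, h.exec_of_notMem hv]

theorem exec_congr {σ τ : Mem} {S : Set Addr} (hS : ∀ v ∈ ℓ.2.flatten, v ∈ S)
    (hστ : ∀ v ∈ S, σ v = τ v) : ∀ v ∈ S, execLayer f ℓ σ v = execLayer f ℓ τ v := by
  intro v hv
  by_cases hm : v ∈ ℓ.2.flatten
  · obtain ⟨ws, hw, hvw⟩ := List.mem_flatten.1 hm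
    rw [h.exec_of_mem hw hvw, h.exec_of_mem hw hvw]
    exact act_congr f ℓ.1 (fun x hx => hστ x (hS x (List.mem_flatten.2 ⟨ws, hw, hx⟩))) v hvw
  · rw [h.exec_of_notMem hm, h.exec_of_notMem hm, hστ v hv]

end Layer.OK

section Programs

variable {P Q : List Layer}

theorem exec_frame (h : ∀ ℓ ∈ P, ℓ.OK (n + n + a) B) {v : Addr} (hv : v ∉ wires P) (σ : Mem) :
    exec f P σ v = σ v := by
  induction P generalizing σ with
  | nil => rfl
  | cons ℓ P ih =>
    simp only [wires, List.flatMap_cons, List.mem_append, not_or] at hv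
    rw [exec_cons, ih (fun ℓ h' => h ℓ (List.mem_cons_of_mem _ h')) hv.2,
      (h ℓ List.mem_cons_self).exec_of_notMem hv.1]

theorem exec_congr (h : ∀ ℓ ∈ P, ℓ.OK (n + n + a) B) {σ τ : Mem} {S : Set Addr}
    (hS : ∀ v ∈ wires P, v ∈ S) (hστ : ∀ v ∈ S, σ v = τ v) :
    ∀ v ∈ S, exec f P σ v = exec f P τ v := by
  induction P generalizing σ τ with
  | nil => exact hστ
  | cons ℓ P ih =>
    simp only [wires, List.flatMap_cons, List.mem_append] at hS
    exact ih (fun ℓ h' => h ℓ (List.mem_cons_of_mem _ h')) (fun v hv => hS v (Or.inr hv))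
      ((h ℓ List.mem_cons_self).exec_congr (fun v hv => hS v (Or.inl hv)) hστ)

theorem exec_reverse (h : ∀ ℓ ∈ P, ℓ.OK (n + n + a) B) (σ : Mem) :
    exec f P.reverse (exec f P σ) = σ := by
  induction P generalizing σ with
  | nil => rfl
  | cons ℓ P ih =>
    rw [List.reverse_cons, exec_append, exec_cons f ℓ P,
      ih fun ℓ h' => h ℓ (List.mem_cons_of_mem _ h')]
    exact (h ℓ List.mem_cons_self).exec_exec σ

/-- The ancillas of all calls are zero when the call is made. -/
def CallsClean (f : Bits n → Bits n) : List Layer → Mem → Prop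
  | [], _ => True
  | ℓ :: P, σ => (ℓ.1 = 0 → ∀ ws ∈ ℓ.2, ∀ v ∈ ws.drop (n + n), σ v = false) ∧
      CallsClean f P (execLayer f ℓ σ)

theorem callsClean_append {σ : Mem} :
    CallsClean f (P ++ Q) σ ↔ CallsClean f P σ ∧ CallsClean f Q (exec f P σ) := by
  induction P generalizing σ with
  | nil => simp [CallsClean]
  | cons ℓ P ih => simp [CallsClean, ih, and_assoc]

theorem callsClean_of_forall_ne (h : ∀ ℓ ∈ P, ℓ.1 ≠ 0) (σ : Mem) : CallsClean f P σ := by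
  induction P generalizing σ with
  | nil => trivial
  | cons ℓ P ih =>
    exact ⟨fun h0 => absurd h0 (h ℓ List.mem_cons_self),
      ih (fun ℓ h' => h ℓ (List.mem_cons_of_mem _ h')) _⟩

theorem CallsClean.congr (h : ∀ ℓ ∈ P, ℓ.OK (n + n + a) B) {σ τ : Mem} {S : Set Addr}
    (hS : ∀ v ∈ wires P, v ∈ S) (hστ : ∀ v ∈ S, σ v = τ v) (hc : CallsClean f P σ) :
    CallsClean f P τ := by
  induction P generalizing σ τ with
  | nil => trivial
  | cons ℓ P ih =>
    simp only [wires, List.flatMap_cons, List.mem_append] at hS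
    refine ⟨fun h0 ws hw v hv => ?_, ih (fun ℓ h' => h ℓ (List.mem_cons_of_mem _ h'))
      (fun v hv => hS v (Or.inr hv))
      ((h ℓ List.mem_cons_self).exec_congr (fun v hv => hS v (Or.inl hv)) hστ) hc.2⟩
    rw [← hστ v (hS v (Or.inl (List.mem_flatten.2 ⟨ws, hw, List.mem_of_mem_drop hv⟩)))]
    exact hc.1 h0 ws hw v hv

/-- A call changes only its second register. Ancillas that are clean before it are therefore clean
after it, which is when the uncomputing call takes place. -/
theorem CallsClean.reverse (h : ∀ ℓ ∈ P, ℓ.OK (n + n + a) B) {σ : Mem} (hc : CallsClean f P σ) :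
    CallsClean f P.reverse (exec f P σ) := by
  induction P generalizing σ with
  | nil => trivial
  | cons ℓ P ih =>
    have hP : ∀ ℓ ∈ P, ℓ.OK (n + n + a) B := fun ℓ h' => h ℓ (List.mem_cons_of_mem _ h')
    have hℓ := h ℓ List.mem_cons_self
    rw [List.reverse_cons, callsClean_append, exec_cons, exec_reverse hP]
    refine ⟨ih hP hc.2, fun h0 ws hw v hv => ?_, trivial⟩
    have hvw := List.mem_of_mem_drop hv
    rw [hℓ.exec_of_mem hw hvw, ← hc.1 h0 ws hw v hv]
    unfold act
    rw [if_pos h0]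
    refine dif_neg fun hi => ?_
    obtain ⟨i, hi', rfl⟩ := List.mem_iff_getElem.1 hv
    rw [List.getElem_drop, (hℓ.nodup_of_mem hw).idxOf_getElem] at hi
    omega

end Programs

/-! ### Straight-line programs -/

/-- If targets are distinct and none is read before or while it is written, the operands of every
step already have their final values when they are read. The execution then amounts to a system of
equations about the final memory alone, which is the convenient form for chains of dependent steps.
-/
theorem foldl_polyAct {ι : Type*} {κ : ℕ} {T : ι → Addr} {C : ι → List Addr} {I : List ι}
    (hp : I.Pairwise fun i j => T i ≠ T j ∧ T j ∉ C i) (hs : ∀ i ∈ I, T i ∉ C i) (σ : Mem) :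
    (∀ i ∈ I, I.foldl (fun τ i => polyAct κ (T i :: C i) τ) σ (T i) =
      xor (σ (T i)) (Kind.poly κ ((C i).map
        (I.foldl (fun τ i => polyAct κ (T i :: C i) τ) σ)))) ∧
    ∀ v, (∀ i ∈ I, v ≠ T i) → I.foldl (fun τ i => polyAct κ (T i :: C i) τ) σ v = σ v := by
  induction I generalizing σ with
  | nil => simp
  | cons i I ih =>
    rw [List.pairwise_cons] at hp
    obtain ⟨ih1, ih2⟩ := ih hp.2 (fun j hj => hs j (List.mem_cons_of_mem _ hj))
      (polyAct κ (T i :: C i) σ)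
    have hstep : ∀ v, v ≠ T i → polyAct κ (T i :: C i) σ v = σ v := fun v hv => by
      simp [polyAct, hv]
    refine ⟨fun j hj => ?_, fun v hv => ?_⟩
    · rw [List.foldl_cons]
      rcases List.mem_cons.1 hj with rfl | hj
      · rw [ih2 _ fun k hk => (hp.1 k hk).1]
        have : (C j).map (I.foldl (fun τ i => polyAct κ (T i :: C i) τ)
            (polyAct κ (T j :: C j) σ)) = (C j).map σ := by
          refine List.map_congr_left fun v hv => ?_
          rw [ih2 _ fun k hk e => (hp.1 k hk).2 (e ▸ hv), hstep]
          rintro rfl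
          exact hs j List.mem_cons_self hv
        rw [this]
        simp [polyAct]
      · rw [ih1 j hj, hstep]
        exact (hp.1 j hj).1.symm
    · rw [List.foldl_cons, ih2 v fun k hk => hv k (List.mem_cons_of_mem _ hk),
        hstep v (hv i List.mem_cons_self)]

theorem exec_loop_eq (κ : ℕ) (hκ : κ ≠ 0) (w cnt : ℕ) (F : ℕ → ℕ → List Addr) (σ : Mem) :
    exec f (loop κ w cnt F) σ =
      ((List.range w).flatMap fun b => (List.range cnt).map fun u => (b, u)).foldl
        (fun τ i => polyAct κ (F i.1 i.2) τ) σ := by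
  simp only [exec, loop, List.foldl_map, execLayer, lay, List.foldl_flatMap, act, if_neg hκ]

/-- A loop whose targets are distinct and not read before they are written. -/
theorem exec_loop {κ : ℕ} (hκ : κ ≠ 0) {w cnt : ℕ} {T : ℕ → ℕ → Addr} {C : ℕ → ℕ → List Addr}
    (hT : ∀ b < w, ∀ b' < w, ∀ u < cnt, ∀ u' < cnt, T b u = T b' u' → b = b' ∧ u = u')
    (hC : ∀ b < w, ∀ b' ≤ b, ∀ u < cnt, ∀ u' < cnt, T b u ∉ C b' u') (σ : Mem) :
    (∀ b < w, ∀ u < cnt, exec f (loop κ w cnt fun b u => T b u :: C b u) σ (T b u) =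
      xor (σ (T b u)) (Kind.poly κ ((C b u).map
        (exec f (loop κ w cnt fun b u => T b u :: C b u) σ)))) ∧
    ∀ v, (∀ b < w, ∀ u < cnt, v ≠ T b u) →
      exec f (loop κ w cnt fun b u => T b u :: C b u) σ v = σ v := by
  rw [exec_loop_eq κ hκ]
  have key := foldl_polyAct (κ := κ) (T := fun i : ℕ × ℕ => T i.1 i.2)
    (C := fun i : ℕ × ℕ => C i.1 i.2)
    (I := (List.range w).flatMap fun b => (List.range cnt).map fun u => (b, u)) ?_ ?_ σ
  · refine ⟨fun b hb u hu => key.1 (b, u) ?_, fun v hv => key.2 v ?_⟩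
    · simp [hb, hu]
    · intro i hi
      simp only [List.mem_flatMap, List.mem_range, List.mem_map] at hi
      obtain ⟨b, hb, u, hu, rfl⟩ := hi
      exact hv b hb u hu
  · rw [List.pairwise_flatMap]
    refine ⟨fun b hb => ?_, ?_⟩
    · rw [List.pairwise_map]
      refine List.Pairwise.imp_of_mem ?_ List.pairwise_lt_range
      intro u u' hu hu' hlt
      rw [List.mem_range] at hb hu hu'
      exact ⟨fun e => by have := (hT b hb b hb u hu u' hu' e).2; omega,
        hC b hb b le_rfl u' hu' u hu⟩
    · refine List.Pairwise.imp_of_mem ?_ List.pairwise_lt_range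
      intro b b' hb hb' hlt i hi j hj
      rw [List.mem_range] at hb hb'
      simp only [List.mem_map, List.mem_range] at hi hj
      obtain ⟨u, hu, rfl⟩ := hi
      obtain ⟨u', hu', rfl⟩ := hj
      exact ⟨fun e => by have := (hT b hb b' hb' u hu u' hu' e).1; omega,
        hC b' hb' b hlt.le u' hu' u hu⟩
  · intro i hi
    simp only [List.mem_flatMap, List.mem_range, List.mem_map] at hi
    obtain ⟨b, hb, u, hu, rfl⟩ := hi
    exact hC b hb b le_rfl u hu u hu

end Exec

/-! ### Gates -/

namespace Gate

variable {w : ℕ}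

theorem isLinearMap_apply (g : Gate w) : IsLinearMap ℂ g.apply := by
  cases g with
  | one U q =>
    refine ⟨fun φ ψ => ?_, fun c ψ => ?_⟩ <;> funext x <;>
      simp only [apply, Pi.add_apply, Pi.smul_apply, smul_eq_mul, mul_add, Finset.sum_add_distrib,
        Finset.mul_sum]
    exact Finset.sum_congr rfl fun b _ => by ring
  | two U q r h =>
    refine ⟨fun φ ψ => ?_, fun c ψ => ?_⟩ <;> funext x <;>
      simp only [apply, Pi.add_apply, Pi.smul_apply, smul_eq_mul, mul_add, Finset.sum_add_distrib,
        Finset.mul_sum]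
    exact Finset.sum_congr rfl fun b _ => by ring

theorem apply_comm {g g' : Gate w} (h : Disjoint g.support g'.support) (ψ : State w) :
    g.apply (g'.apply ψ) = g'.apply (g.apply ψ) := by
  funext x
  cases g with
  | one U q =>
    cases g' with
    | one V r =>
      simp only [support, Finset.disjoint_singleton] at h
      simp only [apply, Finset.mul_sum, Function.update_of_ne h, Function.update_of_ne h.symm]
      rw [Finset.sum_comm]
      refine Finset.sum_congr rfl fun b _ => Finset.sum_congr rfl fun c _ => ?_
      rw [Function.update_comm h]; ring
    | two V r t hrt =>
      simp only [support, Finset.disjoint_singleton_left, Finset.mem_insert, Finset.mem_singleton,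
        not_or] at h
      simp only [apply, Finset.mul_sum, Function.update_of_ne h.1, Function.update_of_ne h.2,
        Function.update_of_ne (Ne.symm h.1), Function.update_of_ne (Ne.symm h.2)]
      rw [Finset.sum_comm]
      refine Finset.sum_congr rfl fun b _ => Finset.sum_congr rfl fun c _ => ?_
      rw [Function.update_comm h.1, Function.update_comm h.2]; ring
  | two U p q hpq =>
    cases g' with
    | one V r =>
      simp only [support, Finset.disjoint_singleton_right, Finset.mem_insert, Finset.mem_singleton,
        not_or] at h
      simp only [apply, Finset.mul_sum, Function.update_of_ne h.1, Function.update_of_ne h.2,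
        Function.update_of_ne (Ne.symm h.1), Function.update_of_ne (Ne.symm h.2)]
      rw [Finset.sum_comm]
      refine Finset.sum_congr rfl fun b _ => Finset.sum_congr rfl fun c _ => ?_
      rw [Function.update_comm h.1, Function.update_comm h.2]; ring
    | two V r t hrt =>
      simp only [support, Finset.disjoint_left, Finset.mem_insert, Finset.mem_singleton,
        not_or, forall_eq_or_imp, forall_eq] at h
      obtain ⟨⟨h1, h2⟩, h3, h4⟩ := h
      simp only [apply, Finset.mul_sum, Function.update_of_ne h1, Function.update_of_ne h2,
        Function.update_of_ne h3, Function.update_of_ne h4, Function.update_of_ne (Ne.symm h1),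
        Function.update_of_ne (Ne.symm h2), Function.update_of_ne (Ne.symm h3),
        Function.update_of_ne (Ne.symm h4)]
      rw [Finset.sum_comm]
      refine Finset.sum_congr rfl fun b _ => Finset.sum_congr rfl fun c _ => ?_
      rw [Function.update_comm h3, Function.update_comm h1, Function.update_comm h4,
        Function.update_comm h2]
      ring

theorem support_map {m : ℕ} (e : Fin m ↪ Fin w) (g : Gate m) :
    (g.map e).support = g.support.map e := by
  cases g <;> simp [support, map]

theorem apply_ket_one (U : Matrix.unitaryGroup Bool ℂ) (q : Fin w) (y : Bits w) :
    (one U q).apply (ket y) = ∑ b : Bool, U.1 b (y q) • ket (Function.update y q b) := by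
  funext x
  simp only [apply, ket, Finset.sum_apply, Pi.smul_apply, smul_eq_mul]
  by_cases hP : ∀ j, j ≠ q → x j = y j
  · have h1 : ∀ b, Function.update x q b = y ↔ b = y q := fun b => by
      rw [Function.update_eq_iff]; exact ⟨fun h => h.1, fun h => ⟨h, hP⟩⟩
    have h2 : ∀ b, x = Function.update y q b ↔ x q = b := fun b => by
      rw [Function.eq_update_iff]; exact ⟨fun h => h.1, fun h => ⟨h, hP⟩⟩
    simp [h1, h2]
  · have h1 : ∀ b, Function.update x q b ≠ y := fun b h => hP (Function.update_eq_iff.1 h).2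
    have h2 : ∀ b, x ≠ Function.update y q b := fun b h => hP (Function.eq_update_iff.1 h).2
    simp [h1, h2]

theorem apply_ket_two (U : Matrix.unitaryGroup (Bool × Bool) ℂ) (q r : Fin w) (h : q ≠ r)
    (y : Bits w) :
    (two U q r h).apply (ket y) = ∑ b : Bool × Bool,
      U.1 b (y q, y r) • ket (Function.update (Function.update y q b.1) r b.2) := by
  funext x
  simp only [apply, ket, Finset.sum_apply, Pi.smul_apply, smul_eq_mul]
  have key : ∀ (x y : Bits w) (b : Bool × Bool),
      Function.update (Function.update x q b.1) r b.2 = y ↔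
        b = (y q, y r) ∧ ∀ j, j ≠ q → j ≠ r → x j = y j := by
    intro x y b
    rw [Function.update_eq_iff]
    constructor
    · rintro ⟨h1, h2⟩
      have h3 := h2 q h
      rw [Function.update_self] at h3
      exact ⟨Prod.ext h3 h1, fun j hq hr => by rw [← h2 j hr, Function.update_of_ne hq]⟩
    · rintro ⟨rfl, h2⟩
      refine ⟨rfl, fun j hr => ?_⟩
      by_cases hq : j = q
      · subst hq; simp
      · rw [Function.update_of_ne hq, h2 j hq hr]
  simp only [eq_comm (a := x), key]
  by_cases hP : ∀ j, j ≠ q → j ≠ r → x j = y j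
  · have hP' : ∀ j, j ≠ q → j ≠ r → y j = x j := fun j h1 h2 => (hP j h1 h2).symm
    have e1 : ∀ b : Bool × Bool, (b = (y q, y r) ∧ ∀ j, j ≠ q → j ≠ r → x j = y j) ↔
        b = (y q, y r) := fun b => ⟨fun h => h.1, fun h => ⟨h, hP⟩⟩
    have e2 : ∀ b : Bool × Bool, (b = (x q, x r) ∧ ∀ j, j ≠ q → j ≠ r → y j = x j) ↔
        b = (x q, x r) := fun b => ⟨fun h => h.1, fun h => ⟨h, hP'⟩⟩
    simp [e1, e2]
  · have hP' : ¬ ∀ j, j ≠ q → j ≠ r → y j = x j :=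
      fun h => hP fun j h1 h2 => (h j h1 h2).symm
    have e1 : ∀ b : Bool × Bool, ¬ (b = (y q, y r) ∧ ∀ j, j ≠ q → j ≠ r → x j = y j) :=
      fun b h => hP h.2
    have e2 : ∀ b : Bool × Bool, ¬ (b = (x q, x r) ∧ ∀ j, j ≠ q → j ≠ r → y j = x j) :=
      fun b h => hP' h.2
    simp [e1, e2]

end Gate

/-! ### Subsystems -/

section Lift

variable {m w : ℕ} (e : Fin m ↪ Fin w) (z : Bits w)

open Classical in
/-- A state of the wires in the range of `e`, the other wires being in the state `z`. -/
def lift (ψ : State m) : State w :=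
  fun x => if ∀ j, j ∉ Set.range e → x j = z j then ψ (x ∘ e) else 0

theorem isLinearMap_lift : IsLinearMap ℂ (lift e z) := by
  refine ⟨fun φ ψ => ?_, fun c ψ => ?_⟩ <;> funext x <;> simp only [lift, Pi.add_apply,
    Pi.smul_apply] <;> split_ifs <;> simp

theorem lift_ket (y : Bits m) : lift e z (ket y) = ket (Function.extend e y z) := by
  funext x
  have : x = Function.extend e y z ↔ (∀ j, j ∉ Set.range e → x j = z j) ∧ x ∘ e = y := by
    constructor
    · rintro rfl
      refine ⟨fun j hj => Function.extend_apply' _ _ _ hj, ?_⟩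
      funext i; exact e.injective.extend_apply _ _ _
    · rintro ⟨h1, rfl⟩
      funext j
      by_cases hj : j ∈ Set.range e
      · obtain ⟨i, rfl⟩ := hj
        rw [e.injective.extend_apply]; rfl
      · rw [Function.extend_apply' _ _ _ hj, h1 j hj]
  simp only [lift, ket, this]
  split_ifs <;> simp_all

theorem lift_eq_sum (ψ : State m) :
    lift e z ψ = ∑ y : Bits m, ψ y • ket (Function.extend e y z) := by
  have : ψ = ∑ y : Bits m, ψ y • ket y := by
    funext x
    simp [ket, Finset.sum_apply]
  conv_lhs => rw [this]
  have hl := (isLinearMap_lift e z).mk'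
  rw [← IsLinearMap.mk'_apply (isLinearMap_lift e z), map_sum]
  simp [lift_ket]

/-- A gate renamed along `e` changes only wires in the range of `e`, so it preserves the condition
on the other wires and acts on the inner state. -/
theorem Gate.apply_map_lift (g : Gate m) (ψ : State m) :
    (g.map e).apply (lift e z ψ) = lift e z (g.apply ψ) := by
  funext x
  have hupd : ∀ (x : Bits w) (i : Fin m) (b : Bool),
      (∀ j, j ∉ Set.range e → Function.update x (e i) b j = z j) ↔
        ∀ j, j ∉ Set.range e → x j = z j := fun x i b =>
    forall_congr' fun j => imp_congr_right fun hj => by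
      rw [Function.update_of_ne fun h => hj ⟨i, h.symm⟩]
  have hcomp : ∀ (x : Bits w) (i : Fin m) (b : Bool),
      Function.update x (e i) b ∘ e = Function.update (x ∘ e) i b := fun x i b =>
    Function.update_comp_eq_of_injective x e.injective i b
  cases g with
  | one U q =>
    simp only [Gate.map, Gate.apply, lift, hupd, hcomp]
    split_ifs <;> simp
  | two U q r h =>
    simp only [Gate.map, Gate.apply, lift, hupd, hcomp]
    split_ifs <;> simp

theorem foldl_map_lift (L : List (Gate m)) (ψ : State m) :
    L.foldl (fun φ g => (g.map e).apply φ) (lift e z ψ) =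
      lift e z (L.foldl (fun φ g => g.apply φ) ψ) := by
  induction L generalizing ψ with
  | nil => rfl
  | cons g L ih => rw [List.foldl_cons, Gate.apply_map_lift, ih]; rfl

theorem foldl_foldl_map_lift (C : Circuit m) (ψ : State m) :
    C.foldl (fun φ K => K.foldl (fun χ g => (g.map e).apply χ) φ) (lift e z ψ) =
      lift e z (C.run ψ) := by
  induction C generalizing ψ with
  | nil => rfl
  | cons K C ih => rw [List.foldl_cons, foldl_map_lift, ih]; rfl

end Lift

/-! ### Decoding of templates -/

section Decode

/-- The basic gate with a given code. -/
def mkBasic (w : ℕ) : List ℕ → Option (BasicGate w)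
  | [0, q] => if h : q < w then some (.had ⟨q, h⟩) else none
  | [1, q] => if h : q < w then some (.t ⟨q, h⟩) else none
  | [2, q, r] =>
    if h : q < w ∧ r < w ∧ q ≠ r then
      some (.cnot ⟨q, h.1⟩ ⟨r, h.2.1⟩ fun h' => h.2.2 (Fin.mk.inj h')) else none
  | _ => none

/-- The embedding with a given list of values. -/
def mkEmb (m w : ℕ) (c : List ℕ) : Option (Fin m ↪ Fin w) :=
  if h : c.length = m ∧ c.Nodup ∧ ∀ x ∈ c, x < w then
    some ⟨fun i => ⟨c.get (i.cast h.1.symm), h.2.2 _ (List.get_mem _ _)⟩, fun _ _ hij =>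
      Fin.cast_injective _ (h.2.1.injective_get (Fin.mk.inj hij))⟩
  else none

/-- The template step with a given code. -/
def mkStep (m w : ℕ) (s : Bool × List (List ℕ)) : Step m w :=
  if s.1 then .calls (s.2.filterMap (mkEmb m w)) else .gates (s.2.filterMap (mkBasic w))

variable {m w : ℕ}

theorem code_of_mkBasic {c : List ℕ} {g : BasicGate w} (h : mkBasic w c = some g) :
    g.code = c := by
  unfold mkBasic at h
  split at h <;> first | (split_ifs at h; cases h; rfl) | cases h

theorem code_of_mkEmb {c : List ℕ} {e : Fin m ↪ Fin w} (h : mkEmb m w c = some e) :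
    (List.ofFn fun i => (e i).val) = c := by
  unfold mkEmb at h
  split_ifs at h with hc
  cases h
  obtain ⟨rfl, -⟩ := hc
  exact List.ofFn_get c

theorem map_filterMap_eq {α β : Type*} {d : α → Option β} {c : β → α}
    (hcd : ∀ x y, d x = some y → c y = x) {L : List α} (h : ∀ x ∈ L, (d x).isSome) :
    (L.filterMap d).map c = L := by
  induction L with
  | nil => rfl
  | cons x L ih =>
    obtain ⟨y, hy⟩ := Option.isSome_iff_exists.1 (h x List.mem_cons_self)
    rw [List.filterMap_cons_some hy, List.map_cons, hcd x y hy,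
      ih fun x hx => h x (List.mem_cons_of_mem _ hx)]

/-- Decoding silently drops invalid entries; the hypothesis that every entry decodes makes encoding
its left inverse. -/
theorem code_mkStep {s : Bool × List (List ℕ)}
    (h : ∀ c ∈ s.2, if s.1 then (mkEmb m w c).isSome else (mkBasic w c).isSome) :
    (mkStep m w s).code = s := by
  obtain ⟨b, L⟩ := s
  cases b
  · simp only [Bool.false_eq_true, if_false] at h
    simp only [mkStep, Bool.false_eq_true, if_false, Step.code]
    rw [map_filterMap_eq (fun _ _ => code_of_mkBasic) h]
  · simp only [if_true] at h
    simp only [mkStep, if_true, Step.code]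
    rw [map_filterMap_eq (fun _ _ => code_of_mkEmb) h]

/-- Application of the basic gate with a given code. -/
def applyCode (w : ℕ) (c : List ℕ) (ψ : State w) : State w :=
  match mkBasic w c with
  | some g => g.toGate.apply ψ
  | none => ψ

/-- Application of a circuit along the embedding with a given code. -/
def sliceCode (w : ℕ) (c : List ℕ) (K : List (Gate m)) (ψ : State w) : State w :=
  match mkEmb m w c with
  | some e => K.foldl (fun χ g => (g.map e).apply χ) ψ
  | none => ψ

theorem mem_support_mkBasic {c : List ℕ} {g : BasicGate w} (h : mkBasic w c = some g) {q : Fin w}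
    (hq : q ∈ g.toGate.support) : q.val ∈ c.tail := by
  unfold mkBasic at h
  split at h
  · split_ifs at h; cases h
    simp only [BasicGate.toGate, Gate.support, Finset.mem_singleton] at hq
    simp [hq]
  · split_ifs at h; cases h
    simp only [BasicGate.toGate, Gate.support, Finset.mem_singleton] at hq
    simp [hq]
  · split_ifs at h; cases h
    simp only [BasicGate.toGate, Gate.support, Finset.mem_insert, Finset.mem_singleton] at hq
    rcases hq with rfl | rfl <;> simp
  · cases h

theorem mem_of_mkEmb {c : List ℕ} {e : Fin m ↪ Fin w} (h : mkEmb m w c = some e) (i : Fin m) :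
    (e i).val ∈ c := by
  rw [← code_of_mkEmb h]
  exact List.mem_ofFn.2 ⟨i, rfl⟩

theorem disjoint_support_mkBasic {c c' : List ℕ} {g g' : BasicGate w} (h : mkBasic w c = some g)
    (h' : mkBasic w c' = some g') (hd : c.tail.Disjoint c'.tail) :
    Disjoint g.toGate.support g'.toGate.support :=
  Finset.disjoint_left.2 fun _ hq hq' => hd (mem_support_mkBasic h hq) (mem_support_mkBasic h' hq')

theorem disjoint_support_mkEmb {c c' : List ℕ} {e e' : Fin m ↪ Fin w} (h : mkEmb m w c = some e)
    (h' : mkEmb m w c' = some e') (hd : c.Disjoint c') (g g' : Gate m) :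
    Disjoint (g.map e).support (g'.map e').support := by
  rw [Gate.support_map, Gate.support_map, Finset.disjoint_left]
  intro q hq hq'
  obtain ⟨i, -, rfl⟩ := Finset.mem_map.1 hq
  obtain ⟨j, -, hj⟩ := Finset.mem_map.1 hq'
  exact hd (mem_of_mkEmb h i) (hj ▸ mem_of_mkEmb h' j)

/-- The head of a code is the kind of gate, hence the tails are the lists of wires. -/
theorem applyCode_comm {c c' : List ℕ} (hd : c.tail.Disjoint c'.tail) (ψ : State w) :
    applyCode w c (applyCode w c' ψ) = applyCode w c' (applyCode w c ψ) := by
  unfold applyCode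
  split
  · split
    · rename_i h _ g' h'
      exact Gate.apply_comm (disjoint_support_mkBasic h h' hd) ψ
    · rfl
  · rfl

theorem foldl_comm_of_comm {S ι : Type*} {A : S → S} {F : ι → S → S} {I : List ι}
    (h : ∀ i ∈ I, ∀ s, A (F i s) = F i (A s)) (s : S) :
    A (I.foldl (fun s i => F i s) s) = I.foldl (fun s i => F i s) (A s) := by
  induction I generalizing s with
  | nil => rfl
  | cons i I ih =>
    rw [List.foldl_cons, ih fun j hj => h j (List.mem_cons_of_mem _ hj),
      h i List.mem_cons_self, List.foldl_cons]

theorem sliceCode_comm {c c' : List ℕ} (hd : c.Disjoint c') (K K' : List (Gate m)) (ψ : State w) :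
    sliceCode w c K (sliceCode w c' K' ψ) = sliceCode w c' K' (sliceCode w c K ψ) := by
  unfold sliceCode
  split
  · split
    · rename_i e h _ e' h'
      refine foldl_comm_of_comm (A := fun ψ => K.foldl (fun χ g => (g.map e).apply χ) ψ)
        (F := fun g' χ => (Gate.map e' g').apply χ) (fun g' _ s => ?_) ψ
      refine (foldl_comm_of_comm (A := fun ψ => (g'.map e').apply ψ)
        (F := fun g χ => (Gate.map e g).apply χ) (fun g _ s => ?_) s).symm
      exact (Gate.apply_comm (disjoint_support_mkEmb h h' hd g g') s).symm
    · rfl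
  · rfl

/-- This exchanges the order "slice by slice, all components" with "component by component, all
slices". It needs only that different components commute; the slices of one component keep their
order. -/
theorem foldl_foldl_comm {S ι κ : Type*} {A : ι → κ → S → S} {I : List ι} (J : List κ)
    (h : I.Pairwise fun i i' => ∀ j j' s, A i j (A i' j' s) = A i' j' (A i j s)) (s : S) :
    J.foldl (fun s j => I.foldl (fun s i => A i j s) s) s =
      I.foldl (fun s i => J.foldl (fun s j => A i j s) s) s := by
  induction I generalizing s with
  | nil => simp
  | cons i I ih =>
    rw [List.pairwise_cons] at h
    rw [List.foldl_cons, ← ih h.2]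
    simp only [List.foldl_cons]
    have aux : ∀ (J : List κ) (s : S),
        J.foldl (fun s j => I.foldl (fun s i => A i j s) (A i j s)) s =
          J.foldl (fun s j => I.foldl (fun s i => A i j s) s) (J.foldl (fun s j => A i j s) s) := by
      intro J
      induction J with
      | nil => intro s; rfl
      | cons j J ihJ =>
        intro s
        rw [List.foldl_cons, ihJ, List.foldl_cons, List.foldl_cons]
        congr 1
        refine (foldl_comm_of_comm (A := fun s => I.foldl (fun s i => A i j s) s)
          (F := fun j s => A i j s) (fun j' _ s => ?_) _).symm
        refine (foldl_comm_of_comm (A := fun s => A i j' s) (F := fun i' s => A i' j s)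
          (fun i' hi' s => ?_) s).symm
        exact h.1 i' hi' j' j s
    exact aux J s

/-- The action of a step of a template, with the placeholder replaced by `C`. -/
theorem run_instantiate_mkStep (C : Circuit m) (s : Bool × List (List ℕ)) (ψ : State w) :
    Circuit.run ((mkStep m w s).instantiate C) ψ =
      if s.1 then C.foldl (fun φ K => s.2.foldl (fun χ c => sliceCode w c K χ) φ) ψ
      else s.2.foldl (fun φ c => applyCode w c φ) ψ := by
  obtain ⟨b, L⟩ := s
  cases b
  · simp only [mkStep, Bool.false_eq_true, if_false, Step.instantiate, Circuit.run,
      List.foldl_cons, List.foldl_nil, List.foldl_map, List.foldl_filterMap, applyCode]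
    congr 1
    funext φ c
    cases mkBasic w c <;> rfl
  · simp only [mkStep, if_true, Step.instantiate, Circuit.run, List.foldl_map, List.foldl_flatMap,
      List.foldl_filterMap, sliceCode]
    congr 1
    funext φ K
    congr 1
    funext χ c
    cases mkEmb m w c <;> rfl

end Decode

/-! ### Logical wires -/

/-- Logical wire of a physical wire. -/
def dec (R W j : ℕ) : Addr := (j / W / R, j / W % R, j % W)

/-- The logical wires in use. -/
def Bdd (P R W : ℕ) (v : Addr) : Prop := v.1 < P ∧ v.2.1 < R ∧ v.2.2 < W

theorem dec_enc {P R W : ℕ} {v : Addr} (h : Bdd P R W v) : dec R W (enc R W v) = v := by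
  obtain ⟨r, i, b⟩ := v
  obtain ⟨-, hi, hb⟩ := h
  have hW : (((r * R + i) * W + b) / W) = r * R + i := by
    rw [mul_comm, Nat.mul_add_div (by omega), Nat.div_eq_of_lt hb, add_zero]
  have hR : (r * R + i) / R = r := by
    rw [mul_comm, Nat.mul_add_div (by simp at hi; omega), Nat.div_eq_of_lt hi, add_zero]
  have h1 : (r * R + i) % R = i := by
    rw [mul_comm, Nat.mul_add_mod, Nat.mod_eq_of_lt hi]
  have h2 : ((r * R + i) * W + b) % W = b := by
    rw [mul_comm, Nat.mul_add_mod, Nat.mod_eq_of_lt hb]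
  simp only [dec, enc, hW, hR, h1, h2]

theorem enc_dec (R W j : ℕ) : enc R W (dec R W j) = j := by
  simp only [enc, dec]
  rw [mul_comm (j / W / R), Nat.div_add_mod, mul_comm, Nat.div_add_mod]

theorem enc_lt {P R W : ℕ} {v : Addr} (h : Bdd P R W v) : enc R W v < P * R * W := by
  obtain ⟨r, i, b⟩ := v
  obtain ⟨hr, hi, hb⟩ := h
  simp only [enc] at *
  have h1 : r * R + i < P * R := by nlinarith
  nlinarith

/-- The basis state of a memory. -/
def bitsOf (R W w : ℕ) (σ : Mem) : Bits w := fun j => σ (dec R W j)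

def memKet (R W w : ℕ) (σ : Mem) : State w := ket (bitsOf R W w σ)

section

variable {P R W w : ℕ} (hw : w = P * R * W)
include hw

theorem bitsOf_enc {v : Addr} (hv : Bdd P R W v) (σ : Mem) :
    bitsOf R W w σ ⟨enc R W v, hw ▸ enc_lt hv⟩ = σ v := by
  simp only [bitsOf]; rw [dec_enc hv]

theorem update_bitsOf {v : Addr} (hv : Bdd P R W v) (σ : Mem) (b : Bool) :
    Function.update (bitsOf R W w σ) ⟨enc R W v, hw ▸ enc_lt hv⟩ b =
      bitsOf R W w (Function.update σ v b) := by
  funext j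
  by_cases hj : dec R W j = v
  · have : j = ⟨enc R W v, hw ▸ enc_lt hv⟩ := Fin.ext (by
      show (j : ℕ) = enc R W v
      rw [← hj, enc_dec])
    subst this
    simp [bitsOf, dec_enc hv]
  · have : j ≠ ⟨enc R W v, hw ▸ enc_lt hv⟩ := fun h => hj (by rw [h]; exact dec_enc hv)
    simp [bitsOf, this, hj]

end

/-! ### Basic gates on basis states -/

/-- The eighth root of unity. -/
def omega8 : ℂ := Complex.exp (((Real.pi / 4 : ℝ) : ℂ) * Complex.I)

theorem omega8_pow_four : omega8 ^ 4 = -1 := by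
  rw [omega8, ← Complex.exp_nat_mul, ← Complex.exp_pi_mul_I]
  congr 1; push_cast; ring

/-- The normalization of the Hadamard gate. -/
def invSqrtTwo : ℂ := ((1 / Real.sqrt 2 : ℝ) : ℂ)

theorem invSqrtTwo_mul_self : invSqrtTwo * invSqrtTwo = 1 / 2 := by
  rw [invSqrtTwo, ← Complex.ofReal_mul, div_mul_div_comm, Real.mul_self_sqrt (by norm_num)]
  norm_num

theorem hadamard_apply (b c : Bool) :
    hadamard.1 b c = invSqrtTwo * if b && c then -1 else 1 := by
  simp only [hadamard, Matrix.of_apply, invSqrtTwo]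
  split_ifs <;> push_cast <;> ring

theorem isLinearMap_applyCode (w : ℕ) (c : List ℕ) : IsLinearMap ℂ (applyCode w c) := by
  unfold applyCode
  split
  · exact Gate.isLinearMap_apply _
  · exact ⟨fun _ _ => rfl, fun _ _ => rfl⟩

theorem isLinearMap_foldl {E ι : Type*} [AddCommGroup E] [Module ℂ E] {A : ι → E → E} {I : List ι}
    (h : ∀ i ∈ I, IsLinearMap ℂ (A i)) : IsLinearMap ℂ fun s => I.foldl (fun s i => A i s) s := by
  induction I with
  | nil => exact ⟨fun _ _ => rfl, fun _ _ => rfl⟩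
  | cons i I ih =>
    have ih := ih fun j hj => h j (List.mem_cons_of_mem _ hj)
    have hi := h i List.mem_cons_self
    exact ⟨fun x y => by simp only [List.foldl_cons, hi.map_add, ih.map_add],
      fun c x => by simp only [List.foldl_cons, hi.map_smul, ih.map_smul]⟩

/-- Application of a basic gate to the wires of an operation. -/
def applyPat (R W w : ℕ) (ws : List Addr) (p : ℕ × List ℕ) : State w → State w :=
  applyCode w (p.1 :: p.2.map fun i => enc R W (ws.getD i (0, 0, 0)))

/-- Successive application of basic gates. -/
def applyPats (R W w : ℕ) (ws : List Addr) (ps : List (ℕ × List ℕ)) (ψ : State w) : State w :=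
  ps.foldl (fun φ p => applyPat R W w ws p φ) ψ

theorem isLinearMap_applyPats (R W w : ℕ) (ws : List Addr) (ps : List (ℕ × List ℕ)) :
    IsLinearMap ℂ (applyPats R W w ws ps) :=
  isLinearMap_foldl fun _ _ => isLinearMap_applyCode w _

theorem applyPats_append (R W w : ℕ) (ws : List Addr) (ps qs : List (ℕ × List ℕ)) (ψ : State w) :
    applyPats R W w ws (ps ++ qs) ψ = applyPats R W w ws qs (applyPats R W w ws ps ψ) :=
  List.foldl_append

section Patterns

variable {P R W w : ℕ} (hw : w = P * R * W)
include hw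

theorem applyCode_had {v : Addr} (hv : Bdd P R W v) (σ : Mem) :
    applyCode w [0, enc R W v] (memKet R W w σ) =
      invSqrtTwo • (memKet R W w (Function.update σ v false) +
        (if σ v then -1 else 1 : ℂ) • memKet R W w (Function.update σ v true)) := by
  have hlt : enc R W v < w := hw ▸ enc_lt hv
  simp only [applyCode, mkBasic, dif_pos hlt, BasicGate.toGate, memKet]
  rw [Gate.apply_ket_one]
  simp only [Fintype.sum_bool, bitsOf_enc hw hv, update_bitsOf hw hv, hadamard_apply]
  rw [smul_add, smul_smul, add_comm]
  simp

theorem applyCode_t {v : Addr} (hv : Bdd P R W v) (σ : Mem) :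
    applyCode w [1, enc R W v] (memKet R W w σ) =
      (if σ v then omega8 else 1) • memKet R W w σ := by
  have hlt : enc R W v < w := hw ▸ enc_lt hv
  simp only [applyCode, mkBasic, dif_pos hlt, BasicGate.toGate, memKet]
  rw [Gate.apply_ket_one]
  simp only [Fintype.sum_bool, bitsOf_enc hw hv, update_bitsOf hw hv]
  cases h : σ v
  · have : Function.update σ v false = σ := by rw [← h, Function.update_eq_self]
    simp [tGate, this]
  · have : Function.update σ v true = σ := by rw [← h, Function.update_eq_self]
    simp [tGate, this, omega8]

theorem applyCode_cnot {u v : Addr} (hu : Bdd P R W u) (hv : Bdd P R W v) (huv : u ≠ v) (σ : Mem) :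
    applyCode w [2, enc R W u, enc R W v] (memKet R W w σ) =
      memKet R W w (Function.update σ v (xor (σ v) (σ u))) := by
  have h : enc R W u < w ∧ enc R W v < w ∧ enc R W u ≠ enc R W v :=
    ⟨hw ▸ enc_lt hu, hw ▸ enc_lt hv, fun h => huv (by rw [← dec_enc hu, h, dec_enc hv])⟩
  simp only [applyCode, mkBasic, dif_pos h, BasicGate.toGate, memKet]
  rw [Gate.apply_ket_two]
  simp only [bitsOf_enc hw hu, bitsOf_enc hw hv, update_bitsOf hw hu, update_bitsOf hw hv,
    cnotGate, Matrix.of_apply]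
  rw [Finset.sum_eq_single (σ u, xor (σ v) (σ u))]
  · simp
  · intro b _ hb
    rw [if_neg hb, zero_smul]
  · simp

theorem applyPats_z {ws : List Addr} (hv : Bdd P R W (ws.getD 0 (0, 0, 0))) (σ : Mem) :
    applyPats R W w ws Kind.zPats (memKet R W w σ) =
      (if σ (ws.getD 0 (0, 0, 0)) then -1 else 1 : ℂ) • memKet R W w σ := by
  have hl : ∀ (c : ℂ) ψ, applyCode w [1, enc R W (ws.getD 0 (0, 0, 0))] (c • ψ) =
      c • applyCode w [1, enc R W (ws.getD 0 (0, 0, 0))] ψ := (isLinearMap_applyCode w _).map_smul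
  simp only [applyPats, Kind.zPats, List.replicate, List.foldl_cons, List.foldl_nil, applyPat,
    List.map_cons, List.map_nil, applyCode_t hw hv, hl, smul_smul]
  congr 1
  split_ifs
  · rw [← omega8_pow_four]; ring
  · ring

/-- The gates accumulate the phase exp(iπ/4) to the power a + b + c − (a⊕b) − (b⊕c) − (a⊕c) +
(a⊕b⊕c) = 4abc. The CNOT gates produce the parities on the wires and then restore them; the inverse
of T is its seventh power. -/
theorem applyPats_ccz {ws : List Addr} {i j k : ℕ} {u v z : Addr} (hi : ws.getD i (0, 0, 0) = u)
    (hj : ws.getD j (0, 0, 0) = v) (hk : ws.getD k (0, 0, 0) = z) (hu : Bdd P R W u)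
    (hv : Bdd P R W v) (hz : Bdd P R W z) (huv : u ≠ v) (huz : u ≠ z) (hvz : v ≠ z) (σ : Mem) :
    applyPats R W w ws (Kind.cczPats i j k) (memKet R W w σ) =
      (if σ z && (σ u && σ v) then -1 else 1 : ℂ) • memKet R W w σ := by
  -- Basis states are indexed by the values of the three wires, with all other wires fixed. Each
  -- gate is then a permutation or a phase on eight vectors, and the claim is a finite check.
  obtain ⟨K, hK⟩ : ∃ K : Bool → Bool → Bool → State w, ∀ p q r, K p q r = memKet R W w
    (Function.update (Function.update (Function.update σ u p) v q) z r) := ⟨_, fun _ _ _ => rfl⟩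
  have hσ : memKet R W w σ = K (σ u) (σ v) (σ z) := by
    rw [hK]; congr 1
    rw [Function.update_eq_self, Function.update_eq_self, Function.update_eq_self]
  have e1 : ∀ p q r, applyCode w [1, enc R W u] (K p q r) = (if p then omega8 else 1) • K p q r :=
    fun p q r => by
      rw [hK, applyCode_t hw hu, Function.update_of_ne huz, Function.update_of_ne huv,
        Function.update_self]
  have e2 : ∀ p q r, applyCode w [1, enc R W v] (K p q r) = (if q then omega8 else 1) • K p q r :=
    fun p q r => by rw [hK, applyCode_t hw hv, Function.update_of_ne hvz, Function.update_self]
  have e3 : ∀ p q r, applyCode w [1, enc R W z] (K p q r) = (if r then omega8 else 1) • K p q r :=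
    fun p q r => by rw [hK, applyCode_t hw hz, Function.update_self]
  have e4 : ∀ p q r, applyCode w [2, enc R W u, enc R W v] (K p q r) = K p (xor q p) r :=
    fun p q r => by
      rw [hK, applyCode_cnot hw hu hv huv, hK, Function.update_of_ne huz, Function.update_of_ne huv,
        Function.update_self, Function.update_of_ne hvz, Function.update_self,
        Function.update_comm hvz.symm, Function.update_idem]
  have e5 : ∀ p q r, applyCode w [2, enc R W v, enc R W z] (K p q r) = K p q (xor r q) :=
    fun p q r => by
      rw [hK, applyCode_cnot hw hv hz hvz, hK, Function.update_of_ne hvz, Function.update_self,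
        Function.update_self, Function.update_idem]
  have e6 : ∀ p q r, applyCode w [2, enc R W u, enc R W z] (K p q r) = K p q (xor r p) :=
    fun p q r => by
      rw [hK, applyCode_cnot hw hu hz huz, hK, Function.update_of_ne huz, Function.update_of_ne huv,
        Function.update_self, Function.update_self, Function.update_idem]
  have hl : ∀ (l : List ℕ) (c : ℂ) ψ, applyCode w l (c • ψ) = c • applyCode w l ψ :=
    fun l => (isLinearMap_applyCode w l).map_smul
  rw [hσ]
  generalize σ u = p, σ v = q, σ z = r
  simp only [applyPats, Kind.cczPats, List.replicate, List.foldl_cons, List.foldl_nil, applyPat,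
    List.map_cons, List.map_nil, List.cons_append, List.nil_append, hi, hj, hk,
    e1, e2, e3, e4, e5, e6, hl]
  -- Counting the inverse of T as seven gates, the exponent of `omega8` is 4 when all three bits are
  -- set, and 0 or 16 otherwise.
  have h16 : omega8 ^ 16 = 1 := by
    rw [show 16 = 4 * 4 by norm_num, pow_mul, omega8_pow_four]; norm_num
  cases p <;> cases q <;> cases r <;>
    simp only [Bool.xor_false, Bool.xor_true, Bool.not_true, Bool.not_false, if_true,
      Bool.false_eq_true, if_false, one_smul, smul_smul, Bool.and_true,
      Bool.and_false, Bool.and_self] <;>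
    congr 1 <;> ring_nf <;> simp only [h16, omega8_pow_four, one_smul]

/-- A phase operation on wire `z`, conjugated by Hadamard gates, is a controlled negation. -/
theorem had_conj {z : Addr} (hz : Bdd P R W z) {D : State w → State w} (hD : IsLinearMap ℂ D)
    {c : Bool} {σ : Mem}
    (h : ∀ b, D (memKet R W w (Function.update σ z b)) =
      (if b && c then -1 else 1 : ℂ) • memKet R W w (Function.update σ z b)) :
    applyCode w [0, enc R W z] (D (applyCode w [0, enc R W z] (memKet R W w σ))) =
      memKet R W w (Function.update σ z (xor (σ z) c)) := by
  have hl := isLinearMap_applyCode w [0, enc R W z]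
  rw [applyCode_had hw hz, hD.map_smul, hD.map_add, hD.map_smul, h, h, hl.map_smul, hl.map_add,
    hl.map_smul, hl.map_smul, hl.map_smul, applyCode_had hw hz, applyCode_had hw hz]
  simp only [Function.update_self, Function.update_idem, smul_add, smul_smul]
  have h2 : invSqrtTwo * invSqrtTwo = 1 / 2 := invSqrtTwo_mul_self
  set A := memKet R W w (Function.update σ z false) with hA
  set B := memKet R W w (Function.update σ z true) with hB
  generalize σ z = b
  cases b <;> cases c <;>
    simp only [Bool.xor_false, Bool.xor_true, Bool.not_true, Bool.not_false, if_true,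
      Bool.false_eq_true, if_false, Bool.and_true, Bool.and_false, mul_one, one_mul, mul_neg,
      neg_mul, neg_neg, h2] <;>
    (try simp only [← hA, ← hB]) <;> module

theorem applyPats_monPats {z : Addr} {cs : List Addr} {m : List ℕ} (hlen : m.length ≤ 2)
    (hm : m.Nodup) (hmc : ∀ i ∈ m, i < cs.length) (hn : (z :: cs).Nodup)
    (hB : ∀ v ∈ z :: cs, Bdd P R W v) (σ : Mem) :
    applyPats R W w (z :: cs) (Kind.monPats m) (memKet R W w σ) =
      memKet R W w (Function.update σ z (xor (σ z) (Kind.evalMon (cs.map σ) m))) := by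
  have hz : Bdd P R W z := hB z List.mem_cons_self
  rw [List.nodup_cons] at hn
  match m, hlen with
  | [], _ =>
    simp only [Kind.monPats, applyPats_append]
    -- The constant monomial is a negation: a phase flip conjugated by Hadamard gates, with control
    -- bit `true`.
    refine had_conj hw hz (isLinearMap_applyPats R W w (z :: cs) Kind.zPats) (fun b => ?_)
    rw [applyPats_z hw (by simpa using hz)]
    simp [Kind.evalMon]
  | [i], _ =>
    have hi := hmc i List.mem_cons_self
    have hic : cs[i] ∈ cs := List.getElem_mem hi
    simp only [Kind.monPats, applyPats, List.foldl_cons, List.foldl_nil, applyPat, List.map_cons,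
      List.map_nil, List.getD_cons_succ, List.getD_cons_zero, List.getD_eq_getElem _ _ hi]
    rw [applyCode_cnot hw (hB _ (List.mem_cons_of_mem _ hic)) hz (ne_of_mem_of_not_mem hic hn.1)]
    simp [Kind.evalMon, hi]
  | [i, j], _ =>
    have hi := hmc i List.mem_cons_self
    have hj := hmc j (by simp)
    have hij : i ≠ j := by simpa using hm
    have hic : cs[i] ∈ cs := List.getElem_mem hi
    have hjc : cs[j] ∈ cs := List.getElem_mem hj
    have hiz : cs[i] ≠ z := ne_of_mem_of_not_mem hic hn.1
    have hjz : cs[j] ≠ z := ne_of_mem_of_not_mem hjc hn.1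
    simp only [Kind.monPats, applyPats_append]
    refine had_conj hw hz (isLinearMap_applyPats R W w (z :: cs) (Kind.cczPats (i + 1) (j + 1) 0))
      (fun b => ?_)
    rw [applyPats_ccz hw (u := cs[i]) (v := cs[j]) (z := z) (by simp [hi]) (by simp [hj]) rfl
      (hB _ (List.mem_cons_of_mem _ hic)) (hB _ (List.mem_cons_of_mem _ hjc)) hz
      (fun h => hij ((List.Nodup.getElem_inj_iff hn.2).1 h)) hiz hjz]
    simp [Kind.evalMon, hi, hj, Function.update_of_ne hiz, Function.update_of_ne hjz]
  | _ :: _ :: _ :: _, h => simp at h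

theorem applyPats_flatMap_monPats {z : Addr} {cs : List Addr} {ms : List (List ℕ)}
    (hms : ∀ m ∈ ms, m.length ≤ 2 ∧ m.Nodup ∧ ∀ i ∈ m, i < cs.length) (hn : (z :: cs).Nodup)
    (hB : ∀ v ∈ z :: cs, Bdd P R W v) (σ : Mem) :
    applyPats R W w (z :: cs) (ms.flatMap Kind.monPats) (memKet R W w σ) =
      memKet R W w (Function.update σ z
        (xor (σ z) ((ms.map (Kind.evalMon (cs.map σ))).foldr xor false))) := by
  induction ms generalizing σ with
  | nil => simp [applyPats]
  | cons m ms ih =>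
    obtain ⟨h1, h2, h3⟩ := hms m List.mem_cons_self
    have hc : ∀ b, cs.map (Function.update σ z b) = cs.map σ := fun b =>
      List.map_congr_left fun v hv =>
        Function.update_of_ne (ne_of_mem_of_not_mem hv (List.nodup_cons.1 hn).1) _ _
    rw [List.flatMap_cons, applyPats_append, applyPats_monPats hw h1 h2 h3 hn hB,
      ih fun m hm => hms m (List.mem_cons_of_mem _ hm)]
    simp [hc]

end Patterns

/-! ### Layers on basis states -/

namespace Kind

theorem pats_eq_flatMap {κ : ℕ} (h : 3 ≤ κ) (h' : κ < 12) :
    pats κ = (monomials κ).flatMap monPats := by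
  interval_cases κ <;> rfl

theorem monomials_valid {κ : ℕ} (h : 3 ≤ κ) (h' : κ < 12) : ∀ m ∈ monomials κ,
    m.length ≤ 2 ∧ m.Nodup ∧ ∀ i ∈ m, i + 1 < arity 0 κ := by
  interval_cases κ <;> decide

/-- Patterns that denote a gate, on wires with indices less than `r`. -/
def patOK (r : ℕ) : ℕ × List ℕ → Bool
  | (0, [i]) => i < r
  | (1, [i]) => i < r
  | (2, [i, j]) => i < r && j < r && i != j
  | _ => false

theorem pats_valid {κ : ℕ} (h : κ ≠ 0) (h' : κ < 12) : ∀ p ∈ pats κ, patOK (arity 0 κ) p := by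
  have : 1 ≤ κ := Nat.pos_of_ne_zero h
  interval_cases κ <;> decide

theorem arity_eq {κ : ℕ} (h : κ ≠ 0) (m : ℕ) : arity m κ = arity 0 κ := by
  obtain ⟨k, rfl⟩ := Nat.exists_eq_succ_of_ne_zero h
  rfl

theorem arity_pos {κ : ℕ} (h : κ ≠ 0) (h' : κ < 12) : 0 < arity 0 κ := by
  have : 1 ≤ κ := Nat.pos_of_ne_zero h
  interval_cases κ <;> decide

theorem lt_of_patOK {r : ℕ} {p : ℕ × List ℕ} (h : patOK r p) : ∀ i ∈ p.2, i < r := by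
  unfold patOK at h
  split at h <;> simp_all

end Kind

/-- The action of a layer, for calls of the circuit `C`. -/
def runLayer {m : ℕ} (C : Circuit m) (R W w : ℕ) (ℓ : Layer) (ψ : State w) : State w :=
  Circuit.run (((layerCode R W ℓ).map (mkStep m w)).flatMap (Step.instantiate C)) ψ

/-- The action of a program. -/
def runProg {m : ℕ} (C : Circuit m) (R W w : ℕ) (Q : List Layer) (ψ : State w) : State w :=
  Q.foldl (fun φ ℓ => runLayer C R W w ℓ φ) ψ

section RunProg

variable {m : ℕ} (C : Circuit m) (R W w : ℕ)

theorem run_flatMap {ι : Type*} (L : List ι) (g : ι → Circuit w) (ψ : State w) :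
    Circuit.run (L.flatMap g) ψ = L.foldl (fun φ i => (g i).run φ) ψ := by
  simp only [Circuit.run, List.foldl_flatMap]

theorem run_program (Q : List Layer) (ψ : State w) :
    Circuit.run (((Q.flatMap (layerCode R W)).map (mkStep m w)).flatMap (Step.instantiate C)) ψ =
      runProg C R W w Q ψ := by
  simp only [runProg, runLayer, run_flatMap, List.foldl_map, List.foldl_flatMap]

@[simp] theorem runProg_nil (ψ : State w) : runProg C R W w [] ψ = ψ := rfl

@[simp] theorem runProg_cons (ℓ : Layer) (Q : List Layer) (ψ : State w) :
    runProg C R W w (ℓ :: Q) ψ = runProg C R W w Q (runLayer C R W w ℓ ψ) := rfl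

theorem runProg_append (Q Q' : List Layer) (ψ : State w) :
    runProg C R W w (Q ++ Q') ψ = runProg C R W w Q' (runProg C R W w Q ψ) := List.foldl_append

theorem isLinearMap_run {w : ℕ} (C : Circuit w) : IsLinearMap ℂ C.run := by
  refine isLinearMap_foldl (A := fun L φ => List.foldl (fun χ g => Gate.apply g χ) φ L)
    fun L _ => ?_
  exact isLinearMap_foldl fun g _ => g.isLinearMap_apply

theorem isLinearMap_runLayer (ℓ : Layer) : IsLinearMap ℂ (runLayer C R W w ℓ) := isLinearMap_run _

theorem isLinearMap_runProg (Q : List Layer) : IsLinearMap ℂ (runProg C R W w Q) :=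
  isLinearMap_foldl fun ℓ _ => isLinearMap_runLayer C R W w ℓ

theorem map_sum_of_isLinearMap {E F ι : Type*} [AddCommMonoid E] [AddCommMonoid F] [Module ℂ E]
    [Module ℂ F] {A : E → F} (h : IsLinearMap ℂ A) (s : Finset ι) (v : ι → E) :
    A (∑ i ∈ s, v i) = ∑ i ∈ s, A (v i) := map_sum h.mk' v s

theorem map_sum_smul_of_isLinearMap {E F ι : Type*} [AddCommMonoid E] [AddCommMonoid F] [Module ℂ E]
    [Module ℂ F] {A : E → F} (h : IsLinearMap ℂ A) (s : Finset ι) (c : ι → ℂ) (v : ι → E) :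
    A (∑ i ∈ s, c i • v i) = ∑ i ∈ s, c i • A (v i) := by
  rw [map_sum_of_isLinearMap h]
  exact Finset.sum_congr rfl fun i _ => h.map_smul _ _

end RunProg

section Layers

variable {P R W w : ℕ} {m : ℕ} {ℓ : Layer}

theorem enc_injOn {u v : Addr} (hu : Bdd P R W u) (hv : Bdd P R W v)
    (h : enc R W u = enc R W v) : u = v := by
  rw [← dec_enc hu, h, dec_enc hv]

theorem Layer.OK.disjoint (h : ℓ.OK m (Bdd P R W)) :
    ℓ.2.Pairwise fun ws ws' => (ws.map (enc R W)).Disjoint (ws'.map (enc R W)) := by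
  refine List.Pairwise.imp_of_mem (fun {ws ws'} hw hw' hd => ?_) (List.nodup_flatten.1 h.nodup).2
  intro x hx hx'
  obtain ⟨u, hu, rfl⟩ := List.mem_map.1 hx
  obtain ⟨v, hv, hvu⟩ := List.mem_map.1 hx'
  have := enc_injOn (h.bounded ws' hw' v hv) (h.bounded ws hw u hu) hvu
  exact hd hu (this ▸ hv)

theorem mem_map_enc_of_patOK {ws : List Addr} {p : ℕ × List ℕ}
    (hp : ∀ i ∈ p.2, i < ws.length) {x : ℕ}
    (hx : x ∈ p.2.map fun i => enc R W (ws.getD i (0, 0, 0))) : x ∈ ws.map (enc R W) := by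
  obtain ⟨i, hi, rfl⟩ := List.mem_map.1 hx
  have := hp i hi
  rw [List.getD_eq_getElem _ _ this]
  exact List.mem_map_of_mem (List.getElem_mem this)

theorem Layer.OK.patOK_lt (h : ℓ.OK m (Bdd P R W)) (h0 : ℓ.1 ≠ 0) {ws : List Addr} (hws : ws ∈ ℓ.2)
    {p : ℕ × List ℕ} (hp : p ∈ Kind.pats ℓ.1) : ∀ i ∈ p.2, i < ws.length := by
  rw [h.length ws hws, Kind.arity_eq h0]
  exact Kind.lt_of_patOK (Kind.pats_valid h0 h.kind p hp)

/-- The template orders the gates by time-slice, whereas the semantics needs them operation by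
operation. Operations on disjoint wires commute, so the two orders agree. -/
theorem runLayer_of_ne_zero (C : Circuit m) (h : ℓ.OK m (Bdd P R W)) (h0 : ℓ.1 ≠ 0) (ψ : State w) :
    runLayer C R W w ℓ ψ =
      ℓ.2.foldl (fun φ ws => applyPats R W w ws (Kind.pats ℓ.1) φ) ψ := by
  -- Attaching membership proofs makes it available, when gates are commuted, that the pattern
  -- refers only to wires of its own operation.
  have h1 : runLayer C R W w ℓ ψ = (Kind.pats ℓ.1).attach.foldl
      (fun φ p => ℓ.2.attach.foldl (fun χ ws => applyPat R W w ws.1 p.1 χ) φ) ψ := by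
    simp only [runLayer, layerCode, if_neg h0, run_flatMap, List.foldl_map, run_instantiate_mkStep,
      Bool.false_eq_true, if_false, applyPat]
    rw [List.foldl_attach (f := fun φ (p : ℕ × List ℕ) => List.foldl (fun χ (ws : {x // x ∈ ℓ.2}) =>
      applyCode w (p.1 :: p.2.map fun i => enc R W (ws.1.getD i (0, 0, 0))) χ) φ ℓ.2.attach)]
    congr 1
    funext φ p
    rw [List.foldl_attach (f := fun χ (ws : List Addr) =>
      applyCode w (p.1 :: p.2.map fun i => enc R W (ws.getD i (0, 0, 0))) χ)]
  rw [h1, foldl_foldl_comm (A := fun (ws : {x // x ∈ ℓ.2}) (p : {x // x ∈ Kind.pats ℓ.1}) χ =>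
    applyPat R W w ws.1 p.1 χ)]
  · rw [← List.foldl_attach (l := ℓ.2)]
    congr 1
    funext φ ws
    rw [List.foldl_attach (f := fun χ p => applyPat R W w ws.1 p χ)]
    rfl
  · have hp : ℓ.2.attach.Pairwise fun ws ws' =>
        (ws.1.map (enc R W)).Disjoint (ws'.1.map (enc R W)) := by
      have hd := h.disjoint
      rw [← List.attach_map_subtype_val ℓ.2, List.pairwise_map] at hd
      exact hd
    refine hp.imp fun {ws ws'} hd j j' s => applyCode_comm (fun x hx hx' => ?_) s
    exact hd (mem_map_enc_of_patOK (h.patOK_lt h0 ws.2 j.2) hx)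
      (mem_map_enc_of_patOK (h.patOK_lt h0 ws'.2 j'.2) hx')

theorem runLayer_of_zero (C : Circuit m) (h : ℓ.OK m (Bdd P R W)) (h0 : ℓ.1 = 0) (ψ : State w) :
    runLayer C R W w ℓ ψ = ℓ.2.foldl
      (fun φ ws => C.foldl (fun χ K => sliceCode w (ws.map (enc R W)) K χ) φ) ψ := by
  simp only [runLayer, layerCode, if_pos h0, run_flatMap, List.foldl_cons, List.foldl_nil,
    List.map_cons, List.map_nil, run_instantiate_mkStep, if_true, List.foldl_map]
  rw [foldl_foldl_comm (A := fun (ws : List Addr) K χ => sliceCode w (ws.map (enc R W)) K χ)]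
  exact h.disjoint.imp fun hd j j' s => sliceCode_comm hd j j' s

variable {n a : ℕ} {f : Bits n → Bits n} {C : Circuit (n + n + a)}

theorem exists_mkEmb (hw : w = P * R * W) {ws : List Addr} (hn : ws.Nodup) (hl : ws.length = m)
    (hB : ∀ v ∈ ws, Bdd P R W v) :
    ∃ e, mkEmb m w (ws.map (enc R W)) = some e ∧
      ∀ i, ∃ h : i.val < ws.length, (e i).val = enc R W ws[i.val] := by
  have hc : (ws.map (enc R W)).length = m ∧ (ws.map (enc R W)).Nodup ∧
      ∀ x ∈ ws.map (enc R W), x < w := by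
    refine ⟨by simpa using hl, ?_, ?_⟩
    · rw [List.nodup_map_iff_inj_on hn]
      exact fun u hu v hv huv => enc_injOn (hB u hu) (hB v hv) huv
    · intro x hx
      obtain ⟨u, hu, rfl⟩ := List.mem_map.1 hx
      rw [hw]
      exact enc_lt (hB u hu)
  refine ⟨_, dif_pos hc, fun i => ?_⟩
  refine ⟨by omega, ?_⟩
  simp

/-- With clean ancillas, the basis state restricted to `ws` has the form |x, y, 0⟩ to which
`Circuit.Computes` applies. `lift` carries the other wires along as spectators. -/
theorem foldl_sliceCode_memKet (hC : C.Computes f) (hw : w = P * R * W) {ws : List Addr}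
    (hn : ws.Nodup) (hl : ws.length = n + n + a) (hB : ∀ v ∈ ws, Bdd P R W v) {σ : Mem}
    (hσ : ∀ v ∈ ws.drop (n + n), σ v = false) :
    C.foldl (fun χ K => sliceCode w (ws.map (enc R W)) K χ) (memKet R W w σ) =
      memKet R W w (callAct f ws σ) := by
  obtain ⟨e, he, hev⟩ := exists_mkEmb hw hn hl hB
  simp only [sliceCode, he]
  have hdec : ∀ i : Fin (n + n + a), dec R W (e i) = ws[i.val]'(by omega) := fun i => by
    obtain ⟨h1, h2⟩ := hev i
    rw [h2, dec_enc (hB _ (List.getElem_mem _))]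
  let x : Bits n := fun i => σ (ws[i.val]'(by omega))
  let y : Bits n := fun i => σ (ws[n + i.val]'(by omega))
  have hz : bitsOf R W w σ = Function.extend e (Fin.append (Fin.append x y) fun _ => false)
      (bitsOf R W w σ) := by
    funext j
    by_cases hj : ∃ i, e i = j
    · obtain ⟨i, rfl⟩ := hj
      rw [e.injective.extend_apply]
      simp only [bitsOf, hdec]
      induction i using Fin.addCases with
      | left i =>
        induction i using Fin.addCases with
        | left i => rw [Fin.append_left, Fin.append_left]; rfl
        | right i => rw [Fin.append_left, Fin.append_right]; rfl
      | right i =>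
        rw [Fin.append_right]
        refine hσ _ (List.mem_iff_getElem.2 ⟨i, ?_, ?_⟩)
        · simp [hl]
        · simp
    · rw [Function.extend_apply' _ _ _ hj]
  have h1 : memKet R W w σ = lift e (bitsOf R W w σ)
      (ket (Fin.append (Fin.append x y) fun _ => false)) := by
    rw [lift_ket, ← hz]; rfl
  rw [h1, foldl_foldl_map_lift, hC x y, lift_ket, memKet]
  congr 1
  funext j
  by_cases hj : ∃ i, e i = j
  · obtain ⟨i, rfl⟩ := hj
    rw [e.injective.extend_apply]
    simp only [bitsOf, hdec, callAct]
    have hidx := hn.idxOf_getElem i.val (by omega)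
    simp only [hidx]
    have hx : (fun j : Fin n => (ws.map σ).getD j false) = x := by
      funext j
      simp [x, show (j : ℕ) < ws.length by omega]
    rw [hx]
    clear hx hev
    induction i using Fin.addCases with
    | left i =>
      induction i using Fin.addCases with
      | left i =>
        rw [Fin.append_left, Fin.append_left, dif_neg]
        · rfl
        · simp
      | right i =>
        rw [Fin.append_left, Fin.append_right, dif_pos]
        · simp [y, add_comm]
        · simp
    | right i =>
      rw [Fin.append_right, dif_neg]
      · refine (hσ _ (List.mem_iff_getElem.2 ⟨i, ?_, ?_⟩)).symm
        · simp [hl]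
        · simp
      · simp
  · rw [Function.extend_apply' _ _ _ hj]
    have hdj : dec R W j ∉ ws := fun hm => by
      obtain ⟨i, hi, hij⟩ := List.mem_iff_getElem.1 hm
      refine hj ⟨⟨i, hl ▸ hi⟩, Fin.ext ?_⟩
      obtain ⟨h1, h2⟩ := hev ⟨i, hl ▸ hi⟩
      rw [h2]
      simp only [hij, enc_dec]
    simp only [bitsOf, callAct]
    rw [dif_neg]
    rw [List.idxOf_eq_length hdj]
    omega

/-- Kinds 1 and 2, the Hadamard gate and the phase flip, are excluded because they do not permute
basis states. For the others, both the quantum and the classical action split over the operations of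
the layer. -/
theorem runLayer_memKet (hC : C.Computes f) (hw : w = P * R * W) (h : ℓ.OK (n + n + a) (Bdd P R W))
    (hk : ℓ.1 = 0 ∨ 3 ≤ ℓ.1) {σ : Mem}
    (hσ : ℓ.1 = 0 → ∀ ws ∈ ℓ.2, ∀ v ∈ ws.drop (n + n), σ v = false) :
    runLayer C R W w ℓ (memKet R W w σ) = memKet R W w (execLayer f ℓ σ) := by
  obtain ⟨A, hA, hAact⟩ : ∃ A : List Addr → State w → State w,
      (∀ ψ, runLayer C R W w ℓ ψ = ℓ.2.foldl (fun φ ws => A ws φ) ψ) ∧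
      ∀ ws ∈ ℓ.2, ∀ σ : Mem, (ℓ.1 = 0 → ∀ v ∈ ws.drop (n + n), σ v = false) →
        A ws (memKet R W w σ) = memKet R W w (act f ℓ.1 ws σ) := by
    rcases hk with h0 | h3
    · refine ⟨_, runLayer_of_zero C h h0, fun ws hws σ hσ => ?_⟩
      have hl := h.length ws hws
      rw [h0] at hl
      rw [foldl_sliceCode_memKet hC hw (h.nodup_of_mem hws) hl (h.bounded ws hws) (hσ h0), act,
        if_pos h0]
    · have h0 : ℓ.1 ≠ 0 := by omega
      refine ⟨_, runLayer_of_ne_zero C h h0, fun ws hws σ _ => ?_⟩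
      have hl := h.length ws hws
      rw [Kind.arity_eq h0] at hl
      have hpos := Kind.arity_pos h0 h.kind
      obtain ⟨z, cs, rfl⟩ : ∃ z cs, ws = z :: cs := by
        cases ws with
        | nil => simp at hl; omega
        | cons z cs => exact ⟨z, cs, rfl⟩
      rw [Kind.pats_eq_flatMap h3 h.kind, applyPats_flatMap_monPats hw _ (h.nodup_of_mem hws)
        (h.bounded _ hws), act, if_neg h0]
      · rfl
      · intro m hm
        obtain ⟨h1, h2, h3⟩ := Kind.monomials_valid h3 h.kind m hm
        refine ⟨h1, h2, fun i hi => ?_⟩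
        have := h3 i hi
        simp only [List.length_cons] at hl
        omega
  rw [hA, execLayer]
  have hlen := h.le_length
  have hnod := h.nodup
  clear hA
  revert σ
  generalize hκ : ℓ.1 = κ at *
  generalize hL : ℓ.2 = L at *
  have hsub : ∀ ws ∈ L, ws ∈ ℓ.2 := fun ws h => hL ▸ h
  clear hL
  induction L with
  | nil => intro σ _; rfl
  | cons ws L ih =>
    intro σ hσ
    rw [List.flatten_cons, List.nodup_append] at hnod
    rw [List.foldl_cons, List.foldl_cons,
      hAact ws List.mem_cons_self σ (fun h0 => hσ h0 ws List.mem_cons_self)]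
    refine ih hnod.2.1 (fun ws hws => hAact ws (List.mem_cons_of_mem _ hws))
      (fun ws hws => hlen ws (List.mem_cons_of_mem _ hws))
      (fun ws hws => hsub ws (List.mem_cons_of_mem _ hws)) (fun h0 ws' hws' v hv => ?_)
    -- The operation just executed is disjoint from the remaining ones, so their ancillas stay
    -- clean.
    rw [act_of_notMem f κ (hlen ws List.mem_cons_self)]
    · exact hσ h0 ws' (List.mem_cons_of_mem _ hws') v hv
    · intro hvw
      exact hnod.2.2 v hvw v (List.mem_flatten.2 ⟨ws', hws', List.mem_of_mem_drop hv⟩) rfl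

/-- Classical programs act on basis states. -/
theorem runProg_memKet (hC : C.Computes f) (hw : w = P * R * W) {Q : List Layer}
    (h : ∀ ℓ ∈ Q, ℓ.OK (n + n + a) (Bdd P R W)) (hk : ∀ ℓ ∈ Q, ℓ.1 = 0 ∨ 3 ≤ ℓ.1) {σ : Mem}
    (hσ : CallsClean f Q σ) :
    runProg C R W w Q (memKet R W w σ) = memKet R W w (exec f Q σ) := by
  induction Q generalizing σ with
  | nil => rfl
  | cons ℓ Q ih =>
    rw [runProg_cons, runLayer_memKet hC hw (h ℓ List.mem_cons_self) (hk ℓ List.mem_cons_self) hσ.1,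
      ih (fun ℓ hℓ => h ℓ (List.mem_cons_of_mem _ hℓ))
         (fun ℓ hℓ => hk ℓ (List.mem_cons_of_mem _ hℓ))
        hσ.2]
    rfl

theorem runLayer_zedLayer (hw : w = P * R * W) (C : Circuit m) {z : Addr}
    (hz : Bdd P R W z) (σ : Mem) :
    runLayer C R W w (zedLayer z) (memKet R W w σ) =
      (if σ z then -1 else 1 : ℂ) • memKet R W w σ := by
  have h : (zedLayer z).OK m (Bdd P R W) := by
    refine ⟨?_, ?_, show 2 < 12 by decide, ?_, ?_⟩ <;>
      simp +contextual only [zedLayer, lay, List.range_one, List.map_cons, List.map_nil,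
        List.mem_singleton, forall_eq, hz] <;> simp [Kind.arity]
  rw [runLayer_of_ne_zero C h (by simp [zedLayer, lay])]
  exact applyPats_z hw (ws := [z]) (by simpa using hz) σ

end Layers

/-! ### The bitonic sorting network -/

section Network

variable {α : Type*} [LinearOrder α]

/-- The array `a'` results from `a` by the comparators of a stage. -/
def StageRel (h : ℕ) (st : Bool × ℕ) (a a' : ℕ → α) : Prop :=
  ∀ u < h, a' (lo st.2 u) = min (a (lo st.2 u)) (a (hi st u)) ∧
    a' (hi st u) = max (a (lo st.2 u)) (a (hi st u))

/-- The array `b` results from `a` by the given stages. -/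
def NetRel (h : ℕ) : List (Bool × ℕ) → (ℕ → α) → (ℕ → α) → Prop
  | [], a, b => a = b
  | st :: sts, a, b => ∃ c, StageRel h st a c ∧ NetRel h sts c b

theorem netRel_append {h : ℕ} {s t : List (Bool × ℕ)} {a b : ℕ → α} :
    NetRel h (s ++ t) a b ↔ ∃ c, NetRel h s a c ∧ NetRel h t c b := by
  induction s generalizing a with
  | nil => simp [NetRel]
  | cons st s ih =>
    simp only [List.cons_append, NetRel, ih]
    constructor
    · rintro ⟨c, h1, e, h2, h3⟩; exact ⟨e, ⟨c, h1, h2⟩, h3⟩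
    · rintro ⟨e, ⟨c, h1, h2⟩, h3⟩; exact ⟨c, h1, e, h2, h3⟩

/-- Monotone maps commute with minimum and maximum. This is the source of the zero-one principle
used in `NetRel.sorted`. -/
theorem StageRel.comp {β : Type*} [LinearOrder β] {g : α → β} (hg : Monotone g) {h : ℕ}
    {st : Bool × ℕ} {a a' : ℕ → α} (H : StageRel h st a a') :
    StageRel h st (g ∘ a) (g ∘ a') := by
  intro u hu
  obtain ⟨h1, h2⟩ := H u hu
  simp only [Function.comp, h1, h2, hg.map_min, hg.map_max, and_self]

theorem NetRel.comp {β : Type*} [LinearOrder β] {g : α → β} (hg : Monotone g) {h : ℕ}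
    {sts : List (Bool × ℕ)} {a a' : ℕ → α} (H : NetRel h sts a a') :
    NetRel h sts (g ∘ a) (g ∘ a') := by
  induction sts generalizing a with
  | nil => exact congrArg (g ∘ ·) H
  | cons st sts ih =>
    obtain ⟨c, h1, h2⟩ := H
    exact ⟨g ∘ c, h1.comp hg, ih h2⟩

theorem lo_mul_add {d o : ℕ} (ho : o < d) (k : ℕ) : lo d (k * d + o) = k * (2 * d) + o := by
  have hd : 0 < d := by omega
  simp only [lo]
  rw [mul_comm k d, Nat.mul_add_div hd, Nat.mul_add_mod, Nat.div_eq_of_lt ho, Nat.mod_eq_of_lt ho,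
    add_zero]

theorem hi_mul_add {d o : ℕ} (ho : o < d) (b : Bool) (k : ℕ) :
    hi (b, d) (k * d + o) = k * (2 * d) + if b then 2 * d - 1 - o else d + o := by
  have hd : 0 < d := by omega
  simp only [hi]
  rw [mul_comm k d, Nat.mul_add_div hd, Nat.mul_add_mod, Nat.div_eq_of_lt ho, Nat.mod_eq_of_lt ho,
    add_zero]

/-- Every unit lies in some block. -/
theorem exists_unit {d h u : ℕ} (hd : d ∣ h) (hu : u < h) :
    ∃ k o, o < d ∧ u = k * d + o ∧ (k + 1) * d ≤ h := by
  obtain ⟨c, rfl⟩ := hd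
  have hd0 : 0 < d := by
    rcases Nat.eq_zero_or_pos d with rfl | h
    · simp at hu
    · exact h
  refine ⟨u / d, u % d, Nat.mod_lt _ hd0, by rw [mul_comm, Nat.div_add_mod], ?_⟩
  have : u / d < c := Nat.div_lt_of_lt_mul hu
  calc (u / d + 1) * d ≤ c * d := Nat.mul_le_mul_right _ this
    _ = d * c := mul_comm _ _

/-- Every position lies in some half block. -/
theorem exists_pos {d h i : ℕ} (hd : d ∣ h) (hi : i < 2 * h) :
    ∃ k o, o < d ∧ (k + 1) * d ≤ h ∧ (i = k * (2 * d) + o ∨ i = k * (2 * d) + (d + o)) := by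
  obtain ⟨c, rfl⟩ := hd
  have hd0 : 0 < d := by
    rcases Nat.eq_zero_or_pos d with rfl | h
    · simp at hi
    · exact h
  have h1 : i / (2 * d) < c := Nat.div_lt_of_lt_mul (by rwa [mul_assoc])
  have h2 : (i / (2 * d) + 1) * d ≤ d * c := by
    calc (i / (2 * d) + 1) * d ≤ c * d := Nat.mul_le_mul_right _ h1
      _ = d * c := mul_comm _ _
  have h3 := Nat.div_add_mod i (2 * d)
  have h4 : i % (2 * d) < 2 * d := Nat.mod_lt _ (by omega)
  rw [mul_comm] at h3
  by_cases h5 : i % (2 * d) < d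
  · exact ⟨_, _, h5, h2, Or.inl h3.symm⟩
  · exact ⟨_, i % (2 * d) - d, by omega, h2, Or.inr (by omega)⟩

theorem lo_lt {d h u : ℕ} (hd : d ∣ h) (hu : u < h) : lo d u < 2 * h := by
  obtain ⟨k, o, ho, rfl, hk⟩ := exists_unit hd hu
  rw [lo_mul_add ho]
  nlinarith

theorem hi_lt {d h u : ℕ} (hd : d ∣ h) (hu : u < h) (b : Bool) : hi (b, d) u < 2 * h := by
  obtain ⟨k, o, ho, rfl, hk⟩ := exists_unit hd hu
  rw [hi_mul_add ho]
  have : (k + 1) * d = k * d + d := by ring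
  have : k * (2 * d) = 2 * (k * d) := by ring
  split_ifs <;> omega

theorem exists_lo_or_hi {d h i : ℕ} (hd : d ∣ h) (b : Bool) (hi' : i < 2 * h) :
    ∃ u < h, i = lo d u ∨ i = hi (b, d) u := by
  obtain ⟨k, o, ho, hk, rfl | rfl⟩ := exists_pos hd hi'
  · exact ⟨k * d + o, by nlinarith, Or.inl (lo_mul_add ho k).symm⟩
  · cases b
    · exact ⟨k * d + o, by nlinarith, Or.inr (by rw [hi_mul_add ho]; rfl)⟩
    -- In a mirrored stage the upper position with offset `d + o` is the partner of the lower offset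
    -- `d - 1 - o`.
    · refine ⟨k * d + (d - 1 - o), by have : (k + 1) * d = k * d + d := by ring
                                      omega, Or.inr ?_⟩
      rw [hi_mul_add (by omega)]
      simp only [if_true]
      omega

/-- The image of the first `2 * h` positions. -/
theorem StageRel.image {h : ℕ} {b : Bool} {d : ℕ} (hd : d ∣ h) {a a' : ℕ → α}
    (H : StageRel h (b, d) a a') :
    (∀ i < 2 * h, ∃ j < 2 * h, a' i = a j) ∧ ∀ i < 2 * h, ∃ j < 2 * h, a i = a' j := by
  constructor
  · intro i hi'
    obtain ⟨u, hu, rfl | rfl⟩ := exists_lo_or_hi hd b hi'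
    · rw [(H u hu).1]
      rcases min_choice (a (lo d u)) (a (hi (b, d) u)) with e | e
      · exact ⟨_, lo_lt hd hu, e⟩
      · exact ⟨_, hi_lt hd hu b, e⟩
    · rw [(H u hu).2]
      rcases max_choice (a (lo d u)) (a (hi (b, d) u)) with e | e
      · exact ⟨_, lo_lt hd hu, e⟩
      · exact ⟨_, hi_lt hd hu b, e⟩
  · intro i hi'
    obtain ⟨u, hu, hiu⟩ := exists_lo_or_hi hd b hi'
    obtain ⟨h1, h2⟩ := H u hu
    rcases le_total (a (lo d u)) (a (hi (b, d) u)) with e | e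
    · rw [min_eq_left e] at h1
      rw [max_eq_right e] at h2
      rcases hiu with rfl | rfl
      · exact ⟨_, lo_lt hd hu, h1.symm⟩
      · exact ⟨_, hi_lt hd hu b, h2.symm⟩
    · rw [min_eq_right e] at h1
      rw [max_eq_left e] at h2
      rcases hiu with rfl | rfl
      · exact ⟨_, hi_lt hd hu b, h2.symm⟩
      · exact ⟨_, lo_lt hd hu, h1.symm⟩

/-- Only the set of values is tracked. Multiplicities play no role, since the search asks for two
different records with equal values of f. -/
theorem NetRel.image {h : ℕ} {sts : List (Bool × ℕ)} (hd : ∀ st ∈ sts, st.2 ∣ h) {a a' : ℕ → α}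
    (H : NetRel h sts a a') :
    (∀ i < 2 * h, ∃ j < 2 * h, a' i = a j) ∧ ∀ i < 2 * h, ∃ j < 2 * h, a i = a' j := by
  induction sts generalizing a with
  | nil => cases H; exact ⟨fun i hi => ⟨i, hi, rfl⟩, fun i hi => ⟨i, hi, rfl⟩⟩
  | cons st sts ih =>
    obtain ⟨c, h1, h2⟩ := H
    obtain ⟨i1, i2⟩ := h1.image (hd st List.mem_cons_self)
    obtain ⟨i3, i4⟩ := ih (fun st hst => hd st (List.mem_cons_of_mem _ hst)) h2
    refine ⟨fun i hi => ?_, fun i hi => ?_⟩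
    · obtain ⟨j, hj, e⟩ := i3 i hi
      obtain ⟨k, hk, e'⟩ := i1 j hj
      exact ⟨k, hk, e.trans e'⟩
    · obtain ⟨j, hj, e⟩ := i2 i hi
      obtain ⟨k, hk, e'⟩ := i4 j hj
      exact ⟨k, hk, e.trans e'⟩

theorem dvd_of_mem_stages {l : ℕ} {st : Bool × ℕ} (h : st ∈ stages (l + 1)) : st.2 ∣ 2 ^ l := by
  simp only [stages, List.mem_flatMap, List.mem_range, List.mem_cons, List.mem_map] at h
  obtain ⟨p, hp, rfl | ⟨r, hr, rfl⟩⟩ := h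
  · exact pow_dvd_pow 2 (by omega)
  · exact pow_dvd_pow 2 (by omega)

end Network

/-! ### Zero-one analysis of the bitonic network. -/

section ZeroOne

/-- An interval of ones or an interval of zeros. -/
def IsIntervalOn (D : ℕ) (b : ℕ → Bool) : Prop :=
  ∃ p q, (∀ i < D, (b i = true ↔ p ≤ i ∧ i < q)) ∨ ∀ i < D, (b i = true ↔ ¬ (p ≤ i ∧ i < q))

/-- Position o is compared with its antipode d + o on a cycle of length 2d, on which the ones form
an arc. If an antipodal pair consists of ones, the arc contains one of the two half-cycles between
them and meets every antipodal pair; so a single one in the lower output forces the upper output to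
be all ones. -/
theorem half_clean {d : ℕ} {b b' : ℕ → Bool} (hb : IsIntervalOn (2 * d) b)
    (h1 : ∀ o < d, b' o = (b o && b (d + o))) (h2 : ∀ o < d, b' (d + o) = (b o || b (d + o))) :
    IsIntervalOn d b' ∧ IsIntervalOn d (fun o => b' (d + o)) ∧
      ∀ o < d, ∀ o' < d, b' o = true → b' (d + o') = true := by
  obtain ⟨p, q, h | h⟩ := hb
  · have e1 : ∀ o < d, (b' o = true ↔ p ≤ o ∧ d + o < q) := fun o ho => by
      rw [h1 o ho, Bool.and_eq_true, h o (by omega), h (d + o) (by omega)]; omega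
    have e2 : ∀ o < d, (b' (d + o) = true ↔ (p ≤ o ∧ o < q) ∨ (p ≤ d + o ∧ d + o < q)) :=
      fun o ho => by
        rw [h2 o ho, Bool.or_eq_true, h o (by omega), h (d + o) (by omega)]
    refine ⟨⟨p, q - d, Or.inl fun o ho => by rw [e1 o ho]; omega⟩, ?_, fun o ho o' ho' => ?_⟩
    -- The ones of the upper half are the union of the interval and its shift by d. If it straddles
    -- d, they wrap around and are the complement of the interval from q - d to p.
    · rcases le_or_gt q d with hq | hq
      · exact ⟨p, q, Or.inl fun o ho => by rw [e2 o ho]; omega⟩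
      · rcases le_or_gt d p with hp | hp
        · exact ⟨p - d, q - d, Or.inl fun o ho => by rw [e2 o ho]; omega⟩
        · exact ⟨q - d, p, Or.inr fun o ho => by rw [e2 o ho]; omega⟩
    · rw [e1 o ho, e2 o' ho']; omega
  · have e1 : ∀ o < d, (b' o = true ↔ ¬ (p ≤ o ∧ o < q) ∧ ¬ (p ≤ d + o ∧ d + o < q)) :=
      fun o ho => by
        rw [h1 o ho, Bool.and_eq_true, h o (by omega), h (d + o) (by omega)]
    have e2 : ∀ o < d, (b' (d + o) = true ↔ ¬ (p ≤ o ∧ d + o < q)) :=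
      fun o ho => by
        rw [h2 o ho, Bool.or_eq_true, h o (by omega), h (d + o) (by omega)]; omega
    refine ⟨?_, ⟨p, q - d, Or.inr fun o ho => by rw [e2 o ho]; omega⟩, fun o ho o' ho' => ?_⟩
    · rcases le_or_gt q d with hq | hq
      · exact ⟨p, q, Or.inr fun o ho => by rw [e1 o ho]; omega⟩
      · rcases le_or_gt d p with hp | hp
        · exact ⟨p - d, q - d, Or.inr fun o ho => by rw [e1 o ho]; omega⟩
        · exact ⟨q - d, p, Or.inl fun o ho => by rw [e1 o ho]; omega⟩
    · rw [e1 o ho, e2 o' ho']; omega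

theorem exists_threshold {d : ℕ} {b : ℕ → Bool} (h : ∀ i j, i < j → j < d → b i ≤ b j) :
    ∃ t, ∀ i < d, (b i = true ↔ t ≤ i) := by
  by_cases hex : ∃ i, i < d ∧ b i = true
  · refine ⟨Nat.find hex, fun i hi => ⟨fun hb => Nat.find_min' hex ⟨hi, hb⟩, fun hle => ?_⟩⟩
    obtain ⟨_, h2⟩ := Nat.find_spec hex
    rcases hle.lt_or_eq with hlt | he
    · exact h _ _ hlt hi h2
    · rw [← he]; exact h2
  · push Not at hex
    exact ⟨d, fun i hi => ⟨fun hb => absurd hb (hex i hi), fun hle => by omega⟩⟩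

/-- An increasing half followed by the reversal of an increasing half is bitonic, and the mirrored
comparison performs this reversal implicitly. With thresholds s and t, the ones of the lower output
form the interval from s to d - t, and the zeros of the upper one that from d - s to t. -/
theorem mirror_clean {d : ℕ} {b b' : ℕ → Bool} (hl : ∀ i j, i < j → j < d → b i ≤ b j)
    (hr : ∀ i j, i < j → j < d → b (d + i) ≤ b (d + j))
    (h1 : ∀ o < d, b' o = (b o && b (2 * d - 1 - o)))
    (h2 : ∀ o < d, b' (2 * d - 1 - o) = (b o || b (2 * d - 1 - o))) :
    IsIntervalOn d b' ∧ IsIntervalOn d (fun o => b' (d + o)) ∧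
      ∀ o < d, ∀ o' < d, b' o = true → b' (d + o') = true := by
  obtain ⟨s, hs⟩ := exists_threshold hl
  obtain ⟨t, ht⟩ := exists_threshold hr
  have hr' : ∀ o < d, (b (2 * d - 1 - o) = true ↔ t ≤ d - 1 - o) := fun o ho => by
    rw [show 2 * d - 1 - o = d + (d - 1 - o) by omega]
    exact ht _ (by omega)
  have e1 : ∀ o < d, (b' o = true ↔ s ≤ o ∧ t ≤ d - 1 - o) := fun o ho => by
    rw [h1 o ho, Bool.and_eq_true, hs o ho, hr' o ho]
  have e2 : ∀ o < d, (b' (d + o) = true ↔ s ≤ d - 1 - o ∨ t ≤ o) := fun o ho => by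
    have := h2 (d - 1 - o) (by omega)
    rw [show 2 * d - 1 - (d - 1 - o) = d + o by omega] at this
    rw [this, Bool.or_eq_true, hs _ (by omega), ht o ho]
  refine ⟨⟨s, d - t, Or.inl fun o ho => by rw [e1 o ho]; omega⟩,
    ⟨d - s, t, Or.inr fun o ho => by rw [e2 o ho]; omega⟩, fun o ho o' ho' => ?_⟩
  rw [e1 o ho, e2 o' ho']; omega

variable {l : ℕ}

/-- The blocks of length `2 ^ p` are sorted. -/
def BlocksSorted (l p : ℕ) (a : ℕ → Bool) : Prop :=
  ∀ i j, i < j → j < 2 * 2 ^ l → i / 2 ^ p = j / 2 ^ p → a i ≤ a j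

/-- The blocks of length `2 ^ e` are intervals, and sorted among each other within blocks of length
`2 ^ (p + 1)`. -/
def BlocksClean (l p e : ℕ) (a : ℕ → Bool) : Prop :=
  (∀ k, (k + 1) * 2 ^ e ≤ 2 * 2 ^ l → IsIntervalOn (2 ^ e) fun o => a (k * 2 ^ e + o)) ∧
  ∀ i j, i < 2 * 2 ^ l → j < 2 * 2 ^ l → i / 2 ^ (p + 1) = j / 2 ^ (p + 1) →
    i / 2 ^ e < j / 2 ^ e → a i ≤ a j

theorem stageRel_block {d h : ℕ} {b : Bool} {a a' : ℕ → Bool} (H : StageRel h (b, d) a a') {k : ℕ}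
    (hk : (k + 1) * d ≤ h) {o : ℕ} (ho : o < d) :
    a' (k * (2 * d) + o) = (a (k * (2 * d) + o) &&
      a (k * (2 * d) + if b then 2 * d - 1 - o else d + o)) ∧
    a' (k * (2 * d) + if b then 2 * d - 1 - o else d + o) = (a (k * (2 * d) + o) ||
      a (k * (2 * d) + if b then 2 * d - 1 - o else d + o)) := by
  have := H (k * d + o) (by nlinarith)
  rw [lo_mul_add ho, hi_mul_add ho] at this
  exact this

theorem block_parity {d : ℕ} {a : ℕ → Bool} {h : ℕ}
    (H : ∀ k, (k + 1) * d ≤ h → IsIntervalOn d (fun o => a (k * (2 * d) + o)) ∧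
      IsIntervalOn d (fun o => a (k * (2 * d) + (d + o)))) {k : ℕ} (hk : (k + 1) * d ≤ 2 * h)
    (hd : d ∣ h) : IsIntervalOn d fun o => a (k * d + o) := by
  obtain ⟨c, rfl⟩ := hd
  rcases Nat.eq_zero_or_pos d with rfl | hd0
  · exact ⟨0, 0, Or.inl fun i hi => absurd hi (by omega)⟩
  have hkc : k + 1 ≤ 2 * c := by
    by_contra hlt
    have : (2 * c + 1) * d ≤ (k + 1) * d := Nat.mul_le_mul_right _ (by omega)
    nlinarith
  rcases Nat.even_or_odd' k with ⟨j, rfl | rfl⟩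
  · have := (H j (by calc (j + 1) * d ≤ c * d := Nat.mul_le_mul_right _ (by omega)
                      _ = d * c := mul_comm _ _)).1
    rwa [show (fun o => a (2 * j * d + o)) = fun o => a (j * (2 * d) + o) from
      funext fun o => congrArg a (by ring)]
  · have := (H j (by calc (j + 1) * d ≤ c * d := Nat.mul_le_mul_right _ (by omega)
                      _ = d * c := mul_comm _ _)).2
    rwa [show (fun o => a ((2 * j + 1) * d + o)) = fun o => a (j * (2 * d) + (d + o)) from
      funext fun o => congrArg a (by ring)]

theorem div_two_mul_of_block {d k o : ℕ} (ho : o < 2 * d) : (k * (2 * d) + o) / (2 * d) = k := by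
  rw [mul_comm, Nat.mul_add_div (by omega), Nat.div_eq_of_lt ho, add_zero]

theorem div_of_block_left {d k o : ℕ} (ho : o < d) : (k * (2 * d) + o) / d = 2 * k := by
  rw [show k * (2 * d) + o = d * (2 * k) + o by ring, Nat.mul_add_div (by omega),
    Nat.div_eq_of_lt ho, add_zero]

theorem div_of_block_right {d k o : ℕ} (ho : o < d) : (k * (2 * d) + (d + o)) / d = 2 * k + 1 := by
  rw [show k * (2 * d) + (d + o) = d * (2 * k + 1) + o by ring, Nat.mul_add_div (by omega),
    Nat.div_eq_of_lt ho, add_zero]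

theorem blocksClean_mirror {p : ℕ} (hp : p ≤ l) {a a' : ℕ → Bool} (hs : BlocksSorted l p a)
    (H : StageRel (2 ^ l) (true, 2 ^ p) a a') : BlocksClean l p p a' := by
  set d := 2 ^ p with hd
  have hdvd : d ∣ 2 ^ l := pow_dvd_pow 2 hp
  have hblk : ∀ k, (k + 1) * d ≤ 2 ^ l → IsIntervalOn d (fun o => a' (k * (2 * d) + o)) ∧
      IsIntervalOn d (fun o => a' (k * (2 * d) + (d + o))) ∧
      ∀ o < d, ∀ o' < d, a' (k * (2 * d) + o) = true → a' (k * (2 * d) + (d + o')) = true := by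
    intro k hk
    have hk' : (k + 1) * d = k * d + d := by ring
    have hk2 : k * (2 * d) = 2 * (k * d) := by ring
    refine mirror_clean (b := fun o => a (k * (2 * d) + o)) (b' := fun o => a' (k * (2 * d) + o))
      (fun i j hij hj => ?_) (fun i j hij hj => ?_) (fun o ho => ?_) (fun o ho => ?_)
    · refine hs _ _ (by omega) (by omega) ?_
      rw [div_of_block_left (by omega), div_of_block_left hj]
    · refine hs _ _ (by omega) (by omega) ?_
      rw [div_of_block_right (by omega), div_of_block_right hj]
    · exact (stageRel_block H hk ho).1
    · exact (stageRel_block H hk ho).2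
  refine ⟨fun k hk => block_parity (fun k hk => ⟨(hblk k hk).1, (hblk k hk).2.1⟩) hk hdvd,
    fun i j hi hj hij hlt => ?_⟩
  rw [show 2 ^ (p + 1) = 2 * d by rw [pow_succ]; ring] at hij
  rw [← hd] at hlt
  obtain ⟨k, o, ho, hk, hik⟩ := exists_pos hdvd hi
  obtain ⟨k', o', ho', hk', hjk⟩ := exists_pos hdvd hj
  have e1 : i / (2 * d) = k := by
    rcases hik with rfl | rfl <;> exact div_two_mul_of_block (by omega)
  have e2 : j / (2 * d) = k' := by
    rcases hjk with rfl | rfl <;> exact div_two_mul_of_block (by omega)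
  rw [e1, e2] at hij
  subst hij
  rcases hik with rfl | rfl <;> rcases hjk with rfl | rfl <;>
    simp only [div_of_block_left ho, div_of_block_right ho, div_of_block_left ho',
      div_of_block_right ho'] at hlt
  · omega
  · exact fun h => (hblk k hk).2.2 o ho o' ho' h
  · omega
  · omega

/-- Within a block of length `2 * d` the order between the halves comes from `half_clean`. Between
different blocks it persists: every output is a minimum or maximum of two inputs of its own block,
and all inputs of an earlier block are at most all inputs of a later one. -/
theorem blocksClean_half {p e : ℕ} (hp : p ≤ l) (he : e + 1 ≤ p) {a a' : ℕ → Bool}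
    (hs : BlocksClean l p (e + 1) a) (H : StageRel (2 ^ l) (false, 2 ^ e) a a') :
    BlocksClean l p e a' := by
  set d := 2 ^ e with hd
  have hd0 : 0 < d := by positivity
  have hdvd : d ∣ 2 ^ l := pow_dvd_pow 2 (by omega)
  have h2d : 2 ^ (e + 1) = 2 * d := by rw [pow_succ]; ring
  obtain ⟨hs1, hs2⟩ := hs
  rw [h2d] at hs1 hs2
  have hblk : ∀ k, (k + 1) * d ≤ 2 ^ l → IsIntervalOn d (fun o => a' (k * (2 * d) + o)) ∧
      IsIntervalOn d (fun o => a' (k * (2 * d) + (d + o))) ∧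
      ∀ o < d, ∀ o' < d, a' (k * (2 * d) + o) = true → a' (k * (2 * d) + (d + o')) = true := by
    intro k hk
    refine half_clean (b := fun o => a (k * (2 * d) + o)) (b' := fun o => a' (k * (2 * d) + o))
      (hs1 k (by nlinarith)) (fun o ho => ?_) (fun o ho => ?_)
    · exact (stageRel_block H hk ho).1
    · exact (stageRel_block H hk ho).2
  refine ⟨fun k hk => block_parity (fun k hk => ⟨(hblk k hk).1, (hblk k hk).2.1⟩) hk hdvd,
    fun i j hi hj hij hlt => ?_⟩
  rw [← hd] at hlt
  obtain ⟨k, o, ho, hk, hik⟩ := exists_pos hdvd hi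
  obtain ⟨k', o', ho', hk', hjk⟩ := exists_pos hdvd hj
  have e1 : i / (2 * d) = k := by
    rcases hik with rfl | rfl <;> exact div_two_mul_of_block (by omega)
  have e2 : j / (2 * d) = k' := by
    rcases hjk with rfl | rfl <;> exact div_two_mul_of_block (by omega)
  by_cases hkk : k = k'
  · subst hkk
    rcases hik with rfl | rfl <;> rcases hjk with rfl | rfl <;>
      simp only [div_of_block_left ho, div_of_block_right ho, div_of_block_left ho',
        div_of_block_right ho'] at hlt
    · omega
    · exact fun h => (hblk k hk).2.2 o ho o' ho' h
    · omega
    · omega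
  · have hkk' : k < k' := by
      have h1 : i / d / 2 = k := by rw [Nat.div_div_eq_div_mul, mul_comm d, e1]
      have h2 : j / d / 2 = k' := by rw [Nat.div_div_eq_div_mul, mul_comm d, e2]
      omega
    -- Which block of length `2 ^ (p + 1)` a position belongs to depends only on its block of length
    -- `2 * d`. So the hypothesis on `i` and `j` transfers to all positions of their blocks.
    have hpow : 2 ^ (p + 1) = 2 * d * 2 ^ (p - e) := by
      rw [← h2d, ← pow_add]; congr 1; omega
    have hdiv : ∀ x, x / 2 ^ (p + 1) = x / (2 * d) / 2 ^ (p - e) := fun x => by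
      rw [hpow, Nat.div_div_eq_div_mul]
    have hkb : (k + 1) * d = k * d + d := by ring
    have hkb' : (k' + 1) * d = k' * d + d := by ring
    have hk2 : k * (2 * d) = 2 * (k * d) := by ring
    have hk2' : k' * (2 * d) = 2 * (k' * d) := by ring
    have key : ∀ x < 2 * d, ∀ y < 2 * d, a (k * (2 * d) + x) = true →
        a (k' * (2 * d) + y) = true := by
      intro x hx y hy
      refine hs2 _ _ (by omega) (by omega) ?_ ?_
      · rw [hdiv, hdiv] at hij ⊢
        rw [div_two_mul_of_block hx, div_two_mul_of_block hy]
        rwa [e1, e2] at hij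
      · rwa [div_two_mul_of_block hx, div_two_mul_of_block hy]
    obtain ⟨f1, f2⟩ := stageRel_block H hk ho
    obtain ⟨g1, g2⟩ := stageRel_block H hk' ho'
    simp only [Bool.false_eq_true, if_false] at f1 f2 g1 g2
    have hx : ∃ x < 2 * d, a' i = true → a (k * (2 * d) + x) = true := by
      rcases hik with rfl | rfl
      · exact ⟨o, by omega, fun h => by rw [f1, Bool.and_eq_true] at h; exact h.1⟩
      · by_cases ha : a (k * (2 * d) + o) = true
        · exact ⟨o, by omega, fun _ => ha⟩
        · refine ⟨d + o, by omega, fun h => ?_⟩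
          rw [f2, Bool.or_eq_true] at h
          exact h.resolve_left ha
    obtain ⟨x, hx, hax⟩ := hx
    intro h
    have h' := hax h
    rcases hjk with rfl | rfl
    · rw [g1, key x hx o' (by omega) h', key x hx (d + o') (by omega) h']; rfl
    · rw [g2, key x hx o' (by omega) h']; rfl

/-- Merge sort: round p merges sorted blocks of length 2^p in pairs, by one mirrored stage and then
p half-cleaners. After r of these, the clean blocks have length 2^(p-r). -/
theorem blocksSorted_of_netRel {L : ℕ} (hL : L ≤ l + 1) {a b : ℕ → Bool}
    (H : NetRel (2 ^ l) (stages L) a b) : BlocksSorted l L b := by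
  induction L generalizing b with
  | zero =>
    intro i j hij _ he
    simp at he
    omega
  | succ p ih =>
    rw [stages, List.range_succ, List.flatMap_append, List.flatMap_cons, List.flatMap_nil,
      List.append_nil] at H
    obtain ⟨c, h1, d, h2, h3⟩ := netRel_append.1 H
    have hc := blocksClean_mirror (by omega) (ih (by omega) h1) h2
    have key : ∀ r ≤ p, ∀ e, NetRel (2 ^ l)
        ((List.range r).map fun r => (false, 2 ^ (p - 1 - r))) d e → BlocksClean l p (p - r) e := by
      intro r
      induction r with
      | zero =>
        intro _ e he
        cases he
        exact hc
      | succ r ihr =>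
        intro hr e he
        rw [List.range_succ, List.map_append] at he
        obtain ⟨c', h4, e', h5, h6⟩ := netRel_append.1 he
        cases h6
        have := ihr (by omega) c' h4
        rw [show p - r = p - (r + 1) + 1 by omega] at this
        refine blocksClean_half (by omega) (by omega) this ?_
        rw [show p - (r + 1) = p - 1 - r by omega]
        exact h5
    -- At block length 1 different positions lie in different blocks, so cleanliness is sortedness.
    have hfin := key p le_rfl b h3
    rw [Nat.sub_self] at hfin
    intro i j hij hj he
    exact hfin.2 i j (by omega) hj he (by simpa using hij)

end ZeroOne

/-- The network sorts. -/
theorem NetRel.sorted {α : Type*} [LinearOrder α] {l : ℕ} {a b : ℕ → α}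
    (H : NetRel (2 ^ l) (stages (l + 1)) a b) {i j : ℕ} (hij : i < j) (hj : j < 2 ^ (l + 1)) :
    b i ≤ b j := by
  by_contra hlt
  push Not at hlt
  -- Zero-one principle: thresholding at `b i` would turn a descent in the output into a descent in
  -- a Boolean output of the same network.
  have hg : Monotone fun x : α => decide (b i ≤ x) := by
    intro x y hxy hx
    simp only [decide_eq_true_eq] at hx ⊢
    exact hx.trans hxy
  have hj' : j < 2 * 2 ^ l := by rw [pow_succ] at hj; omega
  have h1 := blocksSorted_of_netRel le_rfl (H.comp hg) i j hij hj' (by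
    rw [Nat.div_eq_of_lt hj, Nat.div_eq_of_lt (hij.trans hj)])
  have h2 : decide (b i ≤ b j) = true := h1 (by simp)
  simp only [decide_eq_true_eq] at h2
  exact absurd h2 (not_le.2 hlt)

/-! ### Records -/

/-- The number with the given binary digits. -/
def recVal : ℕ → (ℕ → Bool) → ℕ
  | 0, _ => 0
  | w + 1, g => recVal w g + (g w).toNat * 2 ^ w

theorem recVal_lt (w : ℕ) (g : ℕ → Bool) : recVal w g < 2 ^ w := by
  induction w with
  | zero => simp [recVal]
  | succ w ih =>
    rw [recVal, pow_succ]
    cases g w <;> simp <;> omega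

theorem recVal_congr {w : ℕ} {g g' : ℕ → Bool} (h : ∀ b < w, g b = g' b) :
    recVal w g = recVal w g' := by
  induction w with
  | zero => rfl
  | succ w ih => rw [recVal, recVal, ih fun b hb => h b (by omega), h w (by omega)]

/-- The top bit decides unless it is equal in both. This is the recursion that the operation `gt`
implements bit by bit. -/
theorem recVal_succ_lt {w : ℕ} {g g' : ℕ → Bool} :
    recVal (w + 1) g < recVal (w + 1) g' ↔
      if g w = g' w then recVal w g < recVal w g' else g' w = true := by
  have h1 := recVal_lt w g
  have h2 := recVal_lt w g'
  simp only [recVal]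
  cases g w <;> cases g' w <;> simp <;> omega

theorem recVal_inj {w : ℕ} {g g' : ℕ → Bool} (h : recVal w g = recVal w g') :
    ∀ b < w, g b = g' b := by
  induction w with
  | zero => intro b hb; omega
  | succ w ih =>
    have h1 := recVal_lt w g
    have h2 := recVal_lt w g'
    simp only [recVal] at h
    have hw : g w = g' w := by
      revert h
      cases g w <;> cases g' w <;> simp <;> omega
    rw [hw] at h
    intro b hb
    rcases Nat.lt_succ_iff_lt_or_eq.1 hb with hb | rfl
    · exact ih (by omega) b hb
    · exact hw

theorem recVal_add (m k : ℕ) (g : ℕ → Bool) :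
    recVal (m + k) g = recVal m g + 2 ^ m * recVal k fun b => g (m + b) := by
  induction k with
  | zero => simp [recVal]
  | succ k ih => rw [← add_assoc, recVal, ih, recVal, pow_add]; ring

theorem recVal_lt_two_pow_iff {w : ℕ} {g : ℕ → Bool} : recVal (w + 1) g < 2 ^ w ↔ g w = false := by
  have h1 := recVal_lt w g
  rw [recVal]
  cases g w
  · simp; omega
  · simp

/-- The record in a row. -/
def rowVal (σ : Mem) (w ρ i : ℕ) : ℕ := recVal w fun b => σ (ρ, i, b)

theorem lo_div_mod {d : ℕ} (hd : 0 < d) (u : ℕ) :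
    lo d u / (2 * d) = u / d ∧ lo d u % (2 * d) = u % d := by
  have : u % d < 2 * d := by have := Nat.mod_lt u hd; omega
  rw [lo, mul_comm (u / d)]
  rw [Nat.mul_add_div (by omega), Nat.mul_add_mod, Nat.div_eq_of_lt this, Nat.mod_eq_of_lt this,
    add_zero]
  exact ⟨rfl, rfl⟩

theorem hi_div_mod {st : Bool × ℕ} (hd : 0 < st.2) (u : ℕ) :
    hi st u / (2 * st.2) = u / st.2 ∧
      hi st u % (2 * st.2) = if st.1 then 2 * st.2 - 1 - u % st.2 else st.2 + u % st.2 := by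
  have h := Nat.mod_lt u hd
  have : (if st.1 then 2 * st.2 - 1 - u % st.2 else st.2 + u % st.2) < 2 * st.2 := by
    split_ifs <;> omega
  rw [hi, mul_comm (u / st.2)]
  rw [Nat.mul_add_div (by omega), Nat.mul_add_mod, Nat.div_eq_of_lt this, Nat.mod_eq_of_lt this,
    add_zero]
  exact ⟨rfl, rfl⟩

theorem lo_inj {d : ℕ} (hd : 0 < d) {u u' : ℕ} (h : lo d u = lo d u') : u = u' := by
  obtain ⟨h1, h2⟩ := lo_div_mod hd u
  obtain ⟨h3, h4⟩ := lo_div_mod hd u'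
  rw [h] at h1 h2
  rw [← Nat.div_add_mod u d, ← Nat.div_add_mod u' d, ← h1, ← h2, h3, h4]

theorem hi_inj {st : Bool × ℕ} (hd : 0 < st.2) {u u' : ℕ} (h : hi st u = hi st u') : u = u' := by
  obtain ⟨h1, h2⟩ := hi_div_mod hd u
  obtain ⟨h3, h4⟩ := hi_div_mod hd u'
  rw [h] at h1 h2
  have h5 := Nat.mod_lt u hd
  have h6 := Nat.mod_lt u' hd
  have h7 : u % st.2 = u' % st.2 := by
    rw [h4] at h2
    revert h2
    split_ifs <;> omega
  rw [← Nat.div_add_mod u st.2, ← Nat.div_add_mod u' st.2, ← h1, h3, h7]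

theorem lo_ne_hi {st : Bool × ℕ} (hd : 0 < st.2) (u u' : ℕ) : lo st.2 u ≠ hi st u' := by
  intro h
  have h2 := (lo_div_mod hd u).2
  have h4 := (hi_div_mod hd u').2
  rw [h, h4] at h2
  have h5 := Nat.mod_lt u hd
  have h6 := Nat.mod_lt u' hd
  revert h2
  split_ifs <;> omega

/-! ### The sorting network as a program on memories. -/

section Spec

variable {n : ℕ} {f : Bits n → Bits n}

/-- One stage of the network sorts pairs of records. -/
theorem exec_stageProg {ρ w h : ℕ} {st : Bool × ℕ} (hd : 0 < st.2) {σ : Mem}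
    (hσ : ∀ v : Addr, v.1 = ρ + 1 → σ v = false) :
    (∀ v : Addr, v.1 ≠ ρ + 1 → exec f (stageProg ρ w h st) σ v = σ v) ∧
    StageRel h st (rowVal σ w ρ) (rowVal (exec f (stageProg ρ w h st) σ) w (ρ + 1)) := by
  rw [stageProg, exec_append, exec_append]
  set σ₁ := exec f (loop Kind.gt w h (fun b u => [(ρ + 1, lo st.2 u, w + b + 1), (ρ, lo st.2 u, b),
    (ρ, hi st u, b), (ρ + 1, lo st.2 u, w + b)])) σ with hσ₁
  set σ₂ := exec f (loop Kind.mux w h (fun b u => [(ρ + 1, lo st.2 u, b), (ρ + 1, lo st.2 u, w + w),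
    (ρ, hi st u, b), (ρ, lo st.2 u, b)])) σ₁ with hσ₂
  set σ₃ := exec f (loop Kind.mux w h (fun b u => [(ρ + 1, hi st u, b), (ρ + 1, lo st.2 u, w + w),
    (ρ, lo st.2 u, b), (ρ, hi st u, b)])) σ₂ with hσ₃
  obtain ⟨a1, a2⟩ := exec_loop (f := f) (κ := Kind.gt) (by decide) (w := w) (cnt := h)
    (T := fun b u => (ρ + 1, lo st.2 u, w + b + 1))
    (C := fun b u => [(ρ, lo st.2 u, b), (ρ, hi st u, b), (ρ + 1, lo st.2 u, w + b)])
    (fun b _ b' _ u _ u' _ e => by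
      simp only [Prod.mk.injEq, true_and] at e
      exact ⟨by omega, lo_inj hd e.1⟩)
    (fun b _ b' hb u _ u' _ => by
      simp only [List.mem_cons, Prod.mk.injEq, List.not_mem_nil, true_and, or_false]
      omega) σ
  obtain ⟨b1, b2⟩ := exec_loop (f := f) (κ := Kind.mux) (by decide) (w := w) (cnt := h)
    (T := fun b u => (ρ + 1, lo st.2 u, b))
    (C := fun b u => [(ρ + 1, lo st.2 u, w + w), (ρ, hi st u, b), (ρ, lo st.2 u, b)])
    (fun b _ b' _ u _ u' _ e => by
      simp only [Prod.mk.injEq, true_and] at e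
      exact ⟨by omega, lo_inj hd e.1⟩)
    (fun b _ b' hb u _ u' _ => by
      simp only [List.mem_cons, Prod.mk.injEq, List.not_mem_nil, true_and, or_false]
      omega) σ₁
  obtain ⟨c1, c2⟩ := exec_loop (f := f) (κ := Kind.mux) (by decide) (w := w) (cnt := h)
    (T := fun b u => (ρ + 1, hi st u, b))
    (C := fun b u => [(ρ + 1, lo st.2 u, w + w), (ρ, lo st.2 u, b), (ρ, hi st u, b)])
    (fun b _ b' _ u _ u' _ e => by
      simp only [Prod.mk.injEq, true_and] at e
      exact ⟨by omega, hi_inj hd e.1⟩)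
    (fun b _ b' hb u _ u' _ => by
      simp only [List.mem_cons, Prod.mk.injEq, List.not_mem_nil, true_and, or_false]
      omega) σ₂
  rw [← hσ₁] at a1 a2
  rw [← hσ₂] at b1 b2
  rw [← hσ₃] at c1 c2
  have f1 : ∀ v : Addr, v.1 ≠ ρ + 1 → σ₁ v = σ v := fun v hv => a2 v fun b _ u _ e => hv (by rw [e])
  have f2 : ∀ v : Addr, v.1 ≠ ρ + 1 → σ₂ v = σ v := fun v hv =>
    (b2 v fun b _ u _ e => hv (by rw [e])).trans (f1 v hv)
  have f3 : ∀ v : Addr, v.1 ≠ ρ + 1 → σ₃ v = σ v := fun v hv =>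
    (c2 v fun b _ u _ e => hv (by rw [e])).trans (f2 v hv)
  refine ⟨f3, fun u hu => ?_⟩
  -- The comparison runs from the least significant bit upwards, each new bit overriding the verdict
  -- on the bits below. Column `w + w` thus contains the full comparison, which controls both
  -- multiplexers.
  have hgt : ∀ b ≤ w, σ₁ (ρ + 1, lo st.2 u, w + b) =
      decide (recVal b (fun b => σ (ρ, hi st u, b)) < recVal b fun b => σ (ρ, lo st.2 u, b)) := by
    intro b
    induction b with
    | zero =>
      intro _
      rw [a2, hσ _ rfl]
      · simp [recVal]
      · intro b _ u _ e
        simp only [Prod.mk.injEq] at e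
        omega
    | succ b ih =>
      intro hb
      have h1 := a1 b (by omega) u hu
      rw [hσ (ρ + 1, lo st.2 u, w + b + 1) rfl, List.map_cons,
        List.map_cons, List.map_cons, List.map_nil, Kind.poly_gt,
        f1 (ρ, lo st.2 u, b) (by simp), f1 (ρ, hi st u, b) (by simp), ih (by omega)] at h1
      rw [← add_assoc, h1]
      simp only [recVal_succ_lt]
      cases σ (ρ, lo st.2 u, b) <;> cases σ (ρ, hi st u, b) <;> simp
  have hg := hgt w le_rfl
  have e1 : ∀ b < w, σ₃ (ρ + 1, lo st.2 u, b) =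
      if rowVal σ w ρ (hi st u) < rowVal σ w ρ (lo st.2 u) then σ (ρ, hi st u, b)
      else σ (ρ, lo st.2 u, b) := by
    intro b hb
    have h1 := b1 b hb u hu
    rw [a2 (ρ + 1, lo st.2 u, b) (fun b' _ u' _ e => by simp only [Prod.mk.injEq] at e; omega),
      hσ (ρ + 1, lo st.2 u, b) rfl] at h1
    simp only [List.map_cons, List.map_nil, Kind.poly_mux] at h1
    rw [f2 (ρ, hi st u, b) (by simp), f2 (ρ, lo st.2 u, b) (by simp),
      b2 (ρ + 1, lo st.2 u, w + w) (fun b' _ u' _ e => by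
        simp only [Prod.mk.injEq] at e; omega), hg] at h1
    rw [c2 (ρ + 1, lo st.2 u, b)
      (fun b' _ u' _ e => lo_ne_hi hd u u' (by simp only [Prod.mk.injEq] at e; exact e.2.1)),
      h1]
    by_cases hlt : (recVal w fun b => σ (ρ, hi st u, b)) < recVal w fun b => σ (ρ, lo st.2 u, b) <;>
      simp [rowVal, hlt]
  have e2 : ∀ b < w, σ₃ (ρ + 1, hi st u, b) =
      if rowVal σ w ρ (hi st u) < rowVal σ w ρ (lo st.2 u) then σ (ρ, lo st.2 u, b)
      else σ (ρ, hi st u, b) := by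
    intro b hb
    have h1 := c1 b hb u hu
    rw [b2 (ρ + 1, hi st u, b) (fun b' _ u' _ e => lo_ne_hi hd u' u (by
        simp only [Prod.mk.injEq] at e; exact e.2.1.symm)),
      a2 (ρ + 1, hi st u, b) (fun b' _ u' _ e => lo_ne_hi hd u' u (by
        simp only [Prod.mk.injEq] at e; exact e.2.1.symm)), hσ (ρ + 1, hi st u, b) rfl] at h1
    simp only [List.map_cons, List.map_nil, Kind.poly_mux] at h1
    rw [f3 (ρ, hi st u, b) (by simp), f3 (ρ, lo st.2 u, b) (by simp),
      c2 (ρ + 1, lo st.2 u, w + w) (fun b' _ u' _ e => by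
        simp only [Prod.mk.injEq] at e; exact lo_ne_hi hd u u' e.2.1),
      b2 (ρ + 1, lo st.2 u, w + w) (fun b' _ u' _ e => by
        simp only [Prod.mk.injEq] at e; omega), hg] at h1
    rw [h1]
    by_cases hlt : (recVal w fun b => σ (ρ, hi st u, b)) < recVal w fun b => σ (ρ, lo st.2 u, b) <;>
      simp [rowVal, hlt]
  have e3 : rowVal σ₃ w (ρ + 1) (lo st.2 u) =
      if rowVal σ w ρ (hi st u) < rowVal σ w ρ (lo st.2 u) then rowVal σ w ρ (hi st u)
      else rowVal σ w ρ (lo st.2 u) := by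
    split_ifs with hlt <;> simp only [hlt, if_true, if_false] at e1 <;> exact recVal_congr e1
  have e4 : rowVal σ₃ w (ρ + 1) (hi st u) =
      if rowVal σ w ρ (hi st u) < rowVal σ w ρ (lo st.2 u) then rowVal σ w ρ (lo st.2 u)
      else rowVal σ w ρ (hi st u) := by
    split_ifs with hlt <;> simp only [hlt, if_true, if_false] at e2 <;> exact recVal_congr e2
  rw [e3, e4]
  split_ifs with hlt
  · exact ⟨(min_eq_right hlt.le).symm, (max_eq_left hlt.le).symm⟩
  · push Not at hlt
    exact ⟨(min_eq_left hlt).symm, (max_eq_right hlt).symm⟩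

/-- Stage `t` reads region `ρ + t` and writes region `ρ + t + 1`, which is still zero. Nothing is
overwritten, so the history needed for uncomputation stays available. -/
theorem exec_sortProg {ρ w h : ℕ} {sts : List (Bool × ℕ)} (hd : ∀ st ∈ sts, 0 < st.2) {σ : Mem}
    (hσ : ∀ v : Addr, ρ < v.1 → σ v = false) :
    (∀ v : Addr, v.1 ≤ ρ ∨ ρ + sts.length < v.1 → exec f (sortProg ρ w h sts) σ v = σ v) ∧
    NetRel h sts (rowVal σ w ρ) (rowVal (exec f (sortProg ρ w h sts) σ) w (ρ + sts.length)) := by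
  have key : ∀ t ≤ sts.length, ∀ τ, τ = exec f ((List.range t).flatMap fun t =>
        stageProg (ρ + t) w h (sts.getD t (false, 1))) σ →
      (∀ v : Addr, v.1 ≤ ρ ∨ ρ + t < v.1 → τ v = σ v) ∧
      NetRel h (sts.take t) (rowVal σ w ρ) (rowVal τ w (ρ + t)) := by
    intro t
    induction t with
    | zero => rintro - τ rfl; exact ⟨fun _ _ => rfl, rfl⟩
    | succ t ih =>
      rintro ht τ rfl
      obtain ⟨i1, i2⟩ := ih (by omega) _ rfl
      rw [List.range_succ, List.flatMap_append, exec_append, List.flatMap_cons, List.flatMap_nil,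
        List.append_nil]
      have hlt : t < sts.length := by omega
      rw [List.getD_eq_getElem _ _ hlt]
      set τ' := exec f ((List.range t).flatMap fun t =>
        stageProg (ρ + t) w h (sts.getD t (false, 1))) σ
      obtain ⟨j1, j2⟩ := exec_stageProg (f := f) (w := w) (h := h) (ρ := ρ + t)
        (hd sts[t] (List.getElem_mem hlt)) (σ := τ') (fun v hv => by
          rw [i1 v (Or.inr (by omega)), hσ v (by omega)])
      refine ⟨fun v hv => ?_, ?_⟩
      · rw [j1 v (by omega), i1 v (by omega)]
      · rw [← List.take_concat_get' sts t hlt, netRel_append]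
        exact ⟨_, i2, _, j2, rfl⟩
  have := key sts.length le_rfl _ rfl
  rwa [List.take_length] at this

end Spec

/-! ### Validity of the programs -/

/-- Programs made of calls and polynomial operations on logical wires satisfying `B`. -/
def Valid (m : ℕ) (B : Addr → Prop) (Q : List Layer) : Prop :=
  ∀ ℓ ∈ Q, ℓ.OK m B ∧ (ℓ.1 = 0 ∨ 3 ≤ ℓ.1)

section Valid

variable {m : ℕ} {B B' : Addr → Prop} {P Q : List Layer}

theorem Layer.OK.mono {ℓ : Layer} (h : ℓ.OK m B) (hB : ∀ v, B v → B' v) : ℓ.OK m B' :=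
  ⟨h.ne_nil, h.nodup, h.kind, h.length, fun ws hws v hv => hB v (h.bounded ws hws v hv)⟩

theorem Valid.mono (h : Valid m B Q) (hB : ∀ v, B v → B' v) : Valid m B' Q :=
  fun ℓ hℓ => ⟨(h ℓ hℓ).1.mono hB, (h ℓ hℓ).2⟩

theorem Valid.append (hP : Valid m B P) (hQ : Valid m B Q) : Valid m B (P ++ Q) := by
  intro ℓ hℓ
  rcases List.mem_append.1 hℓ with h | h
  exacts [hP ℓ h, hQ ℓ h]

theorem Valid.reverse (hP : Valid m B P) : Valid m B P.reverse :=
  fun ℓ hℓ => hP ℓ (List.mem_reverse.1 hℓ)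

theorem Valid.flatMap {ι : Type*} {I : List ι} {F : ι → List Layer}
    (h : ∀ i ∈ I, Valid m B (F i)) : Valid m B (I.flatMap F) := by
  intro ℓ hℓ
  obtain ⟨i, hi, hℓ⟩ := List.mem_flatMap.1 hℓ
  exact h i hi ℓ hℓ

theorem Valid.ok (h : Valid m B Q) : ∀ ℓ ∈ Q, ℓ.OK m B := fun ℓ hℓ => (h ℓ hℓ).1

theorem Valid.kind (h : Valid m B Q) : ∀ ℓ ∈ Q, ℓ.1 = 0 ∨ 3 ≤ ℓ.1 := fun ℓ hℓ => (h ℓ hℓ).2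

theorem Valid.bounded (h : Valid m B Q) : ∀ v ∈ wires Q, B v := by
  intro v hv
  obtain ⟨ℓ, hℓ, hv⟩ := List.mem_flatMap.1 hv
  obtain ⟨ws, hws, hv⟩ := List.mem_flatten.1 hv
  exact (h.ok ℓ hℓ).bounded ws hws v hv

theorem ok_lay {κ cnt : ℕ} {F : ℕ → List Addr} (h0 : 0 < cnt) (h12 : κ < 12)
    (hl : ∀ u, (F u).length = Kind.arity m κ) (hn : ∀ u < cnt, (F u).Nodup)
    (hd : ∀ u < cnt, ∀ u' < cnt, u < u' → (F u).Disjoint (F u'))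
    (hB : ∀ u < cnt, ∀ v ∈ F u, B v) : (lay κ cnt F).OK m B := by
  refine ⟨by simp [lay]; omega, ?_, h12, ?_, ?_⟩
  · simp only [lay, List.nodup_flatten, List.forall_mem_map, List.mem_range, List.pairwise_map]
    refine ⟨hn, List.Pairwise.imp_of_mem ?_ List.pairwise_lt_range⟩
    intro u u' hu hu' hlt
    exact hd u (List.mem_range.1 hu) u' (List.mem_range.1 hu') hlt
  · simp only [lay, List.forall_mem_map]
    exact fun u _ => hl u
  · simp only [lay, List.forall_mem_map, List.mem_range]
    exact hB

theorem valid_loop {κ w cnt : ℕ} {F : ℕ → ℕ → List Addr} (h0 : 0 < cnt) (h3 : 3 ≤ κ) (h12 : κ < 12)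
    (hl : ∀ b u, (F b u).length = Kind.arity m κ) (hn : ∀ b < w, ∀ u < cnt, (F b u).Nodup)
    (hd : ∀ b < w, ∀ u < cnt, ∀ u' < cnt, u < u' → (F b u).Disjoint (F b u'))
    (hB : ∀ b < w, ∀ u < cnt, ∀ v ∈ F b u, B v) : Valid m B (loop κ w cnt F) := by
  intro ℓ hℓ
  obtain ⟨b, hb, rfl⟩ := List.mem_map.1 hℓ
  rw [List.mem_range] at hb
  exact ⟨ok_lay h0 h12 (hl b) (hn b hb) (hd b hb) (hB b hb), Or.inr h3⟩

theorem valid_stageProg {ρ w h : ℕ} {st : Bool × ℕ} (hh : 0 < h) (hd : st.2 ∣ h)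
    (hB : ∀ v : Addr, v.1 = ρ ∨ v.1 = ρ + 1 → v.2.1 < 2 * h → v.2.2 ≤ 2 * w → B v) :
    Valid m B (stageProg ρ w h st) := by
  have hd0 : 0 < st.2 := Nat.pos_of_dvd_of_pos hd hh
  have hlo : ∀ u < h, lo st.2 u < 2 * h := fun u hu => lo_lt hd hu
  have hhi : ∀ u < h, hi st u < 2 * h := fun u hu => hi_lt hd hu st.1
  have key : ∀ u u', u < u' → lo st.2 u ≠ lo st.2 u' ∧ hi st u ≠ hi st u' ∧
      lo st.2 u ≠ hi st u' ∧ lo st.2 u' ≠ hi st u := fun u u' hlt =>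
    ⟨fun e => hlt.ne (lo_inj hd0 e), fun e => hlt.ne (hi_inj hd0 e), lo_ne_hi hd0 _ _,
      lo_ne_hi hd0 _ _⟩
  refine ((valid_loop hh (by decide) (by decide) (fun _ _ => rfl) ?_ ?_ ?_).append
    (valid_loop hh (by decide) (by decide) (fun _ _ => rfl) ?_ ?_ ?_)).append
    (valid_loop hh (by decide) (by decide) (fun _ _ => rfl) ?_ ?_ ?_)
  any_goals
    intro b hb u hu
    have := lo_ne_hi hd0 u u
    simp only [List.nodup_cons, List.mem_cons, Prod.mk.injEq, List.not_mem_nil, true_and, or_false,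
      List.nodup_nil, not_false_eq_true, and_true]
    omega
  any_goals
    intro b hb u hu u' hu' hlt v hv hv'
    obtain ⟨k1, k2, k3, k4⟩ := key u u' hlt
    simp only [List.mem_cons, List.not_mem_nil, or_false] at hv hv'
    rcases hv with rfl | rfl | rfl | rfl <;> simp only [Prod.mk.injEq] at hv' <;> omega
  all_goals
    intro b hb u hu v hv
    have h1 := hlo u hu
    have h2 := hhi u hu
    simp only [List.mem_cons, List.not_mem_nil, or_false] at hv
    rcases hv with rfl | rfl | rfl | rfl <;> refine hB _ ?_ ?_ ?_ <;> dsimp only <;> omega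

theorem valid_sortProg {ρ w h : ℕ} {sts : List (Bool × ℕ)} (hh : 0 < h) (hd : ∀ st ∈ sts, st.2 ∣ h)
    (hB : ∀ v : Addr, ρ ≤ v.1 → v.1 ≤ ρ + sts.length → v.2.1 < 2 * h → v.2.2 ≤ 2 * w → B v) :
    Valid m B (sortProg ρ w h sts) := by
  refine Valid.flatMap fun t ht => ?_
  rw [List.mem_range] at ht
  rw [List.getD_eq_getElem _ _ ht]
  exact valid_stageProg hh (hd _ (List.getElem_mem ht)) fun v h1 h2 h3 =>
    hB v (by omega) (by omega) h2 h3

end Valid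

section Programs

variable {n l a k : ℕ}

/-- The wires used by an oracle call. -/
def OracleWire (n l a k : ℕ) (v : Addr) : Prop :=
  Bdd (nRegions n l) (2 ^ (l + 1)) (nCols n a) v ∧
    (workBase n ≤ v.1 ∨ v.1 = 1 + k ∧ v.2.1 = 0 ∧ v.2.2 < qbits n l)

theorem valid_fanProg (hl : l ≤ n) (hk : k < n - l + 2) :
    Valid (n + n + a) (OracleWire n l a k) (fanProg n l k) := by
  have h2 : 0 < 2 ^ (l + 1) := by positivity
  refine (valid_loop one_pos (by decide) (by decide) (fun _ _ => rfl) ?_ ?_ ?_).append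
    (Valid.flatMap fun j hj => valid_loop (by positivity) (by decide) (by decide) (fun _ _ => rfl)
      ?_ ?_ ?_)
  · intro b hb u hu
    simp [workBase]
    omega
  · intros; omega
  · intro b hb u hu v hv
    simp only [List.mem_cons, List.not_mem_nil, or_false] at hv
    simp only [qbits, workBase] at *
    rcases hv with rfl | rfl <;> dsimp only [OracleWire, Bdd, nRegions, nCols, workBase, qbits] <;>
      omega
  · intro b hb u hu
    have : 0 < 2 ^ j := by positivity
    simp only [List.nodup_cons, List.mem_cons, Prod.mk.injEq, List.not_mem_nil, true_and, or_false,
      List.nodup_nil, not_false_eq_true, and_true]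
    omega
  · intro b hb u hu u' hu' hlt v hv hv'
    simp only [List.mem_cons, List.not_mem_nil, or_false] at hv hv'
    rcases hv with rfl | rfl <;> simp only [Prod.mk.injEq] at hv' <;> omega
  · intro b hb u hu v hv
    have h3 : 2 ^ (j + 1) ≤ 2 ^ (l + 1) :=
      Nat.pow_le_pow_right (by norm_num) (by rw [List.mem_range] at hj; omega)
    rw [pow_succ] at h3
    simp only [List.mem_cons, List.not_mem_nil, or_false] at hv
    rcases hv with rfl | rfl <;>
      dsimp only [OracleWire, Bdd, nRegions, nCols, workBase, qbits] at * <;> omega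

/-- The quotient `u / 2 ^ l` is 0 in the rows of the first block and 1 in those of the second; it
selects which half of the search register a row reads. -/
theorem div_pow_mul_le {u : ℕ} (hu : u < 2 ^ (l + 1)) (x : ℕ) : u / 2 ^ l * x ≤ x := by
  have : u / 2 ^ l < 2 := Nat.div_lt_of_lt_mul (by rw [pow_succ] at hu; exact hu)
  calc u / 2 ^ l * x ≤ 1 * x := Nat.mul_le_mul_right _ (by omega)
    _ = x := one_mul x

theorem valid_call :
    (lay Kind.call (2 ^ (l + 1)) fun u =>
      (List.range (n + n + a)).map fun j => (workBase n + 1, u, j)).OK (n + n + a)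
      (OracleWire n l a k) := by
  refine ok_lay (by positivity) (by decide) (fun u => by simp [Kind.arity]) ?_ ?_ ?_
  · intro u _
    rw [List.nodup_map_iff_inj_on List.nodup_range]
    simp
  · intro u hu u' hu' hlt v hv hv'
    simp only [List.mem_map] at hv hv'
    obtain ⟨j, hj, rfl⟩ := hv
    obtain ⟨j', hj', e⟩ := hv'
    simp only [Prod.mk.injEq] at e
    omega
  · intro u hu v hv
    simp only [List.mem_map, List.mem_range] at hv
    obtain ⟨j, hj, rfl⟩ := hv
    dsimp only [OracleWire, Bdd, nRegions, nCols, workBase, qbits]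
    omega

theorem valid_loadOne (hl : l ≤ n) :
    Valid (n + n + a) (OracleWire n l a k)
      (loop Kind.one l (2 ^ l) (fun b u => [(workBase n + 1, hi (false, 2 ^ b) u, b)])) := by
  refine valid_loop (by positivity) (by decide) (by decide) (fun _ _ => rfl) ?_ ?_ ?_
  · simp
  · intro b hb u hu u' hu' hlt v hv hv'
    simp only [List.mem_cons, List.not_mem_nil, or_false] at hv hv'
    rw [hv] at hv'
    simp only [Prod.mk.injEq, true_and, and_true] at hv'
    exact hlt.ne (hi_inj (st := (false, 2 ^ b)) (by positivity) hv')
  · intro b hb u hu v hv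
    have h1 : hi (false, 2 ^ b) u < 2 * 2 ^ l := hi_lt (pow_dvd_pow 2 hb.le) hu false
    rw [← pow_succ'] at h1
    simp only [List.mem_cons, List.not_mem_nil, or_false] at hv
    rw [hv]
    dsimp only [OracleWire, Bdd, nRegions, nCols, workBase]
    omega

theorem valid_loadCopy :
    Valid (n + n + a) (OracleWire n l a k) (loop Kind.copy (n - l) (2 ^ (l + 1)) (fun b u =>
      [(workBase n + 1, u, l + b), (workBase n, u, u / 2 ^ l * (n - l) + b)])) := by
  refine valid_loop (by positivity) (by decide) (by decide) (fun _ _ => rfl) ?_ ?_ ?_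
  · intro b hb u hu
    simp
  · intro b hb u hu u' hu' hlt v hv hv'
    simp only [List.mem_cons, List.not_mem_nil, or_false] at hv hv'
    rcases hv with rfl | rfl <;> simp only [Prod.mk.injEq] at hv' <;> omega
  · intro b hb u hu v hv
    have h3 := div_pow_mul_le hu (n - l)
    simp only [List.mem_cons, List.not_mem_nil, or_false] at hv
    rcases hv with rfl | rfl <;>
      dsimp only [OracleWire, Bdd, nRegions, nCols, workBase] <;> omega

theorem valid_loadProg (hl : l ≤ n) :
    Valid (n + n + a) (OracleWire n l a k) (loadProg n l a) := by
  refine ((valid_loadOne hl).append valid_loadCopy).append fun ℓ hℓ => ?_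
  rw [List.mem_singleton.1 hℓ]
  exact ⟨valid_call, Or.inl rfl⟩

theorem valid_adjProg (hl : l ≤ n) : Valid (n + n + a) (OracleWire n l a k) (adjProg n l) := by
  have h2 : 0 < 2 ^ l := by positivity
  have h3 : 0 < 2 ^ (l + 1) - 1 := by rw [pow_succ]; omega
  have h4 : 0 < 2 ^ (l + 1) := by positivity
  refine ((((((valid_loop h3 (by decide) (by decide) (fun _ _ => rfl) ?_ ?_ ?_).append
    (valid_loop h3 (by decide) (by decide) (fun _ _ => rfl) ?_ ?_ ?_)).append
    (valid_loop h3 (by decide) (by decide) (fun _ _ => rfl) ?_ ?_ ?_)).append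
    (valid_loop h4 (by decide) (by decide) (fun _ _ => rfl) ?_ ?_ ?_)).append
    (valid_loop h4 (by decide) (by decide) (fun _ _ => rfl) ?_ ?_ ?_)).append
    (valid_loop h4 (by decide) (by decide) (fun _ _ => rfl) ?_ ?_ ?_)).append
    (valid_loop h4 (by decide) (by decide) (fun _ _ => rfl) ?_ ?_ ?_)
  any_goals
    intro b hb u hu
    simp only [List.nodup_cons, List.mem_cons, Prod.mk.injEq, List.not_mem_nil, true_and, or_false,
      List.nodup_nil, not_false_eq_true, and_true, sortedReg, workBase]
    omega
  any_goals
    intro b hb u hu u' hu' hlt v hv hv'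
    simp only [List.mem_cons, List.not_mem_nil, or_false] at hv hv'
    rcases hv with rfl | rfl | rfl | rfl <;> simp only [Prod.mk.injEq] at hv' <;> omega
  all_goals
    intro b hb u hu v hv
    simp only [List.mem_cons, List.not_mem_nil, or_false] at hv
    rcases hv with rfl | rfl | rfl | rfl <;>
    dsimp only [OracleWire, Bdd, nRegions, nCols, sortedReg, workBase] <;> omega

end Programs

section Programs

variable {n l a k : ℕ}

theorem valid_oracle (hl : l ≤ n) (hk : k < n - l + 2) :
    Valid (n + n + a) (OracleWire n l a k) (oracle n l a k) := by
  refine ((((valid_fanProg hl hk).append (valid_loadProg hl)).append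
    (valid_sortProg (by positivity) (fun st hst => dvd_of_mem_stages hst) ?_)).append
    (valid_adjProg hl)).append
    (valid_sortProg (by positivity) (fun st hst => dvd_of_mem_stages hst) ?_)
  all_goals
    intro v h1 h2 h3 h4
    rw [← pow_succ'] at h3
    change _ ≤ _ + nStages l at h2
    dsimp only [OracleWire, Bdd, nRegions, nCols, sortedReg, workBase] at *
    omega

theorem valid_zeroTest (hl : l ≤ n) (hk : k < n - l + 2) :
    Valid (n + n + a) (OracleWire n l a k) (zeroTest n l k) := by
  have h2 : 0 < 2 ^ (l + 1) := by positivity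
  refine (valid_loop one_pos (by decide) (by decide) (fun _ _ => rfl) ?_ ?_ ?_).append
    (valid_loop one_pos (by decide) (by decide) (fun _ _ => rfl) ?_ ?_ ?_)
  · simp
  · intros; omega
  · intro b hb u hu v hv
    simp only [List.mem_cons, List.not_mem_nil, or_false] at hv
    rw [hv]
    dsimp only [OracleWire, Bdd, nRegions, nCols, workBase]
    omega
  · intro b hb u hu
    simp [workBase]
    omega
  · intros; omega
  · intro b hb u hu v hv
    simp only [List.mem_cons, List.not_mem_nil, or_false] at hv
    rcases hv with rfl | rfl | rfl <;>
      dsimp only [OracleWire, Bdd, nRegions, nCols, workBase, qbits] at * <;> omega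

theorem valid_extract (hl : l ≤ n) (hk : k < n - l + 2) :
    Valid (n + n + a) (Bdd (nRegions n l) (2 ^ (l + 1)) (nCols n a)) (extract n l k) := by
  have h2 : 0 < 2 ^ (l + 1) := by positivity
  refine ((valid_loop one_pos (by decide) (by decide) (fun _ _ => rfl) ?_ ?_ ?_).append
    (valid_loop one_pos (by decide) (by decide) (fun _ _ => rfl) ?_ ?_ ?_)).append
    (valid_loop one_pos (by decide) (by decide) (fun _ _ => rfl) ?_ ?_ ?_)
  any_goals
    intro b hb u hu
    simp only [List.nodup_cons, List.mem_cons, Prod.mk.injEq, List.not_mem_nil, true_and, or_false,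
      List.nodup_nil, not_false_eq_true, and_true, pairReg, sortedReg, workBase]
    omega
  any_goals
    intros; omega
  all_goals
    intro b hb u hu v hv
    simp only [List.mem_cons, List.not_mem_nil, or_false] at hv
    rcases hv with rfl | rfl | rfl <;>
      dsimp only [Bdd, nRegions, nCols, pairReg, sortedReg, workBase, qbits] at * <;> omega

theorem bdd_register (hl : l ≤ n) (hk : k < n - l + 2) {b : ℕ} (hb : b ≤ qbits n l) :
    Bdd (nRegions n l) (2 ^ (l + 1)) (nCols n a) (1 + k, 0, b) := by
  have h2 : 0 < 2 ^ (l + 1) := by positivity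
  dsimp only [Bdd, nRegions, nCols, qbits] at *
  omega

theorem bdd_pairFlag : Bdd (nRegions n l) (2 ^ (l + 1)) (nCols n a) (pairReg n l, 0, 2 * n) := by
  have h2 : 0 < 2 ^ (l + 1) := by positivity
  dsimp only [Bdd, nRegions, nCols, pairReg, sortedReg, workBase] at *
  omega

theorem bdd_zeroFlag : Bdd (nRegions n l) (2 ^ (l + 1)) (nCols n a) (workBase n, 0, qbits n l) := by
  have h2 : 0 < 2 ^ (l + 1) := by positivity
  dsimp only [Bdd, nRegions, nCols, workBase, qbits] at *
  omega

theorem ok_hadLayer (hl : l ≤ n) (hk : k < n - l + 2) :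
    (hadLayer n l k).OK (n + n + a) (Bdd (nRegions n l) (2 ^ (l + 1)) (nCols n a)) := by
  refine ok_lay (by simp [qbits]) (by decide) (fun _ => rfl) (by simp) ?_ ?_
  · intro u hu u' hu' hlt v hv hv'
    simp only [List.mem_cons, List.not_mem_nil, or_false] at hv hv'
    rw [hv] at hv'
    simp only [Prod.mk.injEq] at hv'
    omega
  · intro u hu v hv
    rw [List.mem_singleton.1 hv]
    exact bdd_register hl hk hu.le

theorem ok_zedLayer {m : ℕ} {B : Addr → Prop} {z : Addr} (hz : B z) : (zedLayer z).OK m B :=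
  ok_lay one_pos (by decide) (fun _ => rfl) (by simp) (by intros; omega)
    (fun u _ v hv => List.mem_singleton.1 hv ▸ hz)

theorem ok_program (hl : l ≤ n) : ∀ ℓ ∈ program n l a,
    ℓ.OK (n + n + a) (Bdd (nRegions n l) (2 ^ (l + 1)) (nCols n a)) := by
  intro ℓ hℓ
  obtain ⟨k, hk, hℓ⟩ := List.mem_flatMap.1 hℓ
  rw [List.mem_range] at hk
  have ho : Valid (n + n + a) _ (oracle n l a k) := (valid_oracle hl hk).mono fun _ h => h.1
  have hz : Valid (n + n + a) _ (zeroTest n l k) := (valid_zeroTest hl hk).mono fun _ h => h.1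
  simp only [searchRun, groverIter, List.mem_append, List.mem_flatMap, List.mem_singleton] at hℓ
  rcases hℓ with (rfl | ⟨_, _, ((h | rfl) | h) | (rfl | (h | rfl) | h) | rfl⟩) | (h | h) | h
  exacts [ok_hadLayer hl hk, ho.ok _ h, ok_zedLayer bdd_pairFlag, ho.reverse.ok _ h,
    ok_hadLayer hl hk, hz.ok _ h, ok_zedLayer bdd_zeroFlag, hz.reverse.ok _ h, ok_hadLayer hl hk,
    ho.ok _ h, (valid_extract hl hk).ok _ h, ho.reverse.ok _ h]

end Programs

/-! ### Decodability and well-formedness of the generated circuit. -/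

section WellFormed

variable {m P R W w : ℕ} {ℓ : Layer}

theorem isSome_mkBasic (hw : w = P * R * W) {ws : List Addr} (hn : ws.Nodup)
    (hB : ∀ v ∈ ws, Bdd P R W v) {p : ℕ × List ℕ} (hp : Kind.patOK ws.length p) :
    (mkBasic w (p.1 :: p.2.map fun i => enc R W (ws.getD i (0, 0, 0)))).isSome := by
  have hlt : ∀ i < ws.length, enc R W (ws.getD i (0, 0, 0)) < w := fun i hi => by
    rw [List.getD_eq_getElem _ _ hi]
    exact hw ▸ enc_lt (hB _ (List.getElem_mem hi))
  unfold Kind.patOK at hp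
  split at hp
  · rename_i i
    simp only [mkBasic, List.map_cons, List.map_nil]
    rw [dif_pos (hlt i (by simpa using hp))]
    rfl
  · rename_i i
    simp only [mkBasic, List.map_cons, List.map_nil]
    rw [dif_pos (hlt i (by simpa using hp))]
    rfl
  · rename_i i j
    simp only [Bool.and_eq_true, decide_eq_true_eq, bne_iff_ne, ne_eq] at hp
    obtain ⟨⟨hi, hj⟩, hij⟩ := hp
    have hne : enc R W (ws.getD i (0, 0, 0)) ≠ enc R W (ws.getD j (0, 0, 0)) := by
      rw [List.getD_eq_getElem _ _ hi, List.getD_eq_getElem _ _ hj]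
      intro h
      exact hij ((hn.getElem_inj_iff).1 (enc_injOn (hB _ (List.getElem_mem hi))
        (hB _ (List.getElem_mem hj)) h))
    simp only [mkBasic, List.map_cons, List.map_nil]
    rw [dif_pos ⟨hlt i hi, hlt j hj, hne⟩]
    rfl
  · cases hp

theorem Layer.OK.isSome_of_mem_layerCode (h : ℓ.OK m (Bdd P R W)) (hw : w = P * R * W) :
    ∀ s ∈ layerCode R W ℓ, ∀ c ∈ s.2,
      if s.1 then (mkEmb m w c).isSome else (mkBasic w c).isSome := by
  intro s hs c hc
  unfold layerCode at hs
  split_ifs at hs with h0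
  · rw [List.mem_singleton.1 hs] at hc ⊢
    obtain ⟨ws, hws, rfl⟩ := List.mem_map.1 hc
    obtain ⟨e, he, -⟩ := exists_mkEmb (m := m) hw ((List.nodup_flatten.1 h.nodup).1 ws hws)
      (by rw [h.length ws hws, h0]; rfl) (h.bounded ws hws)
    simp [he]
  · obtain ⟨p, hp, rfl⟩ := List.mem_map.1 hs
    obtain ⟨ws, hws, rfl⟩ := List.mem_map.1 hc
    simp only [Bool.false_eq_true, if_false]
    refine isSome_mkBasic hw ((List.nodup_flatten.1 h.nodup).1 ws hws) (h.bounded ws hws) ?_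
    rw [h.length ws hws, Kind.arity_eq h0]
    exact Kind.pats_valid h0 h.kind p hp

/-- No slice is empty: a layer has at least one operation, all its codes decode, and every slice of
`C` contains a gate. Disjointness is inherited from the logical wires because `enc` is injective on
the wires in use. -/
theorem Layer.OK.wellFormed (h : ℓ.OK m (Bdd P R W)) (hw : w = P * R * W) {C : Circuit m}
    (hC : C.WellFormed) : ∀ s ∈ layerCode R W ℓ,
      Circuit.WellFormed ((mkStep m w s).instantiate C) := by
  intro s hs
  have hsome := h.isSome_of_mem_layerCode hw s hs
  unfold layerCode at hs
  split_ifs at hs with h0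
  · rw [List.mem_singleton.1 hs] at hsome ⊢
    simp only [mkStep, if_true, Step.instantiate] at hsome ⊢
    intro L hL
    obtain ⟨K, hK, rfl⟩ := List.mem_map.1 hL
    obtain ⟨hK1, hK2⟩ := hC K hK
    constructor
    · obtain ⟨ws, hws⟩ := List.exists_mem_of_ne_nil _ h.ne_nil
      obtain ⟨e, he⟩ := Option.isSome_iff_exists.1 (hsome _ (List.mem_map_of_mem hws))
      obtain ⟨g, hg⟩ := List.exists_mem_of_ne_nil _ hK1
      refine List.ne_nil_of_mem (a := g.map e) (List.mem_flatMap.2 ⟨e, ?_, List.mem_map_of_mem hg⟩)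
      exact List.mem_filterMap.2 ⟨_, List.mem_map_of_mem hws, he⟩
    · rw [List.pairwise_flatMap]
      refine ⟨fun e _ => ?_, ?_⟩
      · rw [List.pairwise_map]
        refine hK2.imp fun {g g'} hd => ?_
        rw [Gate.support_map, Gate.support_map]
        exact (Finset.disjoint_map e).2 hd
      · rw [List.pairwise_filterMap, List.pairwise_map]
        refine h.disjoint.imp fun hd e he e' he' x hx y hy => ?_
        obtain ⟨g, -, rfl⟩ := List.mem_map.1 hx
        obtain ⟨g', -, rfl⟩ := List.mem_map.1 hy
        exact disjoint_support_mkEmb he he' hd g g'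
  · obtain ⟨p, hp, rfl⟩ := List.mem_map.1 hs
    simp only [mkStep, Bool.false_eq_true, if_false, Step.instantiate] at hsome ⊢
    intro L hL
    rw [List.mem_singleton.1 hL]
    constructor
    · obtain ⟨ws, hws⟩ := List.exists_mem_of_ne_nil _ h.ne_nil
      obtain ⟨g, hg⟩ := Option.isSome_iff_exists.1 (hsome _ (List.mem_map_of_mem hws))
      refine List.ne_nil_of_mem (a := g.toGate) (List.mem_map_of_mem ?_)
      exact List.mem_filterMap.2 ⟨_, List.mem_map_of_mem hws, hg⟩
    · rw [List.pairwise_map, List.pairwise_filterMap, List.pairwise_map]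
      refine List.Pairwise.imp_of_mem ?_ h.disjoint
      intro ws ws' hws hws' hd g hg g' hg'
      refine disjoint_support_mkBasic hg hg' ?_
      intro x hx hx'
      exact hd (mem_map_enc_of_patOK (h.patOK_lt h0 hws hp) hx)
        (mem_map_enc_of_patOK (h.patOK_lt h0 hws' hp) hx')

end WellFormed

/-! ### The oracle -/

section Spec

variable {n : ℕ} {f : Bits n → Bits n}

/-- A loop whose targets are distinct and not read. -/
theorem exec_loop_of_disjoint {κ : ℕ} (hκ : κ ≠ 0) {w cnt : ℕ} {T : ℕ → ℕ → Addr}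
    {C : ℕ → ℕ → List Addr}
    (hT : ∀ b < w, ∀ b' < w, ∀ u < cnt, ∀ u' < cnt, T b u = T b' u' → b = b' ∧ u = u')
    (hC : ∀ b < w, ∀ b' < w, ∀ u < cnt, ∀ u' < cnt, T b u ∉ C b' u') (σ : Mem) :
    (∀ b < w, ∀ u < cnt, exec f (loop κ w cnt fun b u => T b u :: C b u) σ (T b u) =
      xor (σ (T b u)) (Kind.poly κ ((C b u).map σ))) ∧
    ∀ v, (∀ b < w, ∀ u < cnt, v ≠ T b u) →
      exec f (loop κ w cnt fun b u => T b u :: C b u) σ v = σ v := by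
  obtain ⟨h1, h2⟩ := exec_loop (f := f) hκ hT
    (fun b hb b' hb' u hu u' hu' => hC b hb b' (by omega) u hu u' hu') σ
  refine ⟨fun b hb u hu => ?_, h2⟩
  rw [h1 b hb u hu]
  congr 2
  refine List.map_congr_left fun v hv => h2 v fun b' hb' u' hu' e => ?_
  exact hC b' hb' b hb u' hu' u hu (e ▸ hv)

/-- Repeated doubling: round `t` copies the rows below 2^t to the next 2^t rows. This keeps the
number of layers polylogarithmic although there are 2^(l+1) rows. The induction also records that
the remaining rows are zero, so that adding a bit amounts to copying it. -/
theorem exec_fanProg {l k : ℕ} (hk : 1 + k ≠ workBase n) {σ : Mem}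
    (hσ : ∀ v : Addr, v.1 = workBase n → σ v = false) :
    (∀ v : Addr, v.1 ≠ workBase n → exec f (fanProg n l k) σ v = σ v) ∧
    ∀ i < 2 ^ (l + 1), ∀ b < qbits n l,
      exec f (fanProg n l k) σ (workBase n, i, b) = σ (1 + k, 0, b) := by
  set ω := workBase n
  have key : ∀ t τ, τ =
      exec f (loop Kind.copy (qbits n l) 1 (fun b _ => [(ω, 0, b), (1 + k, 0, b)]) ++
      (List.range t).flatMap fun j => loop Kind.copy (qbits n l) (2 ^ j)
        (fun b u => [(ω, 2 ^ j + u, b), (ω, u, b)])) σ →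
      (∀ v : Addr, v.1 ≠ ω → τ v = σ v) ∧
      (∀ i < 2 ^ t, ∀ b < qbits n l, τ (ω, i, b) = σ (1 + k, 0, b)) ∧
      ∀ i, 2 ^ t ≤ i → ∀ b, τ (ω, i, b) = false := by
    intro t
    induction t with
    | zero =>
      rintro τ rfl
      obtain ⟨h1, h2⟩ := exec_loop_of_disjoint (f := f) (κ := Kind.copy) (by decide)
        (w := qbits n l) (cnt := 1) (T := fun b _ => (ω, 0, b)) (C := fun b _ => [(1 + k, 0, b)])
        (fun b _ b' _ u _ u' _ e => by simp only [Prod.mk.injEq] at e; omega)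
        (fun b _ b' _ u _ u' _ => by simp; omega) σ
      rw [List.range_zero, List.flatMap_nil, List.append_nil]
      refine ⟨fun v hv => h2 v fun b _ u _ e => hv (by rw [e]), fun i hi b hb => ?_,
        fun i hi b => ?_⟩
      · obtain rfl : i = 0 := by omega
        rw [h1 b hb 0 one_pos, hσ (ω, 0, b) rfl]
        simp
      · rw [h2 _ fun b _ u _ e => by simp only [Prod.mk.injEq] at e; omega, hσ (ω, i, b) rfl]
    | succ t ih =>
      rintro τ rfl
      obtain ⟨i1, i2, i3⟩ := ih _ rfl
      rw [List.range_succ, List.flatMap_append, ← List.append_assoc, exec_append]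
      set τ' := exec f (loop Kind.copy (qbits n l) 1 (fun b _ => [(ω, 0, b), (1 + k, 0, b)]) ++
      (List.range t).flatMap fun j => loop Kind.copy (qbits n l) (2 ^ j)
        (fun b u => [(ω, 2 ^ j + u, b), (ω, u, b)])) σ
      rw [List.flatMap_cons, List.flatMap_nil, List.append_nil]
      obtain ⟨h1, h2⟩ := exec_loop_of_disjoint (f := f) (κ := Kind.copy) (by decide)
        (w := qbits n l) (cnt := 2 ^ t) (T := fun b u => (ω, 2 ^ t + u, b))
        (C := fun b u => [(ω, u, b)])
        (fun b _ b' _ u _ u' _ e => by simp only [Prod.mk.injEq] at e; omega)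
        (fun b _ b' _ u _ u' _ => by
          simp only [List.mem_singleton, Prod.mk.injEq]
          omega) τ'
      refine ⟨fun v hv => (h2 v fun b _ u _ e => hv (by rw [e])).trans (i1 v hv),
        fun i hi b hb => ?_, fun i hi b => ?_⟩
      · by_cases hit : i < 2 ^ t
        · rw [h2 _ fun b _ u _ e => by simp only [Prod.mk.injEq] at e; omega, i2 i hit b hb]
        · rw [pow_succ] at hi
          have := h1 b hb (i - 2 ^ t) (by omega)
          rw [show 2 ^ t + (i - 2 ^ t) = i by omega] at this
          rw [this, i3 i (by omega)]
          simp [i2 (i - 2 ^ t) (by omega) b hb]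
      · rw [pow_succ] at hi
        rw [h2 _ fun b _ u _ e => by simp only [Prod.mk.injEq] at e; omega, i3 i (by omega)]
  obtain ⟨h1, h2, -⟩ := key (l + 1) _ rfl
  exact ⟨h1, h2⟩

/-- The argument in the `i`-th row, for a search register `x`. -/
def rowArg (n l : ℕ) (x : ℕ → Bool) (i : ℕ) : Bits n := fun b =>
  if b.val < l then decide (i / 2 ^ b.val % 2 = 1) else x (i / 2 ^ l * (n - l) + (b - l))

theorem hi_false_div {d : ℕ} (hd : 0 < d) (u : ℕ) : hi (false, d) u / d % 2 = 1 := by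
  have h1 : u % d < d := Nat.mod_lt u hd
  have h2 : hi (false, d) u = d * (2 * (u / d) + 1) + u % d := by simp [hi]; ring
  rw [h2, Nat.mul_add_div hd, Nat.div_eq_of_lt h1]
  omega

theorem lo_div {d : ℕ} (hd : 0 < d) (u : ℕ) : lo d u / d % 2 = 0 := by
  have h1 : u % d < d := Nat.mod_lt u hd
  have h2 : lo d u = d * (2 * (u / d)) + u % d := by simp [lo]; ring
  rw [h2, Nat.mul_add_div hd, Nat.div_eq_of_lt h1]
  omega

theorem idxOf_row {m r i c : ℕ} (hc : c < m) :
    ((List.range m).map fun j => ((r, i, j) : Addr)).idxOf (r, i, c) = c := by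
  have hn : ((List.range m).map fun j => ((r, i, j) : Addr)).Nodup := by
    rw [List.nodup_map_iff_inj_on List.nodup_range]; simp
  have := hn.idxOf_getElem c (by simpa using hc)
  simpa using this

/-- The low `l` bits of the argument in a row are the bits of the row number, independent of the
register: bit `b` is set exactly in the rows that are upper ends of comparators at distance 2^b. The
remaining bits are the block index taken from the copy of the register in this row. -/
theorem exec_loadProg {l a : ℕ} (hl : l ≤ n) {σ : Mem} {x : ℕ → Bool}
    (hσ : ∀ v : Addr, v.1 = workBase n + 1 → σ v = false)
    (hx : ∀ i < 2 ^ (l + 1), ∀ b < qbits n l, σ (workBase n, i, b) = x b) :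
    (∀ v : Addr, v.1 ≠ workBase n + 1 → exec f (loadProg n l a) σ v = σ v) ∧
    (∀ i < 2 ^ (l + 1), ∀ b : Fin n,
      exec f (loadProg n l a) σ (workBase n + 1, i, b) = rowArg n l x i b ∧
      exec f (loadProg n l a) σ (workBase n + 1, i, n + b) = f (rowArg n l x i) b) ∧
    CallsClean f (loadProg n l a) σ := by
  rw [loadProg, exec_append, exec_append, callsClean_append, callsClean_append, exec_append]
  set ω := workBase n
  obtain ⟨a1, a2⟩ := exec_loop_of_disjoint (f := f) (κ := Kind.one) (by decide)
    (w := l) (cnt := 2 ^ l) (T := fun b u => (ω + 1, hi (false, 2 ^ b) u, b)) (C := fun _ _ => [])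
    (fun b _ b' _ u _ u' _ e => by
      simp only [Prod.mk.injEq] at e
      obtain ⟨-, e, rfl⟩ := e
      exact ⟨rfl, hi_inj (st := (false, 2 ^ b)) (by positivity) e⟩)
    (fun b _ b' _ u _ u' _ => by simp) σ
  set σ₁ := exec f (loop Kind.one l (2 ^ l) fun b u => [(ω + 1, hi (false, 2 ^ b) u, b)]) σ
  obtain ⟨b1, b2⟩ := exec_loop_of_disjoint (f := f) (κ := Kind.copy) (by decide)
    (w := n - l) (cnt := 2 ^ (l + 1)) (T := fun b u => (ω + 1, u, l + b))
    (C := fun b u => [(ω, u, u / 2 ^ l * (n - l) + b)])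
    (fun b _ b' _ u _ u' _ e => by simp only [Prod.mk.injEq] at e; omega)
    (fun b _ b' _ u _ u' _ => by
      simp only [List.mem_singleton, Prod.mk.injEq]
      omega) σ₁
  set σ₂ := exec f (loop Kind.copy (n - l) (2 ^ (l + 1)) fun b u =>
    [(ω + 1, u, l + b), (ω, u, u / 2 ^ l * (n - l) + b)]) σ₁
  have f1 : ∀ v : Addr, v.1 ≠ ω + 1 → σ₁ v = σ v := fun v hv => a2 v fun b _ u _ e => hv (by rw [e])
  have f2 : ∀ v : Addr, v.1 ≠ ω + 1 → σ₂ v = σ v := fun v hv =>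
    (b2 v fun b _ u _ e => hv (by rw [e])).trans (f1 v hv)
  have hok := valid_call (n := n) (l := l) (a := a) (k := 0)
  have g1 : ∀ i < 2 ^ (l + 1), ∀ b : Fin n, σ₂ (ω + 1, i, b) = rowArg n l x i b := by
    intro i hi' b
    unfold rowArg
    split_ifs with hb
    · rw [b2 _ fun b _ u _ e => by simp only [Prod.mk.injEq] at e; omega]
      -- A row is a lower or an upper end at distance 2^b according to its bit b.
      obtain ⟨u, hu, e | e⟩ := exists_lo_or_hi (d := 2 ^ b.val) (h := 2 ^ l) (i := i)
        (pow_dvd_pow 2 hb.le) false (by rwa [← pow_succ'])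
      · rw [a2, hσ (ω + 1, i, b) rfl, e, lo_div (by positivity)]
        · simp
        · intro b' _ u' _ e'
          simp only [Prod.mk.injEq] at e'
          obtain ⟨-, e', rfl⟩ := e'
          exact lo_ne_hi (st := (false, 2 ^ b.val)) (by positivity) u u' (e ▸ e')
      · rw [e, a1 b hb u hu, hσ _ rfl, hi_false_div (by positivity)]
        simp
    · have h1 := b1 (b - l) (by omega) i hi'
      rw [show l + (b.val - l) = b.val by omega] at h1
      have h2 := div_pow_mul_le hi' (n - l)
      rw [h1, a2 _ fun b _ u _ e => by simp only [Prod.mk.injEq] at e; omega, hσ (ω + 1, i, b) rfl]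
      simp only [List.map_cons, List.map_nil, Kind.poly_copy, Bool.false_xor]
      rw [f1 (ω, _, _) (by simp), hx i hi' _ (by unfold qbits; omega)]
  -- This serves twice: the second register is zero, so that the call writes f itself, and the
  -- ancillas are clean.
  have g2 : ∀ i c, n ≤ c → σ₂ (ω + 1, i, c) = false := by
    intro i c hc
    rw [b2 _ fun b _ u _ e => by simp only [Prod.mk.injEq] at e; omega,
      a2 _ fun b _ u _ e => by simp only [Prod.mk.injEq] at e; omega, hσ _ rfl]
  have g3 : ∀ i < 2 ^ (l + 1), ∀ c < n + n + a,
      execLayer f (lay Kind.call (2 ^ (l + 1)) fun u =>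
        (List.range (n + n + a)).map fun j => (ω + 1, u, j)) σ₂ (ω + 1, i, c) =
      callAct f ((List.range (n + n + a)).map fun j => (ω + 1, i, j)) σ₂ (ω + 1, i, c) := by
    intro i hi' c hc
    have := hok.exec_of_mem (f := f) (v := (ω + 1, i, c))
      (ws := (List.range (n + n + a)).map fun j => (ω + 1, i, j))
      (List.mem_map.2 ⟨i, List.mem_range.2 hi', rfl⟩)
      (List.mem_map.2 ⟨c, List.mem_range.2 hc, rfl⟩) σ₂
    rw [this]
    rfl
  have g4 : ∀ i < 2 ^ (l + 1),
      (fun j : Fin n => (((List.range (n + n + a)).map fun j => ((ω + 1, i, j) : Addr)).map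
        σ₂).getD j false) = rowArg n l x i := by
    intro i hi'
    funext j
    rw [List.getD_eq_getElem _ _ (by simp; omega)]
    simp [g1 i hi' j]
  refine ⟨fun v hv => ?_, fun i hi' b => ⟨?_, ?_⟩, ⟨?_, ?_⟩, fun _ ws hws v hv => ?_, trivial⟩
  · rw [exec_cons, exec_nil, hok.exec_of_notMem, f2 v hv]
    simp only [lay, List.mem_flatten, List.mem_map, not_exists, not_and]
    rintro ws ⟨u, -, rfl⟩ h
    obtain ⟨j, -, rfl⟩ := List.mem_map.1 h
    exact hv rfl
  · rw [exec_cons, exec_nil, g3 i hi' b (by omega), callAct, dif_neg, g1 i hi']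
    rw [idxOf_row (by omega)]
    omega
  · rw [exec_cons, exec_nil, g3 i hi' (n + b) (by omega), callAct, dif_pos, g4 i hi',
      g2 i (n + b) (by omega)]
    · simp only [Bool.false_xor]
      congr 1
      refine Fin.ext ?_
      simp only
      rw [idxOf_row (by omega)]
      omega
    · rw [idxOf_row (by omega)]
      omega
  · refine callsClean_of_forall_ne (fun ℓ hℓ => ?_) _
    obtain ⟨b, -, rfl⟩ := List.mem_map.1 hℓ
    simp [lay]
  · refine callsClean_of_forall_ne (fun ℓ hℓ => ?_) _
    obtain ⟨b, -, rfl⟩ := List.mem_map.1 hℓ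
    simp [lay]
  · obtain ⟨u, -, rfl⟩ := List.mem_map.1 hws
    rw [← List.map_drop] at hv
    obtain ⟨j, hj, rfl⟩ := List.mem_map.1 hv
    obtain ⟨c, hc, rfl⟩ := List.mem_iff_getElem.1 hj
    refine g2 u _ ?_
    simp
    omega

-- Column 2n + j of the comparison region accumulates the two dummy bits and the agreement of the
-- top j bits with the next record. The value of f occupies the top n bits, so column 3n says that
-- the values agree and column 4n that the whole records agree. The second implies the first; hence
-- the exclusive or of the negated first bit with the second vanishes exactly for equal values and
-- different arguments.
set_option maxHeartbeats 400000 in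
theorem exec_adjProg {l : ℕ} {σ : Mem}
    (hσ : ∀ v : Addr, sortedReg n l < v.1 → σ v = false) :
    (∀ v : Addr, v.1 ≤ sortedReg n l ∨ sortedReg n l + 2 < v.1 → exec f (adjProg n l) σ v = σ v) ∧
    ∀ u < 2 ^ (l + 1),
      (∀ b < n, exec f (adjProg n l) σ (sortedReg n l + 2, u, b) = σ (sortedReg n l, u, b)) ∧
      (u + 1 < 2 ^ (l + 1) → ∀ b < n, exec f (adjProg n l) σ (sortedReg n l + 2, u, n + b) =
        σ (sortedReg n l, u + 1, b)) ∧
      (exec f (adjProg n l) σ (sortedReg n l + 2, u, 2 * n) = false ↔ u + 1 < 2 ^ (l + 1) ∧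
        (σ (workBase n, u, 2 * (n - l)) = true ∧ σ (workBase n, u, 2 * (n - l) + 1) = true) ∧
        (∀ b < n, σ (sortedReg n l, u, n + b) = σ (sortedReg n l, u + 1, n + b)) ∧
        ∃ b < n, σ (sortedReg n l, u, b) ≠ σ (sortedReg n l, u + 1, b)) := by
  rw [adjProg]
  simp only [exec_append]
  have hωs : workBase n < sortedReg n l := by unfold sortedReg; omega
  set ω := workBase n
  set s := sortedReg n l
  set R := 2 ^ (l + 1)
  obtain ⟨a1, a2⟩ := exec_loop_of_disjoint (f := f) (κ := Kind.copy) (by decide)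
    (w := 2 * n) (cnt := R - 1) (T := fun b u => (s + 1, u, b)) (C := fun b u => [(s, u + 1, b)])
    (fun b _ b' _ u _ u' _ e => by simp only [Prod.mk.injEq] at e; omega)
    (fun b _ b' _ u _ u' _ => by simp only [List.mem_singleton, Prod.mk.injEq]; omega) σ
  set σ₁ := exec f (loop Kind.copy (2 * n) (R - 1) fun b u => [(s + 1, u, b), (s, u + 1, b)]) σ
  obtain ⟨b1, b2⟩ := exec_loop_of_disjoint (f := f) (κ := Kind.and) (by decide)
    (w := 1) (cnt := R - 1) (T := fun _ u => (s + 1, u, 2 * n))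
    (C := fun _ u => [(ω, u, 2 * (n - l)), (ω, u, 2 * (n - l) + 1)])
    (fun b _ b' _ u _ u' _ e => by simp only [Prod.mk.injEq] at e; omega)
    (fun b _ b' _ u _ u' _ => by
      simp only [List.mem_cons, List.not_mem_nil, or_false, Prod.mk.injEq]; omega) σ₁
  set σ₂ := exec f (loop Kind.and 1 (R - 1) fun _ u =>
    [(s + 1, u, 2 * n), (ω, u, 2 * (n - l)), (ω, u, 2 * (n - l) + 1)]) σ₁
  obtain ⟨c1, c2⟩ := exec_loop (f := f) (κ := Kind.eq) (by decide)
    (w := 2 * n) (cnt := R - 1) (T := fun j u => (s + 1, u, 2 * n + j + 1))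
    (C := fun j u => [(s, u, 2 * n - 1 - j), (s + 1, u, 2 * n - 1 - j), (s + 1, u, 2 * n + j)])
    (fun b _ b' _ u _ u' _ e => by simp only [Prod.mk.injEq] at e; omega)
    (fun b _ b' _ u _ u' _ => by
      simp only [List.mem_cons, List.not_mem_nil, or_false, Prod.mk.injEq]; omega) σ₂
  set σ₃ := exec f (loop Kind.eq (2 * n) (R - 1) fun j u =>
    [(s + 1, u, 2 * n + j + 1), (s, u, 2 * n - 1 - j), (s + 1, u, 2 * n - 1 - j),
      (s + 1, u, 2 * n + j)]) σ₂
  obtain ⟨d1, d2⟩ := exec_loop_of_disjoint (f := f) (κ := Kind.copy) (by decide)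
    (w := n) (cnt := R) (T := fun b u => (s + 2, u, b)) (C := fun b u => [(s, u, b)])
    (fun b _ b' _ u _ u' _ e => by simp only [Prod.mk.injEq] at e; omega)
    (fun b _ b' _ u _ u' _ => by simp only [List.mem_singleton, Prod.mk.injEq]; omega) σ₃
  set σ₄ := exec f (loop Kind.copy n R fun b u => [(s + 2, u, b), (s, u, b)]) σ₃
  obtain ⟨e1, e2⟩ := exec_loop_of_disjoint (f := f) (κ := Kind.copy) (by decide)
    (w := n) (cnt := R) (T := fun b u => (s + 2, u, n + b)) (C := fun b u => [(s + 1, u, b)])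
    (fun b _ b' _ u _ u' _ e => by simp only [Prod.mk.injEq] at e; omega)
    (fun b _ b' _ u _ u' _ => by simp only [List.mem_singleton, Prod.mk.injEq]; omega) σ₄
  set σ₅ := exec f (loop Kind.copy n R fun b u => [(s + 2, u, n + b), (s + 1, u, b)]) σ₄
  obtain ⟨g1, g2⟩ := exec_loop_of_disjoint (f := f) (κ := Kind.notCopy) (by decide)
    (w := 1) (cnt := R) (T := fun _ u => (s + 2, u, 2 * n)) (C := fun _ u => [(s + 1, u, 3 * n)])
    (fun b _ b' _ u _ u' _ e => by simp only [Prod.mk.injEq] at e; omega)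
    (fun b _ b' _ u _ u' _ => by simp only [List.mem_singleton, Prod.mk.injEq]; omega) σ₅
  set σ₆ := exec f (loop Kind.notCopy 1 R fun _ u => [(s + 2, u, 2 * n), (s + 1, u, 3 * n)]) σ₅
  obtain ⟨h1, h2⟩ := exec_loop_of_disjoint (f := f) (κ := Kind.copy) (by decide)
    (w := 1) (cnt := R) (T := fun _ u => (s + 2, u, 2 * n)) (C := fun _ u => [(s + 1, u, 4 * n)])
    (fun b _ b' _ u _ u' _ e => by simp only [Prod.mk.injEq] at e; omega)
    (fun b _ b' _ u _ u' _ => by simp only [List.mem_singleton, Prod.mk.injEq]; omega) σ₆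
  set σ₇ := exec f (loop Kind.copy 1 R fun _ u => [(s + 2, u, 2 * n), (s + 1, u, 4 * n)]) σ₆
  have k1 : ∀ v : Addr, v.1 ≠ s + 1 → σ₁ v = σ v := fun v hv => a2 v fun b _ u _ e => hv (by rw [e])
  have k2 : ∀ v : Addr, v.1 ≠ s + 1 → σ₂ v = σ v := fun v hv =>
    (b2 v fun b _ u _ e => hv (by rw [e])).trans (k1 v hv)
  have k3 : ∀ v : Addr, v.1 ≠ s + 1 → σ₃ v = σ v := fun v hv =>
    (c2 v fun b _ u _ e => hv (by rw [e])).trans (k2 v hv)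
  have k4 : ∀ v : Addr, v.1 ≠ s + 2 → σ₄ v = σ₃ v := fun v hv =>
    d2 v fun b _ u _ e => hv (by rw [e])
  have k5 : ∀ v : Addr, v.1 ≠ s + 2 → σ₅ v = σ₃ v := fun v hv =>
    (e2 v fun b _ u _ e => hv (by rw [e])).trans (k4 v hv)
  have k6 : ∀ v : Addr, v.1 ≠ s + 2 → σ₆ v = σ₃ v := fun v hv =>
    (g2 v fun b _ u _ e => hv (by rw [e])).trans (k5 v hv)
  have k7 : ∀ v : Addr, v.1 ≠ s + 2 → σ₇ v = σ₃ v := fun v hv =>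
    (h2 v fun b _ u _ e => hv (by rw [e])).trans (k6 v hv)
  -- the record of the next row
  have m1 : ∀ b < 2 * n, ∀ u, u + 1 < R → σ₃ (s + 1, u, b) = σ (s, u + 1, b) := by
    intro b hb u hu
    rw [c2 _ fun b _ u _ e => by simp only [Prod.mk.injEq] at e; omega,
      b2 _ fun b _ u _ e => by simp only [Prod.mk.injEq] at e; omega,
      a1 b hb u (by omega), hσ (s + 1, u, b) (by simp)]
    simp
  -- the chain of comparisons
  have m2 : ∀ j ≤ 2 * n, ∀ u, u + 1 < R → (σ₃ (s + 1, u, 2 * n + j) = true ↔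
      (σ (ω, u, 2 * (n - l)) = true ∧ σ (ω, u, 2 * (n - l) + 1) = true) ∧
      ∀ b < 2 * n, 2 * n ≤ b + j → σ (s, u, b) = σ (s, u + 1, b)) := by
    intro j
    induction j with
    | zero =>
      intro _ u hu
      have hb := b1 0 one_pos u (by omega)
      rw [a2 _ fun b _ u _ e => by simp only [Prod.mk.injEq] at e; omega,
        hσ (s + 1, u, 2 * n) (by simp)] at hb
      simp only [List.map_cons, List.map_nil, Kind.poly_and, Bool.false_xor] at hb
      rw [k1 (ω, u, 2 * (n - l)) (by simp only; omega),
        k1 (ω, u, 2 * (n - l) + 1) (by simp only; omega)] at hb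
      rw [add_zero, c2 _ fun b _ u _ e => by simp only [Prod.mk.injEq] at e; omega, hb,
        Bool.and_eq_true]
      exact ⟨fun h => ⟨h, fun b hb hb' => by omega⟩, fun h => h.1⟩
    | succ j ih =>
      intro hj u hu
      have hc := c1 j (by omega) u (by omega)
      rw [b2 (s + 1, u, 2 * n + j + 1) fun b _ u _ e => by simp only [Prod.mk.injEq] at e; omega,
        a2 (s + 1, u, 2 * n + j + 1) fun b _ u _ e => by simp only [Prod.mk.injEq] at e; omega,
        hσ (s + 1, u, 2 * n + j + 1) (by simp)] at hc
      simp only [List.map_cons, List.map_nil, Kind.poly_eq, Bool.false_xor] at hc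
      rw [k3 (s, u, 2 * n - 1 - j) (by simp), m1 (2 * n - 1 - j) (by omega) u hu] at hc
      rw [← add_assoc, hc, Bool.and_eq_true, ih (by omega) u hu, beq_iff_eq]
      constructor
      · rintro ⟨⟨h1, h2⟩, h3⟩
        refine ⟨h1, fun b hb hb' => ?_⟩
        by_cases hbj : 2 * n ≤ b + j
        · exact h2 b hb hbj
        · rwa [show 2 * n - 1 - j = b by omega] at h3
      · rintro ⟨h1, h2⟩
        exact ⟨⟨h1, fun b hb hb' => h2 b hb (by omega)⟩, h2 _ (by omega) (by omega)⟩
  have m3 : ∀ b u, R ≤ u + 1 → σ₃ (s + 1, u, b) = false := by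
    intro b u hu
    rw [c2 _ fun b _ u _ e => by simp only [Prod.mk.injEq] at e; omega,
      b2 _ fun b _ u _ e => by simp only [Prod.mk.injEq] at e; omega,
      a2 _ fun b _ u _ e => by simp only [Prod.mk.injEq] at e; omega, hσ (s + 1, u, b) (by simp)]
  refine ⟨fun v hv => ?_, fun u hu => ⟨fun b hb => ?_, fun hu' b hb => ?_, ?_⟩⟩
  · rw [k7 v (by omega), k3 v (by omega)]
  · rw [h2 _ fun b _ u _ e => by simp only [Prod.mk.injEq] at e; omega,
      g2 _ fun b _ u _ e => by simp only [Prod.mk.injEq] at e; omega,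
      e2 _ fun b _ u _ e => by simp only [Prod.mk.injEq] at e; omega,
      d1 b hb u hu, k3 (s + 2, u, b) (by simp), hσ (s + 2, u, b) (by simp)]
    simp only [List.map_cons, List.map_nil, Kind.poly_copy, Bool.false_xor]
    exact k3 _ (by simp)
  · rw [h2 _ fun b _ u _ e => by simp only [Prod.mk.injEq] at e; omega,
      g2 _ fun b _ u _ e => by simp only [Prod.mk.injEq] at e; omega,
      e1 b hb u hu, d2 _ fun b _ u _ e => by simp only [Prod.mk.injEq] at e; omega,
      k3 (s + 2, u, n + b) (by simp), hσ (s + 2, u, n + b) (by simp)]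
    simp only [List.map_cons, List.map_nil, Kind.poly_copy, Bool.false_xor]
    rw [k4 (s + 1, u, b) (by simp), m1 b (by omega) u hu']
  · have hf : σ₇ (s + 2, u, 2 * n) = xor (!σ₃ (s + 1, u, 3 * n)) (σ₃ (s + 1, u, 4 * n)) := by
      rw [h1 0 one_pos u hu, g1 0 one_pos u hu,
        e2 _ fun b _ u _ e => by simp only [Prod.mk.injEq] at e; omega,
        d2 _ fun b _ u _ e => by simp only [Prod.mk.injEq] at e; omega,
        k3 (s + 2, u, 2 * n) (by simp), hσ (s + 2, u, 2 * n) (by simp)]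
      simp only [List.map_cons, List.map_nil, Kind.poly_copy, Kind.poly_notCopy, Bool.false_xor]
      rw [k5 (s + 1, u, 3 * n) (by simp), k6 (s + 1, u, 4 * n) (by simp)]
    rw [hf]
    by_cases hu' : u + 1 < R
    · have p1 := m2 n (by omega) u hu'
      have p2 := m2 (2 * n) le_rfl u hu'
      rw [show 2 * n + n = 3 * n by ring] at p1
      rw [show 2 * n + 2 * n = 4 * n by ring] at p2
      have q1 : (∀ b < 2 * n, 2 * n ≤ b + n → σ (s, u, b) = σ (s, u + 1, b)) ↔
          ∀ b < n, σ (s, u, n + b) = σ (s, u + 1, n + b) := by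
        refine ⟨fun h b hb => h _ (by omega) (by omega), fun h b hb hb' => ?_⟩
        have := h (b - n) (by omega)
        rwa [show n + (b - n) = b by omega] at this
      have q2 : (∀ b < 2 * n, 2 * n ≤ b + 2 * n → σ (s, u, b) = σ (s, u + 1, b)) ↔
          (∀ b < n, σ (s, u, n + b) = σ (s, u + 1, n + b)) ∧
            ∀ b < n, σ (s, u, b) = σ (s, u + 1, b) := by
        refine ⟨fun h => ⟨fun b hb => h _ (by omega) (by omega),
          fun b hb => h _ (by omega) (by omega)⟩, fun h b hb _ => ?_⟩
        by_cases hbn : b < n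
        · exact h.2 b hbn
        · have := h.1 (b - n) (by omega)
          rwa [show n + (b - n) = b by omega] at this
      rw [q1] at p1
      rw [q2] at p2
      have q3 : (∃ b < n, σ (s, u, b) ≠ σ (s, u + 1, b)) ↔
          ¬ ∀ b < n, σ (s, u, b) = σ (s, u + 1, b) := by push Not; rfl
      rw [q3]
      have q4 : ∀ x y : Bool, (xor (!x) y = false ↔ ((x = true ∧ y = false) ∨
          (x = false ∧ y = true))) := by decide
      rw [q4, ← Bool.not_eq_true, ← Bool.not_eq_true, p1, p2]
      constructor
      · rintro (⟨⟨hd, hk⟩, hi⟩ | ⟨hd, hd', hk, -⟩)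
        · exact ⟨hu', hd, hk, fun h => hi ⟨hd, hk, h⟩⟩
        · exact absurd ⟨hd', hk⟩ hd
      · rintro ⟨-, hd, hk, hi⟩
        exact Or.inl ⟨⟨hd, hk⟩, fun h => hi h.2.2⟩
    -- The last row has no successor. Its comparison columns were never written, so its flag is 1,
    -- meaning no collision.
    · rw [m3 _ u (by omega), m3 _ u (by omega)]
      simp [hu']

end Spec

/-- By monotonicity all entries between `j` and `j'` have the same key. If neighbours with equal
keys were always equal, the entries would be constant from `j` to `j'`. Looking for unequal
neighbours is necessary because records occur twice when the two blocks coincide. -/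
theorem exists_adjacent {S : ℕ → ℕ} {R m j j' : ℕ} (hS : ∀ i i', i < i' → i' < R → S i ≤ S i')
    (hj : j < j') (hj' : j' < R) (hne : S j ≠ S j') (hm : S j / m = S j' / m) :
    ∃ u, u + 1 < R ∧ S u ≠ S (u + 1) ∧ S u / m = S (u + 1) / m := by
  by_contra! hcon
  have hc : ∀ u, j ≤ u → u ≤ j' → S u = S j := by
    intro u hu
    induction u, hu using Nat.le_induction with
    | base => intro _; rfl
    | succ u hu ih =>
      intro hu'
      have h1 := ih (by omega)
      by_contra hne'
      refine hcon u (by omega) (fun h => hne' (by rw [← h, h1])) (le_antisymm ?_ ?_)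
      · exact Nat.div_le_div_right (hS _ _ (by omega) (by omega))
      · rw [h1, hm]
        refine Nat.div_le_div_right ?_
        rcases hu'.lt_or_eq with h | h
        · exact hS _ _ h hj'
        · rw [h]
  exact hne (hc j' hj.le le_rfl).symm

theorem recVal_div (n : ℕ) (g : ℕ → Bool) :
    recVal (2 * n) g / 2 ^ n = recVal n fun b => g (n + b) := by
  rw [two_mul, recVal_add, Nat.add_mul_div_left _ _ (by positivity),
    Nat.div_eq_of_lt (recVal_lt n g), zero_add]

section Spec

variable {n : ℕ} {f : Bits n → Bits n}

/-- The search register describes a pair of blocks with a collision. -/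
def Marked (f : Bits n → Bits n) (l : ℕ) (x : ℕ → Bool) : Prop :=
  (x (2 * (n - l)) = true ∧ x (2 * (n - l) + 1) = true) ∧
    ∃ i < 2 ^ (l + 1), ∃ i' < 2 ^ (l + 1), rowArg n l x i ≠ rowArg n l x i' ∧
      f (rowArg n l x i) = f (rowArg n l x i')

/-- Sorting preserves the set of records, so a collision among the rows survives as two different
sorted records with equal keys, and `exists_adjacent` turns it into a collision of neighbours. The
second sort has the flag as its top bit: row 0 then has flag 0 if and only if some row does, and it
carries the pair along. -/
theorem exec_oracle {l a k : ℕ} (hl : l ≤ n) (hk : k < n - l + 2) {σ : Mem}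
    (hσ : ∀ v : Addr, workBase n ≤ v.1 → σ v = false) :
    (∀ v : Addr, v.1 < workBase n → exec f (oracle n l a k) σ v = σ v) ∧
    CallsClean f (oracle n l a k) σ ∧
    (exec f (oracle n l a k) σ (pairReg n l, 0, 2 * n) = false ↔
      Marked f l fun b => σ (1 + k, 0, b)) ∧
    (exec f (oracle n l a k) σ (pairReg n l, 0, 2 * n) = false →
      ∃ i i' : Bits n, i ≠ i' ∧ f i = f i' ∧ ∀ b : Fin n,
        exec f (oracle n l a k) σ (pairReg n l, 0, b) = i b ∧
        exec f (oracle n l a k) σ (pairReg n l, 0, n + b) = i' b) := by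
  have hd : ∀ st ∈ stages (l + 1), 0 < st.2 := fun st hst =>
    Nat.pos_of_dvd_of_pos (dvd_of_mem_stages hst) (by positivity)
  have hs : sortedReg n l = workBase n + 1 + (stages (l + 1)).length := rfl
  have hp : pairReg n l = sortedReg n l + 2 + (stages (l + 1)).length := rfl
  have hR : 2 ^ (l + 1) = 2 * 2 ^ l := pow_succ' 2 l
  rw [oracle, exec_append, exec_append, exec_append, exec_append, callsClean_append,
    callsClean_append, callsClean_append, callsClean_append, exec_append, exec_append, exec_append]
  set ω := workBase n with hω
  set s := sortedReg n l
  set p := pairReg n l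
  set x : ℕ → Bool := fun b => σ (1 + k, 0, b) with hx
  obtain ⟨a1, a2⟩ := exec_fanProg (f := f) (l := l) (k := k) (by unfold workBase; omega)
    (fun v hv => hσ v hv.ge)
  set σ₁ := exec f (fanProg n l k) σ
  obtain ⟨b1, b2, b3⟩ := exec_loadProg (f := f) (a := a) hl (σ := σ₁) (x := x)
    (fun v hv => by rw [a1 v (by omega), hσ v (by omega)]) a2
  set σ₂ := exec f (loadProg n l a) σ₁
  have z2 : ∀ v : Addr, ω + 1 < v.1 → σ₂ v = false := fun v hv => by
    rw [b1 v (by omega), a1 v (by omega), hσ v (by omega)]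
  obtain ⟨c1, c2⟩ := exec_sortProg (f := f) (w := 2 * n) (h := 2 ^ l) hd z2
  set σ₃ := exec f (sortProg (ω + 1) (2 * n) (2 ^ l) (stages (l + 1))) σ₂
  have z3 : ∀ v : Addr, s < v.1 → σ₃ v = false := fun v hv => by
    rw [c1 v (by omega), z2 v (by omega)]
  obtain ⟨d1, d2⟩ := exec_adjProg (f := f) z3
  set σ₄ := exec f (adjProg n l) σ₃
  obtain ⟨e1, e2⟩ := exec_sortProg (f := f) (w := 2 * n + 1) (h := 2 ^ l) (ρ := s + 2) hd
    (σ := σ₄) (fun v hv => by rw [d1 v (by omega), z3 v (by omega)])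
  set σ₅ := exec f (sortProg (s + 2) (2 * n + 1) (2 ^ l) (stages (l + 1))) σ₄
  rw [← hs] at c2
  rw [← hp] at e2
  obtain ⟨im1, im2⟩ := c2.image fun st hst => dvd_of_mem_stages hst
  obtain ⟨im3, im4⟩ := e2.image fun st hst => dvd_of_mem_stages hst
  rw [← hR] at im1 im2 im3 im4
  have hdum : ∀ u < 2 ^ (l + 1), ∀ b < qbits n l, σ₃ (ω, u, b) = x b := fun u hu b hb => by
    rw [c1 _ (by simp only; omega), b1 (ω, u, b) (by simp only; omega), a2 u hu b hb]
  have hq : 2 * (n - l) + 1 < qbits n l := by unfold qbits; omega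
  -- the sorted records
  have hrec : ∀ j < 2 ^ (l + 1), ∃ i < 2 ^ (l + 1), ∀ b : Fin n,
      σ₃ (s, j, b) = rowArg n l x i b ∧ σ₃ (s, j, n + b) = f (rowArg n l x i) b := by
    intro j hj
    obtain ⟨i, hi', e⟩ := im1 j hj
    have h1 := recVal_inj e
    refine ⟨i, hi', fun b => ?_⟩
    obtain ⟨h2, h3⟩ := b2 i hi' b
    exact ⟨(h1 b (by omega)).trans h2, (h1 (n + b) (by omega)).trans h3⟩
  have hpair : σ₅ (p, 0, 2 * n) = false → (x (2 * (n - l)) = true ∧ x (2 * (n - l) + 1) = true) ∧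
      ∃ i < 2 ^ (l + 1), ∃ i' < 2 ^ (l + 1), rowArg n l x i ≠ rowArg n l x i' ∧
        f (rowArg n l x i) = f (rowArg n l x i') ∧
        ∀ b : Fin n, σ₅ (p, 0, b) = rowArg n l x i b ∧ σ₅ (p, 0, n + b) = rowArg n l x i' b := by
    intro hnf
    -- Row 0 after the second sort is some row `u` before it, with the same pair and flag.
    obtain ⟨u, hu, e⟩ := im3 0 (by positivity)
    have h1 := recVal_inj e
    obtain ⟨d3, d4, d5⟩ := d2 u hu
    obtain ⟨hu', hdu, hkey, b, hb, hne⟩ := d5.1 (by rw [← h1 (2 * n) (by omega), hnf])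
    rw [hdum u hu _ hq, hdum u hu _ (by omega)] at hdu
    obtain ⟨i, hi', h2⟩ := hrec u hu
    obtain ⟨i', hi'', h3⟩ := hrec (u + 1) hu'
    refine ⟨hdu, i, hi', i', hi'', fun h => hne ?_, funext fun b => ?_, fun b => ⟨?_, ?_⟩⟩
    · have h4 := (h2 ⟨b, hb⟩).1
      rw [h] at h4
      exact h4.trans (h3 ⟨b, hb⟩).1.symm
    · rw [← (h2 b).2, ← (h3 b).2, hkey b b.2]
    · rw [h1 b (by omega), d3 b b.2, (h2 b).1]
    · rw [h1 (n + b) (by omega), d4 hu' b b.2, (h3 b).1]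
  refine ⟨fun v hv => ?_, ⟨⟨⟨⟨?_, b3⟩, ?_⟩, ?_⟩, ?_⟩, ⟨fun hnf => ?_, ?_⟩, fun hnf => ?_⟩
  · rw [e1 v (by omega), d1 v (by omega), c1 v (by omega), b1 v (by omega), a1 v (by omega)]
  · refine callsClean_of_forall_ne (fun ℓ hℓ => ?_) _
    simp only [fanProg, loop, List.mem_append, List.mem_map, List.mem_flatMap] at hℓ
    obtain ⟨b, -, rfl⟩ | ⟨j, -, b, -, rfl⟩ := hℓ <;> simp [lay]
  · refine callsClean_of_forall_ne (fun ℓ hℓ => ?_) _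
    simp only [sortProg, stageProg, loop, List.mem_append, List.mem_map, List.mem_flatMap] at hℓ
    obtain ⟨t, -, (⟨b, -, rfl⟩ | ⟨b, -, rfl⟩) | ⟨b, -, rfl⟩⟩ := hℓ <;> simp [lay]
  · refine callsClean_of_forall_ne (fun ℓ hℓ => ?_) _
    simp only [adjProg, loop, List.mem_append, List.mem_map] at hℓ
    obtain (((((⟨b, -, rfl⟩ | ⟨b, -, rfl⟩) | ⟨b, -, rfl⟩) | ⟨b, -, rfl⟩) | ⟨b, -, rfl⟩) |
      ⟨b, -, rfl⟩) | ⟨b, -, rfl⟩ := hℓ <;> simp [lay]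
  · refine callsClean_of_forall_ne (fun ℓ hℓ => ?_) _
    simp only [sortProg, stageProg, loop, List.mem_append, List.mem_map, List.mem_flatMap] at hℓ
    obtain ⟨t, -, (⟨b, -, rfl⟩ | ⟨b, -, rfl⟩) | ⟨b, -, rfl⟩⟩ := hℓ <;> simp [lay]
  · obtain ⟨h1, i, hi', i', hi'', h2, h3, -⟩ := hpair hnf
    exact ⟨h1, i, hi', i', hi'', h2, h3⟩
  · rintro ⟨hdu, i, hi', i', hi'', hne, hf⟩
    -- two sorted records with equal keys
    have hA : ∀ i < 2 ^ (l + 1), ∃ j < 2 ^ (l + 1),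
        rowVal σ₂ (2 * n) (ω + 1) i = rowVal σ₃ (2 * n) s j := im2
    obtain ⟨j, hj, ej⟩ := hA i hi'
    obtain ⟨j', hj', ej'⟩ := hA i' hi''
    have hSne : rowVal σ₃ (2 * n) s j ≠ rowVal σ₃ (2 * n) s j' := by
      intro h
      rw [← ej, ← ej'] at h
      refine hne (funext fun b => ?_)
      rw [← (b2 i hi' b).1, ← (b2 i' hi'' b).1]
      exact recVal_inj h b (by omega)
    have hkey : rowVal σ₃ (2 * n) s j / 2 ^ n = rowVal σ₃ (2 * n) s j' / 2 ^ n := by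
      rw [← ej, ← ej', rowVal, rowVal, recVal_div, recVal_div]
      refine recVal_congr fun b hb => ?_
      rw [(b2 i hi' ⟨b, hb⟩).2, (b2 i' hi'' ⟨b, hb⟩).2, hf]
    have hsort : ∀ i i', i < i' → i' < 2 ^ (l + 1) →
        rowVal σ₃ (2 * n) s i ≤ rowVal σ₃ (2 * n) s i' := fun i i' h h' => c2.sorted h h'
    obtain ⟨u, hu, h1, h2⟩ : ∃ u, u + 1 < 2 ^ (l + 1) ∧
        rowVal σ₃ (2 * n) s u ≠ rowVal σ₃ (2 * n) s (u + 1) ∧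
        rowVal σ₃ (2 * n) s u / 2 ^ n = rowVal σ₃ (2 * n) s (u + 1) / 2 ^ n := by
      rcases lt_trichotomy j j' with h | rfl | h
      · exact exists_adjacent hsort h hj' hSne hkey
      · exact absurd rfl hSne
      · exact exists_adjacent hsort h hj hSne.symm hkey.symm
    rw [rowVal, rowVal, recVal_div, recVal_div] at h2
    have hkeys := recVal_inj h2
    have hflag : σ₄ (s + 2, u, 2 * n) = false := by
      refine (d2 u (by omega)).2.2.2 ⟨hu, ?_, hkeys, ?_⟩
      · rw [hdum u (by omega) _ hq, hdum u (by omega) _ (by omega)]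
        exact hdu
      · by_contra! hcon
        refine h1 (recVal_congr fun b hb => ?_)
        by_cases hbn : b < n
        · exact hcon b hbn
        · have := hkeys (b - n) (by omega)
          rwa [show n + (b - n) = b by omega] at this
    -- The flagged record reappears in row `t`, and row 0 is at most as large. Being below 2^(2n)
    -- means that the flag bit is zero.
    obtain ⟨t, ht, et⟩ := im4 u (by omega)
    have h3 : rowVal σ₅ (2 * n + 1) p t < 2 ^ (2 * n) := by
      rw [← et]
      exact recVal_lt_two_pow_iff.2 hflag
    refine recVal_lt_two_pow_iff (g := fun b => σ₅ (p, 0, b)).1 (lt_of_le_of_lt ?_ h3)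
    rcases Nat.eq_zero_or_pos t with rfl | h
    · exact le_rfl
    · exact e2.sorted h ht
  · obtain ⟨-, i, -, i', -, h2, h3, h4⟩ := hpair hnf
    exact ⟨_, _, h2, h3, h4⟩

end Spec

/-! ### Zero test and coherent extraction of a colliding pair. -/

section Spec

variable {n : ℕ} {f : Bits n → Bits n} {l a k : ℕ} {σ : Mem}

theorem forall_ne_zero_zeroTest : ∀ ℓ ∈ zeroTest n l k, ℓ.1 ≠ 0 := by
  intro ℓ hℓ
  simp only [zeroTest, loop, List.mem_append, List.mem_map] at hℓ
  obtain ⟨b, -, rfl⟩ | ⟨b, -, rfl⟩ := hℓ <;> simp [lay]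

theorem forall_ne_zero_extract : ∀ ℓ ∈ extract n l k, ℓ.1 ≠ 0 := by
  intro ℓ hℓ
  simp only [extract, loop, List.mem_append, List.mem_map] at hℓ
  obtain (⟨b, -, rfl⟩ | ⟨b, -, rfl⟩) | ⟨b, -, rfl⟩ := hℓ <;> simp [lay]

/-- The chain keeps in column `j` whether the first `j` bits of the register vanish, starting from
the constant 1 in column 0. -/
theorem exec_zeroTest (hk : 1 + k ≠ workBase n)
    (hσ : ∀ v : Addr, v.1 = workBase n → σ v = false) :
    exec f (zeroTest n l k) σ (workBase n, 0, qbits n l) = true ↔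
      ∀ b < qbits n l, σ (1 + k, 0, b) = false := by
  rw [zeroTest, exec_append]
  set ω := workBase n
  obtain ⟨a1, a2⟩ := exec_loop_of_disjoint (f := f) (κ := Kind.one) (by decide)
    (w := 1) (cnt := 1) (T := fun _ _ => (ω, 0, 0)) (C := fun _ _ => [])
    (fun b _ b' _ u _ u' _ e => by omega) (fun b _ b' _ u _ u' _ => by simp) σ
  set σ₁ := exec f (loop Kind.one 1 1 fun _ _ => [(ω, 0, 0)]) σ
  obtain ⟨b1, b2⟩ := exec_loop (f := f) (κ := Kind.andNot) (by decide)
    (w := qbits n l) (cnt := 1) (T := fun b _ => (ω, 0, b + 1))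
    (C := fun b _ => [(ω, 0, b), (1 + k, 0, b)])
    (fun b _ b' _ u _ u' _ e => by simp only [Prod.mk.injEq] at e; omega)
    (fun b _ b' _ u _ u' _ => by
      simp only [List.mem_cons, List.not_mem_nil, or_false, Prod.mk.injEq]; omega) σ₁
  set σ₂ := exec f (loop Kind.andNot (qbits n l) 1 fun b _ =>
    [(ω, 0, b + 1), (ω, 0, b), (1 + k, 0, b)]) σ₁
  have key : ∀ j ≤ qbits n l, σ₂ (ω, 0, j) = true ↔ ∀ b < j, σ (1 + k, 0, b) = false := by
    intro j
    induction j with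
    | zero =>
      intro _
      rw [b2 _ fun b _ u _ e => by simp only [Prod.mk.injEq] at e; omega, a1 0 one_pos 0 one_pos,
        hσ (ω, 0, 0) rfl]
      simp
    | succ j ih =>
      intro hj
      have h := b1 j hj 0 one_pos
      rw [a2 (ω, 0, j + 1) fun b _ u _ e => by simp only [Prod.mk.injEq] at e; omega,
        hσ (ω, 0, j + 1) rfl] at h
      simp only [List.map_cons, List.map_nil, Kind.poly_andNot, Bool.false_xor] at h
      rw [b2 (1 + k, 0, j) fun b _ u _ e => by simp only [Prod.mk.injEq] at e; omega,
        a2 (1 + k, 0, j) fun b _ u _ e => by simp only [Prod.mk.injEq] at e; omega] at h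
      rw [h, Bool.and_eq_true, ih (by omega), Bool.not_eq_true']
      refine ⟨fun h b hb => ?_, fun h => ⟨fun b hb => h b (by omega), h j (by omega)⟩⟩
      rcases Nat.lt_succ_iff_lt_or_eq.1 hb with hb | rfl
      exacts [h.1 b hb, h.2]
  exact key _ le_rfl

/-- Column `qbits n l` next to the register records whether this search delivers the output. It is
not uncomputed, because the output flag on which it depends is changed afterwards. -/
theorem exec_extract (hk : 1 + k < workBase n) (hσ : σ (1 + k, 0, qbits n l) = false) :
    exec f (extract n l k) σ (1 + k, 0, qbits n l) =
      (!σ (pairReg n l, 0, 2 * n) && !σ (0, 0, 2 * n)) ∧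
    (∀ b < 2 * n, exec f (extract n l k) σ (0, 0, b) =
      xor (σ (0, 0, b)) ((!σ (pairReg n l, 0, 2 * n) && !σ (0, 0, 2 * n)) &&
        σ (pairReg n l, 0, b))) ∧
    exec f (extract n l k) σ (0, 0, 2 * n) =
      xor (σ (0, 0, 2 * n)) (!σ (pairReg n l, 0, 2 * n) && !σ (0, 0, 2 * n)) ∧
    ∀ v : Addr, v ≠ (1 + k, 0, qbits n l) → ¬ (v.1 = 0 ∧ v.2.1 = 0 ∧ v.2.2 ≤ 2 * n) →
      exec f (extract n l k) σ v = σ v := by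
  rw [extract, exec_append, exec_append]
  have hp : 1 + k < pairReg n l := by unfold pairReg sortedReg; omega
  set p := pairReg n l
  set q := qbits n l
  obtain ⟨a1, a2⟩ := exec_loop_of_disjoint (f := f) (κ := Kind.nor) (by decide)
    (w := 1) (cnt := 1) (T := fun _ _ => (1 + k, 0, q))
    (C := fun _ _ => [(p, 0, 2 * n), (0, 0, 2 * n)])
    (fun b _ b' _ u _ u' _ e => by omega) (fun b _ b' _ u _ u' _ => by simp; omega) σ
  set σ₁ := exec f (loop Kind.nor 1 1 fun _ _ => [(1 + k, 0, q), (p, 0, 2 * n), (0, 0, 2 * n)]) σ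
  obtain ⟨b1, b2⟩ := exec_loop_of_disjoint (f := f) (κ := Kind.and) (by decide)
    (w := 2 * n) (cnt := 1) (T := fun b _ => (0, 0, b))
    (C := fun b _ => [(1 + k, 0, q), (p, 0, b)])
    (fun b _ b' _ u _ u' _ e => by simp only [Prod.mk.injEq] at e; omega)
    (fun b _ b' _ u _ u' _ => by
      simp only [List.mem_cons, List.not_mem_nil, or_false, Prod.mk.injEq]; omega) σ₁
  set σ₂ := exec f (loop Kind.and (2 * n) 1 fun b _ =>
    [(0, 0, b), (1 + k, 0, q), (p, 0, b)]) σ₁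
  obtain ⟨c1, c2⟩ := exec_loop_of_disjoint (f := f) (κ := Kind.copy) (by decide)
    (w := 1) (cnt := 1) (T := fun _ _ => (0, 0, 2 * n)) (C := fun _ _ => [(1 + k, 0, q)])
    (fun b _ b' _ u _ u' _ e => by omega) (fun b _ b' _ u _ u' _ => by simp; omega) σ₂
  set σ₃ := exec f (loop Kind.copy 1 1 fun _ _ => [(0, 0, 2 * n), (1 + k, 0, q)]) σ₂
  have g1 : σ₁ (1 + k, 0, q) = (!σ (p, 0, 2 * n) && !σ (0, 0, 2 * n)) := by
    rw [a1 0 one_pos 0 one_pos, hσ]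
    simp
  have g2 : σ₂ (1 + k, 0, q) = (!σ (p, 0, 2 * n) && !σ (0, 0, 2 * n)) := by
    rw [b2 _ fun b _ u _ e => by simp only [Prod.mk.injEq] at e; omega, g1]
  refine ⟨?_, fun b hb => ?_, ?_, fun v hv hv' => ?_⟩
  · rw [c2 _ fun b _ u _ e => by simp only [Prod.mk.injEq] at e; omega, g2]
  · rw [c2 _ fun b _ u _ e => by simp only [Prod.mk.injEq] at e; omega, b1 b hb 0 one_pos,
      a2 _ fun b _ u _ e => by simp only [Prod.mk.injEq] at e; omega]
    simp only [List.map_cons, List.map_nil, Kind.poly_and, g1]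
    rw [a2 (p, 0, b) fun b _ u _ e => by simp only [Prod.mk.injEq] at e; omega]
  · rw [c1 0 one_pos 0 one_pos, b2 _ fun b _ u _ e => by simp only [Prod.mk.injEq] at e; omega,
      a2 _ fun b _ u _ e => by simp only [Prod.mk.injEq] at e; omega]
    simp only [List.map_cons, List.map_nil, Kind.poly_copy, g2]
  · rw [c2 v fun b _ u _ e => hv' (by rw [e]; simp), b2 v fun b hb u _ e => hv' (by
      rw [e]; simp only [true_and]; omega), a2 v fun b _ u _ e => hv e]

/-- The wires with a pair of arguments hold a collision. -/
def HasPair (f : Bits n → Bits n) (σ : Mem) : Prop :=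
  ∃ i i' : Bits n, i ≠ i' ∧ f i = f i' ∧ ∀ b : Fin n, σ (0, 0, b) = i b ∧ σ (0, 0, n + b) = i' b

/-- Extraction writes only to output wires and to the control bit beside the register, none of which
the oracle touches. The reversed oracle therefore finds all of its wires as it left them and clears
the work space. -/
theorem exec_oracle_extract (hl : l ≤ n) (hk : k < n - l + 2)
    (hσ : ∀ v : Addr, workBase n ≤ v.1 → σ v = false) (hq : σ (1 + k, 0, qbits n l) = false) :
    CallsClean f (oracle n l a k ++ extract n l k ++ (oracle n l a k).reverse) σ ∧
    (∀ v : Addr, v ≠ (1 + k, 0, qbits n l) → ¬ (v.1 = 0 ∧ v.2.1 = 0 ∧ v.2.2 ≤ 2 * n) →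
      exec f (oracle n l a k ++ extract n l k ++ (oracle n l a k).reverse) σ v = σ v) ∧
    (exec f (oracle n l a k ++ extract n l k ++ (oracle n l a k).reverse) σ
      (1 + k, 0, qbits n l) = true ↔
        (Marked f l fun b => σ (1 + k, 0, b)) ∧ σ (0, 0, 2 * n) = false) ∧
    (exec f (oracle n l a k ++ extract n l k ++ (oracle n l a k).reverse) σ
      (1 + k, 0, qbits n l) = false →
      exec f (oracle n l a k ++ extract n l k ++ (oracle n l a k).reverse) σ = σ) ∧
    (exec f (oracle n l a k ++ extract n l k ++ (oracle n l a k).reverse) σ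
      (1 + k, 0, qbits n l) = true → (∀ b < 2 * n, σ (0, 0, b) = false) →
      exec f (oracle n l a k ++ extract n l k ++ (oracle n l a k).reverse) σ (0, 0, 2 * n) = true ∧
      HasPair f (exec f (oracle n l a k ++ extract n l k ++ (oracle n l a k).reverse) σ)) := by
  have hkw : 1 + k < workBase n := by unfold workBase; omega
  have hv := valid_oracle (n := n) (a := a) hl hk
  obtain ⟨o1, o2, o3, o4⟩ := exec_oracle (f := f) (a := a) hl hk hσ
  rw [callsClean_append, callsClean_append, exec_append, exec_append, exec_append]
  have hrev := exec_reverse (f := f) hv.ok σ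
  set τ := exec f (oracle n l a k) σ
  have hτ0 : ∀ b, τ (0, 0, b) = σ (0, 0, b) := fun b => o1 _ (by simp only; omega)
  obtain ⟨e1, e2, e3, e4⟩ := exec_extract (f := f) (l := l) hkw (σ := τ)
    (by rw [o1 _ (by simpa using hkw), hq])
  set τ' := exec f (extract n l k) τ
  rw [hτ0] at e1 e3
  -- On these wires the memories before and after extraction agree. Off them, the reversed oracle
  -- does nothing.
  set S : Set Addr := {v | OracleWire n l a k v}
  have hS : ∀ v ∈ S, τ v = τ' v := by
    intro v hv
    refine (e4 v ?_ ?_).symm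
    · rintro rfl
      have := hv.2
      simp only at this
      omega
    · rintro ⟨h1, -⟩
      have := hv.2
      omega
  have hw : ∀ v ∈ wires (oracle n l a k).reverse, v ∈ S := hv.reverse.bounded
  set τ'' := exec f (oracle n l a k).reverse τ'
  have r1 : ∀ v ∈ S, τ'' v = σ v := fun v hv' => by
    have := exec_congr (f := f) hv.reverse.ok hw hS v hv'
    rw [hrev] at this
    exact this.symm
  have r2 : ∀ v ∉ S, τ'' v = τ' v := fun v hv' =>
    exec_frame hv.reverse.ok (fun h => hv' (hw v h)) τ'
  have r3 : ∀ v ∉ S, τ v = σ v := fun v hv' => exec_frame hv.ok (fun h => hv' (hv.bounded v h)) σ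
  have s1 : (1 + k, 0, qbits n l) ∉ S := fun h => by
    have := h.2
    simp only at this
    omega
  have s2 : ∀ b, ((0, 0, b) : Addr) ∉ S := fun b h => by
    have := h.2
    simp only at this
    omega
  have t1 : τ'' (1 + k, 0, qbits n l) = (!τ (pairReg n l, 0, 2 * n) && !σ (0, 0, 2 * n)) := by
    rw [r2 _ s1, e1]
  have t2 : ∀ b < 2 * n, τ'' (0, 0, b) = xor (σ (0, 0, b))
      (τ'' (1 + k, 0, qbits n l) && τ (pairReg n l, 0, b)) := fun b hb => by
    rw [r2 _ (s2 b), e2 b hb, t1, hτ0, hτ0]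
  have t3 : τ'' (0, 0, 2 * n) = xor (σ (0, 0, 2 * n)) (τ'' (1 + k, 0, qbits n l)) := by
    rw [r2 _ (s2 _), e3, t1]
  have t4 : ∀ v : Addr, v ≠ (1 + k, 0, qbits n l) → ¬ (v.1 = 0 ∧ v.2.1 = 0 ∧ v.2.2 ≤ 2 * n) →
      τ'' v = σ v := fun v h1 h2 => by
    by_cases hvS : v ∈ S
    · exact r1 v hvS
    · rw [r2 v hvS, e4 v h1 h2, r3 v hvS]
  refine ⟨⟨⟨o2, callsClean_of_forall_ne forall_ne_zero_extract _⟩, ?_⟩, t4, ?_, fun h => ?_,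
    fun h h0 => ⟨?_, ?_⟩⟩
  · exact (o2.reverse hv.ok).congr hv.reverse.ok hw hS
  · rw [t1, Bool.and_eq_true, Bool.not_eq_true', Bool.not_eq_true', o3]
  · funext v
    by_cases h1 : v = (1 + k, 0, qbits n l)
    · rw [h1, h, hq]
    by_cases h2 : v.1 = 0 ∧ v.2.1 = 0 ∧ v.2.2 ≤ 2 * n
    · obtain ⟨r, i, b⟩ := v
      obtain ⟨rfl, rfl, hb⟩ := h2
      rcases hb.lt_or_eq with hb | hb
      · rw [t2 b hb, h]; simp
      · simp only at hb
        rw [hb, t3, h]; simp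
    · exact t4 v h1 h2
  · rw [t1, Bool.and_eq_true, Bool.not_eq_true'] at h
    rw [t3, t1, h.1]
    simp
  · have h' := h
    rw [t1, Bool.and_eq_true, Bool.not_eq_true'] at h'
    obtain ⟨i, i', h1, h2, h3⟩ := o4 h'.1
    refine ⟨i, i', h1, h2, fun b => ⟨?_, ?_⟩⟩
    · rw [t2 b (by omega), h, h0 b (by omega), (h3 b).1]; simp
    · rw [t2 (n + b) (by omega), h, h0 (n + b) (by omega), (h3 b).2]; simp

end Spec

/-! ### Hadamard transform of the search register -/

section Hadamard

variable {q : ℕ}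

theorem hadamard_involutive (b : Fin q) (ψ : State q) :
    (Gate.one hadamard b).apply ((Gate.one hadamard b).apply ψ) = ψ := by
  funext x
  simp only [Gate.apply, Fintype.sum_bool, hadamard_apply, Function.update_self,
    Function.update_idem]
  have h := invSqrtTwo_mul_self
  rcases hx : x b with _ | _
  · have : Function.update x b false = x := by rw [← hx, Function.update_eq_self]
    simp [this]
    linear_combination 2 * ψ x * h
  · have : Function.update x b true = x := by rw [← hx, Function.update_eq_self]
    simp [this]
    linear_combination 2 * ψ x * h

/-- Hadamard gates on the given qubits. -/
def hadOn (L : List (Fin q)) (ψ : State q) : State q :=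
  L.foldl (fun φ b => (Gate.one hadamard b).apply φ) ψ

theorem isLinearMap_hadOn (L : List (Fin q)) : IsLinearMap ℂ (hadOn L) :=
  isLinearMap_foldl fun b _ => (Gate.one hadamard b).isLinearMap_apply

theorem hadOn_hadOn (L : List (Fin q)) (ψ : State q) : hadOn L (hadOn L ψ) = ψ := by
  induction L generalizing ψ with
  | nil => rfl
  | cons b L ih =>
    have hc : ∀ φ, (Gate.one hadamard b).apply (hadOn L φ) =
        hadOn L ((Gate.one hadamard b).apply φ) := by
      refine foldl_comm_of_comm fun b' _ s => ?_
      by_cases h : b = b'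
      · rw [h]
      · exact Gate.apply_comm (by simpa [Gate.support] using h) s
    change hadOn L ((Gate.one hadamard b).apply (hadOn L ((Gate.one hadamard b).apply ψ))) = ψ
    rw [hc, ih, hadamard_involutive]

/-- Each Hadamard gate contributes a factor 1/√2 and the sign of the product of the old and the new
bit. Below, only the row and the column at the zero string are needed. -/
theorem hadOn_ket {L : List (Fin q)} (hL : L.Nodup) (x y : Bits q) :
    hadOn L (ket y) x = if ∀ b, b ∉ L → x b = y b then
      invSqrtTwo ^ L.length * (L.map fun b => if x b && y b then (-1 : ℂ) else 1).prod else 0 := by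
  induction L using List.reverseRecOn generalizing x with
  | nil => simp [hadOn, ket, funext_iff]
  | append_singleton L b ih =>
    have hb : b ∉ L := by
      rw [List.nodup_append] at hL
      exact fun h => hL.2.2 b h b (by simp) rfl
    have hL' : L.Nodup := (List.nodup_append.1 hL).1
    have h1 : hadOn (L ++ [b]) (ket y) x =
        ∑ t : Bool, hadamard.1 (x b) t * hadOn L (ket y) (Function.update x b t) := by
      rw [hadOn, List.foldl_append]
      rfl
    have hmap : ∀ t, (L.map fun b' => if Function.update x b t b' && y b' then (-1 : ℂ) else 1) =
        L.map fun b' => if x b' && y b' then (-1 : ℂ) else 1 := fun t =>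
      List.map_congr_left fun b' hb' => by
        rw [Function.update_of_ne (ne_of_mem_of_not_mem hb' hb)]
    have hcond : ∀ t, (∀ b', b' ∉ L → Function.update x b t b' = y b') ↔
        t = y b ∧ ∀ b', b' ∉ L ++ [b] → x b' = y b' := by
      intro t
      constructor
      · intro h
        refine ⟨by simpa using h b hb, fun b' hb' => ?_⟩
        simp only [List.mem_append, List.mem_singleton, not_or] at hb'
        simpa [Function.update_of_ne hb'.2] using h b' hb'.1
      · rintro ⟨rfl, h⟩ b' hb'
        by_cases hbb : b' = b
        · rw [hbb, Function.update_self]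
        · rw [Function.update_of_ne hbb]
          exact h b' (by simp [hb', hbb])
    rw [h1]
    by_cases h : ∀ b', b' ∉ L ++ [b] → x b' = y b'
    · have hc : ∀ t, (∀ b', b' ∉ L → Function.update x b t b' = y b') ↔ t = y b := fun t =>
        (hcond t).trans (and_iff_left h)
      simp only [ih hL', hc, hmap, mul_ite, mul_zero]
      rw [Finset.sum_ite_eq' Finset.univ (y b), if_pos h]
      simp only [Finset.mem_univ, if_true, hadamard_apply,
        List.length_append, List.length_singleton,
        List.map_append, List.prod_append, List.map_cons, List.map_nil, List.prod_cons,
        List.prod_nil, pow_succ]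
      ring_nf
    · have hc : ∀ t, ¬ ∀ b', b' ∉ L → Function.update x b t b' = y b' := fun t ht =>
        h ((hcond t).1 ht).2
      rw [if_neg h]
      exact Finset.sum_eq_zero fun t _ => by rw [ih hL', if_neg (hc t), mul_zero]

/-- The Hadamard transform. -/
def hadTransform (q : ℕ) : State q → State q := hadOn (List.finRange q)

theorem isLinearMap_hadTransform : IsLinearMap ℂ (hadTransform q) := isLinearMap_hadOn _

theorem hadTransform_hadTransform (ψ : State q) : hadTransform q (hadTransform q ψ) = ψ :=
  hadOn_hadOn _ ψ

theorem hadTransform_ket_zero : hadTransform q (ket fun _ => false) = fun _ => invSqrtTwo ^ q := by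
  funext x
  rw [hadTransform, hadOn_ket (List.nodup_finRange q)]
  simp

theorem hadTransform_zero (ψ : State q) :
    hadTransform q ψ (fun _ => false) = invSqrtTwo ^ q * ∑ x, ψ x := by
  have : ψ = ∑ y : Bits q, ψ y • ket y := by
    funext x
    simp [ket, Finset.sum_apply]
  conv_lhs => rw [this, map_sum_smul_of_isLinearMap isLinearMap_hadTransform]
  rw [Finset.sum_apply, Finset.mul_sum]
  refine Finset.sum_congr rfl fun y _ => ?_
  rw [Pi.smul_apply, hadTransform, hadOn_ket (List.nodup_finRange q)]
  simp [mul_comm]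

theorem invSqrtTwo_pow_mul_self : invSqrtTwo ^ q * invSqrtTwo ^ q = ((2 : ℂ) ^ q)⁻¹ := by
  rw [← mul_pow, invSqrtTwo_mul_self, one_div, inv_pow]

/-- The Hadamard transform of a phase flip at zero is a reflection at the uniform vector. -/
theorem hadTransform_flip (ψ : State q) :
    (hadTransform q fun x => (if x = (fun _ => false) then -1 else 1 : ℂ) * hadTransform q ψ x) =
      fun x => ψ x - 2 * ((2 : ℂ) ^ q)⁻¹ * ∑ y, ψ y := by
  -- The flip subtracts twice the component at zero, and that component is the normalized sum of all
  -- amplitudes of `ψ`.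
  have h1 : (fun x => (if x = (fun _ => false) then -1 else 1 : ℂ) * hadTransform q ψ x) =
      hadTransform q ψ + (-2 * (invSqrtTwo ^ q * ∑ y, ψ y)) • ket fun _ => false := by
    funext x
    rw [← hadTransform_zero]
    simp only [Pi.add_apply, Pi.smul_apply, ket, smul_eq_mul]
    split_ifs with h
    · rw [h]; ring
    · ring
  rw [h1, isLinearMap_hadTransform.map_add, isLinearMap_hadTransform.map_smul,
    hadTransform_hadTransform, hadTransform_ket_zero]
  funext x
  simp only [Pi.add_apply, Pi.smul_apply, smul_eq_mul]
  rw [← invSqrtTwo_pow_mul_self]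
  ring

end Hadamard

/-! ### States of the search register -/

/-- The memory with the given contents of the `k`-th search register. -/
def setReg {q : ℕ} (k : ℕ) (m : Mem) (x : Bits q) : Mem := fun v =>
  if h : v.1 = 1 + k ∧ v.2.1 = 0 ∧ v.2.2 < q then x ⟨v.2.2, h.2.2⟩ else m v

/-- Extension of a bit string by zeros. -/
def extendBits {q : ℕ} (x : Bits q) (b : ℕ) : Bool := if h : b < q then x ⟨b, h⟩ else false

/-- A superposition of memories that differ in the `k`-th search register. -/
def regState (R W w : ℕ) {q : ℕ} (k : ℕ) (m : Mem) (a : State q) : State w :=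
  ∑ x, a x • memKet R W w (setReg k m x)

section Register

variable {P R W w q k : ℕ}

theorem setReg_register (m : Mem) (x : Bits q) (b : Fin q) : setReg k m x (1 + k, 0, b) = x b := by
  simp [setReg]

theorem setReg_of_ne {m : Mem} (x : Bits q) {v : Addr}
    (h : ¬ (v.1 = 1 + k ∧ v.2.1 = 0 ∧ v.2.2 < q)) : setReg k m x v = m v := dif_neg h

theorem setReg_register_eq {m : Mem} (h : ∀ b, q ≤ b → m (1 + k, 0, b) = false) (x : Bits q) :
    (fun b => setReg k m x (1 + k, 0, b)) = extendBits x := by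
  funext b
  by_cases hb : b < q
  · simp [setReg, extendBits, hb]
  · simp [setReg, extendBits, hb, h b (by omega)]

theorem setReg_zero {m : Mem} (h : ∀ b < q, m (1 + k, 0, b) = false) :
    setReg k m (fun _ : Fin q => false) = m := by
  funext v
  by_cases hv : v.1 = 1 + k ∧ v.2.1 = 0 ∧ v.2.2 < q
  · obtain ⟨r, i, b⟩ := v
    obtain ⟨rfl, rfl, hb⟩ := hv
    simp [setReg, h b hb]
  · exact dif_neg hv

theorem regState_ket (m : Mem) (x : Bits q) :
    regState R W w k m (ket x) = memKet R W w (setReg k m x) := by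
  simp [regState, ket]

/-- Seen as a lift along the wires of the register, a superposition of register contents can be
treated by gates as a state of `q` qubits alone. -/
theorem exists_regState_eq_lift (hw : w = P * R * W) (hB : ∀ b < q, Bdd P R W (1 + k, 0, b)) :
    ∃ e : Fin q ↪ Fin w, (∀ b, (e b).val = enc R W (1 + k, 0, b)) ∧
      ∀ m a, regState R W w k m a = lift e (bitsOf R W w m) a := by
  let e : Fin q ↪ Fin w := ⟨fun b => ⟨enc R W (1 + k, 0, b), hw ▸ enc_lt (hB b b.2)⟩,
    fun b b' h => by
    have := enc_injOn (hB b b.2) (hB b' b'.2) (Fin.mk.inj h)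
    simpa [Fin.ext_iff] using this⟩
  refine ⟨e, fun b => rfl, fun m a => ?_⟩
  rw [lift_eq_sum]
  refine Finset.sum_congr rfl fun x _ => ?_
  rw [memKet]
  congr 2
  funext j
  by_cases hj : j ∈ Set.range e
  · obtain ⟨b, rfl⟩ := hj
    rw [e.injective.extend_apply]
    change setReg k m x (dec R W (enc R W (1 + k, 0, b))) = _
    rw [dec_enc (hB b b.2), setReg_register]
  · rw [Function.extend_apply' _ _ _ hj]
    refine setReg_of_ne x fun h => hj ⟨⟨(dec R W j).2.2, h.2.2⟩, Fin.ext ?_⟩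
    change enc R W (1 + k, 0, (dec R W j).2.2) = _
    rw [← h.1, ← h.2.1]
    exact enc_dec R W j

theorem runLayer_hadLayer {n l a : ℕ} (hl : l ≤ n) (hk : k < n - l + 2)
    (hw : w = nRegions n l * 2 ^ (l + 1) * nCols n a) (C : Circuit (n + n + a)) (m : Mem)
    (ψ : State (qbits n l)) :
    runLayer C (2 ^ (l + 1)) (nCols n a) w (hadLayer n l k)
      (regState (2 ^ (l + 1)) (nCols n a) w k m ψ) =
    regState (2 ^ (l + 1)) (nCols n a) w k m (hadTransform _ ψ) := by
  obtain ⟨e, he, hlift⟩ := exists_regState_eq_lift hw fun b (hb : b < qbits n l) =>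
    bdd_register (a := a) hl hk hb.le
  rw [runLayer_of_ne_zero C (ok_hadLayer hl hk) (by simp [hadLayer, lay]), hlift, hlift,
    hadTransform, hadOn]
  have h1 : (hadLayer n l k).2 = (List.finRange (qbits n l)).map fun b => [(1 + k, 0, b.val)] := by
    rw [hadLayer, lay, ← List.map_coe_finRange_eq_range, List.map_map]
    rfl
  rw [h1, List.foldl_map]
  have h2 := foldl_map_lift e (bitsOf (2 ^ (l + 1)) (nCols n a) w m)
    ((List.finRange (qbits n l)).map fun b => Gate.one hadamard b) ψ
  rw [List.foldl_map, List.foldl_map] at h2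
  rw [← h2]
  congr 1
  funext φ b
  change applyCode w [0, enc (2 ^ (l + 1)) (nCols n a) (1 + k, 0, b)] φ = _
  have h3 : enc (2 ^ (l + 1)) (nCols n a) (1 + k, 0, b) < w := he b ▸ (e b).2
  simp only [applyCode, mkBasic, dif_pos h3, BasicGate.toGate, Gate.map]
  congr 2
  exact Fin.ext (he b).symm

end Register

/-! ### Grover searches as operators on the search register. -/

section Iteration

variable {n a : ℕ} {f : Bits n → Bits n} {C : Circuit (n + n + a)} {P R W w : ℕ}

/-- Computing a bit, flipping the phase and uncomputing. -/
theorem runProg_conj (hC : C.Computes f) (hw : w = P * R * W) {Q : List Layer}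
    (hQ : Valid (n + n + a) (Bdd P R W) Q) {z : Addr} (hz : Bdd P R W z) {σ : Mem}
    (hσ : CallsClean f Q σ) :
    runProg C R W w (Q ++ [zedLayer z] ++ Q.reverse) (memKet R W w σ) =
      (if exec f Q σ z then -1 else 1 : ℂ) • memKet R W w σ := by
  rw [runProg_append, runProg_append, runProg_memKet hC hw hQ.ok hQ.kind hσ, runProg_cons,
    runProg_nil, runLayer_zedLayer hw C hz,
    (isLinearMap_runProg C R W w Q.reverse).map_smul,
    runProg_memKet hC hw hQ.reverse.ok hQ.reverse.kind (hσ.reverse hQ.ok), exec_reverse hQ.ok]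

open Classical in
/-- The effect of a Grover iteration on the amplitudes. -/
def groverStep {q : ℕ} (A : Set (Bits q)) (ψ : State q) : State q := fun x =>
  (if x ∈ A then 1 else -1 : ℂ) * ψ x -
    2 * ((2 : ℂ) ^ q)⁻¹ * ∑ y, (if y ∈ A then 1 else -1 : ℂ) * ψ y

/-- The marked contents of the search register. -/
def markedSet (f : Bits n → Bits n) (l : ℕ) : Set (Bits (qbits n l)) :=
  {x | Marked f l (extendBits x)}

variable {l k : ℕ}

/-- The pair flag is 0 on marked contents, so the phase flip negates the unmarked ones: the negative
of the usual Grover oracle. The flip at zero likewise yields the negative of the usual reflection at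
the uniform vector, and the two signs cancel. -/
theorem runProg_groverIter (hC : C.Computes f) (hl : l ≤ n) (hk : k < n - l + 2)
    (hw : w = nRegions n l * 2 ^ (l + 1) * nCols n a) {m : Mem}
    (hm : ∀ v : Addr, 1 + k ≤ v.1 → m v = false) (ψ : State (qbits n l)) :
    runProg C (2 ^ (l + 1)) (nCols n a) w (groverIter n l a k)
      (regState (2 ^ (l + 1)) (nCols n a) w k m ψ) =
    regState (2 ^ (l + 1)) (nCols n a) w k m (groverStep (markedSet f l) ψ) := by
  classical
  have hkw : 1 + k < workBase n := by unfold workBase; omega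
  have hwork : ∀ (x : Bits (qbits n l)) (v : Addr), workBase n ≤ v.1 → setReg k m x v = false :=
    fun x v hv => by rw [setReg_of_ne x (by omega), hm v (by omega)]
  have ho : ∀ φ : State (qbits n l), runProg C (2 ^ (l + 1)) (nCols n a) w
      (oracle n l a k ++ [zedLayer (pairReg n l, 0, 2 * n)] ++ (oracle n l a k).reverse)
      (regState (2 ^ (l + 1)) (nCols n a) w k m φ) = regState (2 ^ (l + 1)) (nCols n a) w k m
        fun x => (if x ∈ markedSet f l then 1 else -1 : ℂ) * φ x := by
    intro φ
    rw [regState, map_sum_smul_of_isLinearMap (isLinearMap_runProg _ _ _ _ _)]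
    refine Finset.sum_congr rfl fun x _ => ?_
    obtain ⟨-, o2, o3, -⟩ := exec_oracle (f := f) (a := a) hl hk (hwork x)
    rw [runProg_conj hC hw ((valid_oracle hl hk).mono fun _ h => h.1) bdd_pairFlag o2, smul_smul,
      mul_comm]
    rw [setReg_register_eq (fun b _ => hm _ le_rfl)] at o3
    congr 2
    by_cases hx : x ∈ markedSet f l
    · rw [if_pos hx, o3.2 hx]
      simp
    · rw [if_neg hx, if_pos]
      rw [← Bool.not_eq_false]
      exact fun h => hx (o3.1 h)
  have hz : ∀ φ : State (qbits n l), runProg C (2 ^ (l + 1)) (nCols n a) w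
      (zeroTest n l k ++ [zedLayer (workBase n, 0, qbits n l)] ++ (zeroTest n l k).reverse)
      (regState (2 ^ (l + 1)) (nCols n a) w k m φ) = regState (2 ^ (l + 1)) (nCols n a) w k m
        fun x => (if x = (fun _ => false) then -1 else 1 : ℂ) * φ x := by
    intro φ
    rw [regState, map_sum_smul_of_isLinearMap (isLinearMap_runProg _ _ _ _ _)]
    refine Finset.sum_congr rfl fun x _ => ?_
    have o3 := exec_zeroTest (f := f) (l := l) hkw.ne (σ := setReg k m x)
      (fun v hv => hwork x v hv.ge)
    rw [runProg_conj hC hw ((valid_zeroTest hl hk).mono fun _ h => h.1) bdd_zeroFlag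
      (callsClean_of_forall_ne forall_ne_zero_zeroTest _), smul_smul, mul_comm]
    congr 2
    refine if_congr (o3.trans ⟨fun h => funext fun b => ?_, ?_⟩) rfl rfl
    · rw [← setReg_register (k := k) m x b, h b b.2]
    · rintro rfl b hb
      exact setReg_register (q := qbits n l) m (fun _ => false) ⟨b, hb⟩
  have hh : ∀ φ : State (qbits n l), runProg C (2 ^ (l + 1)) (nCols n a) w [hadLayer n l k]
      (regState (2 ^ (l + 1)) (nCols n a) w k m φ) =
      regState (2 ^ (l + 1)) (nCols n a) w k m (hadTransform _ φ) := fun φ => by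
    rw [runProg_cons, runProg_nil, runLayer_hadLayer hl hk hw]
  rw [groverIter, runProg_append, ho, runProg_append, runProg_append, hh, hz, hh,
    hadTransform_flip]
  rfl

theorem runProg_groverIters (hC : C.Computes f) (hl : l ≤ n) (hk : k < n - l + 2)
    (hw : w = nRegions n l * 2 ^ (l + 1) * nCols n a) {m : Mem}
    (hm : ∀ v : Addr, 1 + k ≤ v.1 → m v = false) (ψ : State (qbits n l)) (j : ℕ) :
    runProg C (2 ^ (l + 1)) (nCols n a) w ((List.range j).flatMap fun _ => groverIter n l a k)
      (regState (2 ^ (l + 1)) (nCols n a) w k m ψ) =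
    regState (2 ^ (l + 1)) (nCols n a) w k m ((groverStep (markedSet f l))^[j] ψ) := by
  induction j with
  | zero => rfl
  | succ j ih =>
    rw [List.range_succ, List.flatMap_append, runProg_append, ih, List.flatMap_cons,
      List.flatMap_nil, List.append_nil, runProg_groverIter hC hl hk hw hm,
      Function.iterate_succ_apply']

/-- The amplitudes at the end of the `k`-th search. -/
def searchAmp (f : Bits n → Bits n) (l k : ℕ) : State (qbits n l) :=
  (groverStep (markedSet f l))^[2 ^ k] fun _ => invSqrtTwo ^ qbits n l

/-- The Grover iterations return the work space to zero, so each register content is one basis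
state, on which the extraction runs classically. -/
theorem runProg_searchRun (hC : C.Computes f) (hl : l ≤ n) (hk : k < n - l + 2)
    (hw : w = nRegions n l * 2 ^ (l + 1) * nCols n a) {m : Mem}
    (hm : ∀ v : Addr, 1 + k ≤ v.1 → m v = false) :
    runProg C (2 ^ (l + 1)) (nCols n a) w (searchRun n l a k)
      (memKet (2 ^ (l + 1)) (nCols n a) w m) =
    ∑ x, searchAmp f l k x • memKet (2 ^ (l + 1)) (nCols n a) w
      (exec f (oracle n l a k ++ extract n l k ++ (oracle n l a k).reverse) (setReg k m x)) := by
  have h0 : memKet (2 ^ (l + 1)) (nCols n a) w m =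
      regState (2 ^ (l + 1)) (nCols n a) w k m (ket fun _ : Fin (qbits n l) => false) := by
    rw [regState_ket, setReg_zero fun b _ => hm _ le_rfl]
  rw [searchRun, runProg_append, h0, runProg_append _ _ _ _ [hadLayer n l k], runProg_cons,
    runProg_nil, runLayer_hadLayer hl hk hw,
    hadTransform_ket_zero, runProg_groverIters hC hl hk hw hm,
    regState, map_sum_smul_of_isLinearMap (isLinearMap_runProg _ _ _ _ _)]
  refine Finset.sum_congr rfl fun x _ => ?_
  have hv := (valid_oracle (a := a) hl hk).mono fun _ h => h.1
  have hV := (hv.append (valid_extract hl hk)).append hv.reverse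
  rw [runProg_memKet hC hw hV.ok hV.kind, searchAmp]
  refine (exec_oracle_extract hl hk (fun v hv => ?_) ?_).1
  · rw [setReg_of_ne x (by unfold workBase at hv; omega), hm v (by unfold workBase at hv; omega)]
  · rw [setReg_of_ne x (by simp), hm _ le_rfl]

end Iteration

/-! ### Amplitudes of the search -/

section Amplitudes

open Classical in
/-- The state with constant amplitudes inside and outside of a set, normalized. -/
def planeState {q : ℕ} (A : Set (Bits q)) (u v : ℝ) : State q := fun x =>
  if x ∈ A then ((u / √(A.ncard : ℝ) : ℝ) : ℂ) else ((v / √((2 : ℝ) ^ q - A.ncard) : ℝ) : ℂ)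

variable {q : ℕ} {A : Set (Bits q)}

open Classical in
theorem sum_ite_mem (A : Set (Bits q)) (c d : ℝ) :
    ∑ x : Bits q, (if x ∈ A then c else d) = A.ncard * c + ((2 : ℝ) ^ q - A.ncard) * d := by
  have h1 : ((Finset.univ.filter fun x => x ∈ A).card : ℝ) = A.ncard := by
    rw [Set.ncard_eq_toFinset_card']
    congr 2
    ext x
    simp
  have h2 : ∑ x : Bits q, (if x ∈ A then c else d) =
      ∑ x : Bits q, ((if x ∈ A then c - d else 0) + d) :=
    Finset.sum_congr rfl fun x _ => by split_ifs <;> ring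
  rw [h2, Finset.sum_add_distrib, ← Finset.sum_filter, Finset.sum_const, Finset.sum_const,
    nsmul_eq_mul, nsmul_eq_mul, h1]
  simp
  ring

/-- The angle of a Grover iteration. -/
def groverAngle (A : Set (Bits q)) : ℝ := Real.arcsin √(A.ncard / (2 : ℝ) ^ q)

theorem ncard_le (A : Set (Bits q)) : (A.ncard : ℝ) ≤ 2 ^ q := by
  have h := Set.ncard_le_ncard (Set.subset_univ A)
  rw [Set.ncard_univ, Nat.card_eq_fintype_card] at h
  simp at h
  exact_mod_cast h

theorem sin_groverAngle (A : Set (Bits q)) :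
    Real.sin (groverAngle A) = √(A.ncard : ℝ) / √((2 : ℝ) ^ q) := by
  have h : √(A.ncard / (2 : ℝ) ^ q) ≤ 1 := by
    rw [Real.sqrt_le_one]
    exact (div_le_one (by positivity)).2 (ncard_le A)
  rw [groverAngle, Real.sin_arcsin (by linarith [Real.sqrt_nonneg (A.ncard / (2 : ℝ) ^ q)]) h,
    Real.sqrt_div (by positivity)]

theorem cos_groverAngle (A : Set (Bits q)) :
    Real.cos (groverAngle A) = √((2 : ℝ) ^ q - A.ncard) / √((2 : ℝ) ^ q) := by
  rw [groverAngle, Real.cos_arcsin, Real.sq_sqrt (by positivity),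
    ← Real.sqrt_div (by linarith [ncard_le A])]
  congr 1
  field_simp

/-- The plane spanned by the normalized indicators of `A` and of its complement is invariant, and
the product of the two reflections rotates it by twice the angle whose sine is √(|A|/2^q). The
complement has to be non-empty for its normalization; if `A` is empty, the coordinate along `A` is
never evaluated. -/
theorem groverStep_planeState (hA : (A.ncard : ℝ) < 2 ^ q) (φ : ℝ) :
    groverStep A (planeState A (Real.sin φ) (Real.cos φ)) =
      planeState A (Real.sin (φ + 2 * groverAngle A)) (Real.cos (φ + 2 * groverAngle A)) := by
  classical
  have hM : (0 : ℝ) < 2 ^ q := by positivity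
  have hs := sin_groverAngle A
  have hc := cos_groverAngle A
  have ht := Real.mul_self_sqrt (show (0 : ℝ) ≤ A.ncard by positivity)
  have hd := Real.mul_self_sqrt (show (0 : ℝ) ≤ 2 ^ q - A.ncard by linarith)
  have hm := Real.mul_self_sqrt hM.le
  have hd0 : 0 < √((2 : ℝ) ^ q - A.ncard) := Real.sqrt_pos.2 (by linarith)
  have hm0 : 0 < √((2 : ℝ) ^ q) := Real.sqrt_pos.2 hM
  have hsum : ∑ y, (if y ∈ A then 1 else -1 : ℂ) * planeState A (Real.sin φ) (Real.cos φ) y =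
      ((√(A.ncard : ℝ) * Real.sin φ - √((2 : ℝ) ^ q - A.ncard) * Real.cos φ : ℝ) : ℂ) := by
    have h1 : ∀ y, (if y ∈ A then 1 else -1 : ℂ) * planeState A (Real.sin φ) (Real.cos φ) y =
        ((if y ∈ A then Real.sin φ / √(A.ncard : ℝ) else
          -(Real.cos φ / √((2 : ℝ) ^ q - A.ncard)) : ℝ) : ℂ) := fun y => by
      simp only [planeState]
      split_ifs <;> push_cast <;> ring
    rw [Finset.sum_congr rfl fun y _ => h1 y, ← Complex.ofReal_sum, sum_ite_mem]
    congr 1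
    have h2 : (A.ncard : ℝ) * (Real.sin φ / √(A.ncard : ℝ)) = √(A.ncard : ℝ) * Real.sin φ := by
      rw [mul_div_left_comm, Real.div_sqrt, mul_comm]
    have h3 : ((2 : ℝ) ^ q - A.ncard) * (Real.cos φ / √((2 : ℝ) ^ q - A.ncard)) =
        √((2 : ℝ) ^ q - A.ncard) * Real.cos φ := by
      rw [mul_div_left_comm, Real.div_sqrt, mul_comm]
    linear_combination h2 - h3
  funext x
  rw [groverStep, hsum, Real.sin_add, Real.cos_add, Real.sin_two_mul, Real.cos_two_mul', hs, hc]
  set d := √((2 : ℝ) ^ q - A.ncard)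
  set M := √((2 : ℝ) ^ q)
  have hq : ((2 : ℂ) ^ q)⁻¹ = ((1 / (M * M) : ℝ) : ℂ) := by rw [hm]; push_cast; rw [one_div]
  rw [hq]
  -- After denominators are cleared, sin² + cos² = 1 for the Grover angle is all that remains.
  have hdM : d * d = M * M - √(A.ncard : ℝ) * √(A.ncard : ℝ) := by rw [hd, hm, ht]
  by_cases hx : x ∈ A
  · have ht0 : 0 < √(A.ncard : ℝ) := Real.sqrt_pos.2 (by
      have := (Set.ncard_pos (Set.toFinite A)).2 ⟨x, hx⟩
      exact_mod_cast this)
    simp only [planeState, if_pos hx, one_mul]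
    rw [← Complex.ofReal_ofNat, ← Complex.ofReal_mul, ← Complex.ofReal_mul, ← Complex.ofReal_sub]
    congr 1
    set t := √(A.ncard : ℝ)
    field_simp
    linear_combination (-Real.sin φ) * hdM
  · simp only [planeState, if_neg hx]
    rw [show √((2 : ℝ) ^ q - A.ncard) = d from rfl,
      ← Complex.ofReal_ofNat, ← Complex.ofReal_one, ← Complex.ofReal_neg, ← Complex.ofReal_mul,
      ← Complex.ofReal_mul, ← Complex.ofReal_mul, ← Complex.ofReal_sub]
    congr 1
    set t := √(A.ncard : ℝ)
    field_simp
    linear_combination (Real.cos φ) * hdM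

theorem groverAngle_of_ncard_eq_zero (h : A.ncard = 0) : groverAngle A = 0 := by
  simp [groverAngle, h]

/-- The uniform vector is the point of the plane at the Grover angle itself, whence the odd
multiples. -/
theorem groverStep_iterate (hA : (A.ncard : ℝ) < 2 ^ q) (j : ℕ) :
    (groverStep A)^[j] (fun _ => invSqrtTwo ^ q) = planeState A
      (Real.sin ((2 * j + 1) * groverAngle A)) (Real.cos ((2 * j + 1) * groverAngle A)) := by
  induction j with
  | zero =>
    have hM : (0 : ℝ) < 2 ^ q := by positivity
    have hd0 : 0 < √((2 : ℝ) ^ q - A.ncard) := Real.sqrt_pos.2 (by linarith)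
    have h1 : invSqrtTwo ^ q = ((1 / √((2 : ℝ) ^ q) : ℝ) : ℂ) := by
      rw [invSqrtTwo, ← Complex.ofReal_pow, div_pow, one_pow, Real.sqrt_eq_rpow, Real.sqrt_eq_rpow,
        ← Real.rpow_natCast, ← Real.rpow_natCast, ← Real.rpow_mul (by norm_num),
        ← Real.rpow_mul (by norm_num), mul_comm]
    funext x
    simp only [Function.iterate_zero, id, planeState, Nat.cast_zero, mul_zero, zero_add, one_mul,
      sin_groverAngle, cos_groverAngle]
    split_ifs with hx
    · have ht0 : 0 < √(A.ncard : ℝ) := Real.sqrt_pos.2 (by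
        have := (Set.ncard_pos (Set.toFinite A)).2 ⟨x, hx⟩
        exact_mod_cast this)
      rw [h1]
      congr 1
      field_simp
    · rw [h1]
      congr 1
      field_simp
  | succ j ih =>
    rw [Function.iterate_succ_apply', ih, groverStep_planeState hA]
    congr 2 <;> push_cast <;> ring

-- For empty `A` the coordinate `u` does not show in the state; it has to vanish for the formulas to
-- hold.
open Classical in
theorem sum_norm_planeState (hA : (A.ncard : ℝ) < 2 ^ q) {u v : ℝ} (h0 : A.ncard = 0 → u = 0) :
    (∑ x, if x ∈ A then ‖planeState A u v x‖ ^ 2 else 0) = u ^ 2 ∧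
    ∑ x, ‖planeState A u v x‖ ^ 2 = u ^ 2 + v ^ 2 := by
  have h1 : ∀ x, ‖planeState A u v x‖ ^ 2 =
      if x ∈ A then u ^ 2 / A.ncard else v ^ 2 / ((2 : ℝ) ^ q - A.ncard) := fun x => by
    simp only [planeState]
    split_ifs
    · rw [Complex.norm_real, Real.norm_eq_abs, sq_abs, div_pow, Real.sq_sqrt (by positivity)]
    · rw [Complex.norm_real, Real.norm_eq_abs, sq_abs, div_pow, Real.sq_sqrt (by linarith)]
  have h2 : (A.ncard : ℝ) * (u ^ 2 / A.ncard) = u ^ 2 := by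
    rcases Nat.eq_zero_or_pos A.ncard with h | h
    · simp [h, h0 h]
    · field_simp
  have h3 : ((2 : ℝ) ^ q - A.ncard) * (v ^ 2 / ((2 : ℝ) ^ q - A.ncard)) = v ^ 2 := by
    have : (2 : ℝ) ^ q - A.ncard ≠ 0 := by linarith
    field_simp
  constructor
  · have : ∀ x, (if x ∈ A then ‖planeState A u v x‖ ^ 2 else 0) =
        if x ∈ A then u ^ 2 / A.ncard else 0 := fun x => by
      rw [h1]; split_ifs <;> rfl
    rw [Finset.sum_congr rfl fun x _ => this x, sum_ite_mem, h2, mul_zero, add_zero]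
  · rw [Finset.sum_congr rfl fun x _ => h1 x, sum_ite_mem, h2, h3]

end Amplitudes

/-- Some power of two is a suitable number of iterations. -/
theorem exists_good_power {θ : ℝ} {L : ℕ} (h0 : 0 < θ) (h1 : θ ≤ Real.pi / 6)
    (h2 : 1 ≤ 2 ^ L * θ) :
    ∃ k < L + 1, 3 / 4 ≤ Real.sin ((2 * (2 : ℕ) ^ k + 1) * θ) ^ 2 := by
  classical
  have hpi : Real.pi ≤ 4 := Real.pi_le_four
  -- At `L` the rotated angle is at least 2, beyond π/3. The first exponent to reach π/3 is chosen.
  have hex : ∃ k, Real.pi / 3 ≤ (2 * 2 ^ k + 1) * θ := ⟨L, by nlinarith⟩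
  have hL : Nat.find hex ≤ L := Nat.find_min' hex (by nlinarith)
  refine ⟨Nat.find hex, by omega, ?_⟩
  have hlow := Nat.find_spec hex
  -- Passing from one exponent to the next at most doubles the rotated angle, which was below π/3
  -- before. For exponent 0 it is three times the angle, at most π/2 by the bound π/6.
  have hup : (2 * 2 ^ Nat.find hex + 1) * θ ≤ 2 * Real.pi / 3 := by
    rcases Nat.eq_zero_or_pos (Nat.find hex) with h | h
    · rw [h]
      linarith
    · have := Nat.find_min hex (m := Nat.find hex - 1) (by omega)
      push Not at this
      obtain ⟨j, hj⟩ := Nat.exists_eq_succ_of_ne_zero h.ne'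
      rw [hj] at this ⊢
      simp only [Nat.succ_eq_add_one, Nat.add_sub_cancel] at this
      rw [pow_succ]
      nlinarith
  push_cast
  set φ := (2 * 2 ^ Nat.find hex + 1) * θ
  have hcos : Real.cos φ ^ 2 ≤ 1 / 4 := by
    have h3 : |Real.cos φ| ≤ 1 / 2 := by
      rw [abs_le]
      constructor
      · have h := Real.cos_le_cos_of_nonneg_of_le_pi (by linarith [Real.pi_pos])
          (by linarith [Real.pi_pos]) hup
        have e : Real.cos (2 * Real.pi / 3) = -(1 / 2) := by
          rw [show 2 * Real.pi / 3 = Real.pi - Real.pi / 3 by ring, Real.cos_pi_sub,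
            Real.cos_pi_div_three]
        linarith
      · have h := Real.cos_le_cos_of_nonneg_of_le_pi (by linarith [Real.pi_pos])
          (by linarith [Real.pi_pos]) hlow
        rwa [Real.cos_pi_div_three] at h
    rw [← sq_abs]
    nlinarith [abs_nonneg (Real.cos φ)]
  linarith [Real.sin_sq_add_cos_sq φ]

theorem recVal_div_two_pow {w b : ℕ} (hb : b < w) (g : ℕ → Bool) :
    recVal w g / 2 ^ b % 2 = (g b).toNat := by
  have h0 : ∀ (k : ℕ) (g : ℕ → Bool), recVal (k + 1) g % 2 = (g 0).toNat := by
    intro k g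
    rw [add_comm, recVal_add, pow_one, Nat.add_mul_mod_self_left]
    simp only [recVal]
    cases g 0 <;> simp
  obtain ⟨k, rfl⟩ := Nat.exists_eq_add_of_lt hb
  rw [add_assoc, recVal_add, Nat.add_mul_div_left _ _ (by positivity),
    Nat.div_eq_of_lt (recVal_lt b g), zero_add, h0]
  rfl

/-! ### Counting marked pairs of blocks. -/

section Marked

variable {n l : ℕ} {f : Bits n → Bits n}

/-- Bits of a row number. -/
theorem rowArg_recVal (x : ℕ → Bool) (y : Bits n) (c : Bool)
    (hx : ∀ b : Fin n, l ≤ b.val → x (c.toNat * (n - l) + (b - l)) = y b) :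
    rowArg n l x (recVal (l + 1) fun b => if b < l then extendBits y b else c) = y := by
  funext b
  unfold rowArg
  split_ifs with hb
  · rw [recVal_div_two_pow (by omega), if_pos hb]
    simp [extendBits, b.2]
  · have h1 : (recVal (l + 1) fun b => if b < l then extendBits y b else c) / 2 ^ l = c.toNat := by
      have := recVal_lt l fun b => if b < l then extendBits y b else c
      rw [recVal, if_neg (lt_irrefl l), Nat.add_mul_div_right _ _ (by positivity),
        Nat.div_eq_of_lt this, zero_add]
    rw [h1]
    exact hx b (by omega)

theorem markedSet_nonempty (hl : l ≤ n) (hf : ¬ Function.Injective f) :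
    (markedSet f l).Nonempty := by
  obtain ⟨y, y', hy, hne⟩ : ∃ y y', f y = f y' ∧ y ≠ y' := by
    simpa [Function.Injective] using hf
  -- The register holds the high bits of `y`, then those of `y'`, then two dummy ones. The low bits
  -- of the two arguments determine their rows.
  let g : ℕ → Bool := fun b => if b < n - l then extendBits y (l + b) else
    if b < 2 * (n - l) then extendBits y' (l + (b - (n - l))) else true
  let x : Bits (qbits n l) := fun b => g b
  have hxg : ∀ b < qbits n l, extendBits x b = g b := fun b hb => by simp [extendBits, hb, x]
  have hext : ∀ (z : Bits n) (b : Fin n), extendBits z b = z b := fun z b => by simp [extendBits]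
  refine ⟨x, ⟨?_, ?_⟩, ?_⟩
  · rw [hxg _ (by unfold qbits; omega)]
    simp only [g]
    rw [if_neg (by omega), if_neg (by omega)]
  · rw [hxg _ (by unfold qbits; omega)]
    simp only [g]
    rw [if_neg (by omega), if_neg (by omega)]
  · have h1 := rowArg_recVal (l := l) (extendBits x) y false fun b hb => by
      rw [hxg _ (by unfold qbits; simp; omega)]
      simp only [g, Bool.toNat_false, zero_mul, zero_add]
      rw [if_pos (by omega), show l + (b.val - l) = b.val by omega, hext]
    have h2 := rowArg_recVal (l := l) (extendBits x) y' true fun b hb => by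
      rw [hxg _ (by unfold qbits; simp; omega)]
      simp only [g, Bool.toNat_true, one_mul]
      rw [if_neg (by omega), if_pos (by omega),
        show l + (n - l + (b.val - l) - (n - l)) = b.val by omega, hext]
    refine ⟨_, recVal_lt _ fun b => if b < l then extendBits y b else false, _,
      recVal_lt _ fun b => if b < l then extendBits y' b else true, ?_, ?_⟩
    · rw [h1, h2]; exact hne
    · rw [h1, h2]; exact hy

/-- Both dummy bits are 1 on a marked string. Setting them freely yields four strings for each
marked one, all different. -/
theorem four_mul_ncard_markedSet_le (f : Bits n → Bits n) (l : ℕ) :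
    4 * (markedSet f l).ncard ≤ 2 ^ qbits n l := by
  classical
  have i0 : 2 * (n - l) < qbits n l := by unfold qbits; omega
  have i1 : 2 * (n - l) + 1 < qbits n l := by unfold qbits; omega
  have hm : ∀ x ∈ markedSet f l, x ⟨_, i0⟩ = true ∧ x ⟨_, i1⟩ = true := by
    intro x hx
    obtain ⟨⟨h1, h2⟩, -⟩ := hx
    simpa [extendBits, i0, i1] using And.intro h1 h2
  let F : markedSet f l × Bool × Bool → Bits (qbits n l) := fun p =>
    Function.update (Function.update p.1.1 ⟨_, i0⟩ p.2.1) ⟨_, i1⟩ p.2.2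
  have hne : (⟨_, i0⟩ : Fin (qbits n l)) ≠ ⟨_, i1⟩ := by simp
  have hF : Function.Injective F := by
    rintro ⟨x, b, c⟩ ⟨x', b', c'⟩ h
    have h1 := congrFun h ⟨_, i1⟩
    have h0 := congrFun h ⟨_, i0⟩
    simp only [F, Function.update_self, Function.update_of_ne hne] at h1 h0
    have hx : x = x' := by
      refine Subtype.ext (funext fun j => ?_)
      by_cases hj0 : j = ⟨_, i0⟩
      · rw [hj0, (hm x.1 x.2).1, (hm x'.1 x'.2).1]
      · by_cases hj1 : j = ⟨_, i1⟩
        · rw [hj1, (hm x.1 x.2).2, (hm x'.1 x'.2).2]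
        · have := congrFun h j
          simpa only [F, Function.update_of_ne hj0, Function.update_of_ne hj1] using this
    rw [hx, h0, h1]
  have := Nat.card_le_card_of_injective F hF
  rw [Nat.card_prod, Nat.card_coe_set_eq] at this
  simp at this
  omega

theorem sum_norm_searchAmp (f : Bits n → Bits n) (l k : ℕ) :
    ∑ x, ‖searchAmp f l k x‖ ^ 2 = 1 := by
  have hA : ((markedSet f l).ncard : ℝ) < 2 ^ qbits n l := by
    have := four_mul_ncard_markedSet_le f l
    have h2 : 0 < 2 ^ qbits n l := by positivity
    have : (markedSet f l).ncard < 2 ^ qbits n l := by omega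
    exact_mod_cast this
  rw [searchAmp, groverStep_iterate hA, (sum_norm_planeState hA ?_).2, Real.sin_sq_add_cos_sq]
  intro h
  rw [groverAngle_of_ncard_eq_zero h]
  simp

-- There is at least one marked string among 4^(n-l+1), so the sine of the angle is at least
-- 2^-(n-l+1). At most a quarter of the strings are marked, so the angle is at most π/6. These are
-- the two conditions of `exists_good_power`.
open Classical in
theorem exists_searchAmp_ge (hl : l ≤ n) (hf : ¬ Function.Injective f) :
    ∃ k < n - l + 2,
      3 / 4 ≤ ∑ x, if x ∈ markedSet f l then ‖searchAmp f l k x‖ ^ 2 else 0 := by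
  have h4 : 4 * ((markedSet f l).ncard : ℝ) ≤ 2 ^ qbits n l := by
    exact_mod_cast four_mul_ncard_markedSet_le f l
  have h1 : 1 ≤ ((markedSet f l).ncard : ℝ) := by
    have := (Set.ncard_pos (Set.toFinite _)).2 (markedSet_nonempty hl hf)
    exact_mod_cast this
  have hM : (0 : ℝ) < 2 ^ qbits n l := by positivity
  have hsq : √((2 : ℝ) ^ qbits n l) = 2 ^ (n - l + 1) := by
    rw [show qbits n l = (n - l + 1) * 2 by unfold qbits; ring, pow_mul,
      Real.sqrt_sq (by positivity)]
  have hsin := sin_groverAngle (markedSet f l)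
  rw [hsq] at hsin
  have hs1 : 1 ≤ 2 ^ (n - l + 1) * Real.sin (groverAngle (markedSet f l)) := by
    rw [hsin, mul_div_cancel₀ _ (by positivity)]
    exact Real.one_le_sqrt.2 h1
  have hle : √((markedSet f l).ncard / (2 : ℝ) ^ qbits n l) ≤ 1 / 2 := by
    rw [Real.sqrt_le_left (by norm_num), div_le_iff₀ hM]
    linarith
  have h0 : 0 ≤ groverAngle (markedSet f l) := Real.arcsin_nonneg.2 (Real.sqrt_nonneg _)
  have hs2 := Real.sin_le h0
  have hp : (0 : ℝ) < 2 ^ (n - l + 1) := by positivity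
  have hpos : 0 < groverAngle (markedSet f l) := by
    by_contra hneg
    have : groverAngle (markedSet f l) = 0 := le_antisymm (not_lt.1 hneg) h0
    rw [this] at hs1
    simp at hs1
    linarith
  have hsix : groverAngle (markedSet f l) ≤ Real.pi / 6 := by
    have e : Real.arcsin (1 / 2) = Real.pi / 6 := by
      rw [← Real.sin_pi_div_six, Real.arcsin_sin (by linarith [Real.pi_pos])
        (by linarith [Real.pi_pos])]
    rw [← e]
    exact Real.monotone_arcsin hle
  obtain ⟨k, hk, hk'⟩ := exists_good_power hpos hsix (L := n - l + 1) (by nlinarith)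
  refine ⟨k, hk, ?_⟩
  have hA : ((markedSet f l).ncard : ℝ) < 2 ^ qbits n l := by linarith
  rw [searchAmp, groverStep_iterate hA, (sum_norm_planeState hA fun h => ?_).1]
  · exact_mod_cast hk'
  · rw [h] at h1
    norm_num at h1

end Marked

/-! ### Correctness of the algorithm -/

section Invariant

variable {n : ℕ} {f : Bits n → Bits n} {l a k w : ℕ}

/-- The memory contents between the searches. -/
structure MemOK (f : Bits n → Bits n) (k : ℕ) (m : Mem) : Prop where
  zero : ∀ v : Addr, 1 + k ≤ v.1 → m v = false
  pair : m (0, 0, 2 * n) = true → HasPair f m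
  out : m (0, 0, 2 * n) = false → ∀ b < 2 * n, m (0, 0, b) = false

theorem HasPair.congr {m m' : Mem} (h : HasPair f m) (hm : ∀ b, m' (0, 0, b) = m (0, 0, b)) :
    HasPair f m' := by
  obtain ⟨i, i', h1, h2, h3⟩ := h
  exact ⟨i, i', h1, h2, fun b => by rw [hm, hm]; exact h3 b⟩

/-- The memory after a search. -/
def searchMem (f : Bits n → Bits n) (l a k : ℕ) (m : Mem) (x : Bits (qbits n l)) : Mem :=
  exec f (oracle n l a k ++ extract n l k ++ (oracle n l a k).reverse) (setReg k m x)

section Step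

variable (hl : l ≤ n) (hk : k < n - l + 2) {m : Mem} (hm : MemOK f k m) (x : Bits (qbits n l))
include hl hk hm

theorem searchMem_spec :
    (∀ v : Addr, v ≠ (1 + k, 0, qbits n l) → ¬ (v.1 = 0 ∧ v.2.1 = 0 ∧ v.2.2 ≤ 2 * n) →
      searchMem f l a k m x v = setReg k m x v) ∧
    (searchMem f l a k m x (1 + k, 0, qbits n l) = true ↔
      x ∈ markedSet f l ∧ m (0, 0, 2 * n) = false) ∧
    (searchMem f l a k m x (1 + k, 0, qbits n l) = false → searchMem f l a k m x = setReg k m x) ∧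
    (searchMem f l a k m x (1 + k, 0, qbits n l) = true →
      searchMem f l a k m x (0, 0, 2 * n) = true ∧ HasPair f (searchMem f l a k m x)) := by
  have h0 : ∀ b, setReg k m x (0, 0, b) = m (0, 0, b) :=
    fun b => setReg_of_ne x (by simp only; omega)
  obtain ⟨-, e1, e2, e3, e4⟩ := exec_oracle_extract (f := f) (a := a) hl hk (σ := setReg k m x)
    (fun v hv => by
      unfold workBase at hv
      rw [setReg_of_ne x (by omega), hm.zero v (by omega)])
    (by rw [setReg_of_ne x (by simp), hm.zero _ le_rfl])
  rw [setReg_register_eq (fun b _ => hm.zero _ le_rfl), h0] at e2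
  exact ⟨e1, e2, e3, fun h => e4 h fun b hb => (h0 b).trans (hm.out (e2.1 h).2 b hb)⟩

theorem searchMem_ok : MemOK f (k + 1) (searchMem f l a k m x) := by
  obtain ⟨e1, e2, e3, e4⟩ := searchMem_spec (a := a) hl hk hm x
  have h0 : ∀ b, setReg k m x (0, 0, b) = m (0, 0, b) :=
    fun b => setReg_of_ne x (by simp only; omega)
  refine ⟨fun v hv => ?_, fun h => ?_, fun h => ?_⟩
  · rw [e1 v (by rintro rfl; simp only at hv; omega) (by omega), setReg_of_ne x (by omega),
      hm.zero v (by omega)]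
  · by_cases hc : searchMem f l a k m x (1 + k, 0, qbits n l) = true
    · exact (e4 hc).2
    · rw [Bool.not_eq_true] at hc
      rw [e3 hc, h0] at h
      rw [e3 hc]
      exact (hm.pair h).congr h0
  · have hc : searchMem f l a k m x (1 + k, 0, qbits n l) = false := by
      by_contra hc
      rw [Bool.not_eq_false] at hc
      rw [(e4 hc).1] at h
      cases h
    rw [e3 hc] at h ⊢
    rw [h0] at h
    exact fun b hb => (h0 b).trans (hm.out h b hb)

/-- An output flag, once set, blocks further extraction and stays set. -/
theorem searchMem_flag (h : m (0, 0, 2 * n) = true ∨ x ∈ markedSet f l) :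
    searchMem f l a k m x (0, 0, 2 * n) = true := by
  obtain ⟨-, e2, e3, e4⟩ := searchMem_spec (a := a) hl hk hm x
  by_cases hc : searchMem f l a k m x (1 + k, 0, qbits n l) = true
  · exact (e4 hc).1
  · have hf : m (0, 0, 2 * n) = true := by
      by_contra hf
      rw [Bool.not_eq_true] at hf
      exact hc (e2.2 ⟨h.resolve_left (by simp [hf]), hf⟩)
    rw [e3 (by simpa using hc), setReg_of_ne x (by simp only; omega), hf]

/-- The register content stays in place, and the control bit beside it tells whether this search
wrote the output. If it did, the output wires were zero before; if not, they are unchanged. Hence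
different branches stay orthogonal, and their weights add without interference. -/
theorem searchMem_inj {m' : Mem} (hm' : MemOK f k m') {x' : Bits (qbits n l)}
    (h : ∀ v, Bdd (nRegions n l) (2 ^ (l + 1)) (nCols n a) v →
      searchMem f l a k m x v = searchMem f l a k m' x' v) :
    (∀ v, Bdd (nRegions n l) (2 ^ (l + 1)) (nCols n a) v → m v = m' v) ∧ x = x' := by
  obtain ⟨e1, e2, e3, -⟩ := searchMem_spec (a := a) hl hk hm x
  obtain ⟨e1', e2', e3', -⟩ := searchMem_spec (a := a) hl hk hm' x'
  have hc := h _ (bdd_register hl hk le_rfl)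
  have hx : x = x' := by
    funext b
    have := h _ (bdd_register hl hk b.2.le)
    rw [e1 _ (by simp [b.2.ne]) (by simp), e1' _ (by simp [b.2.ne]) (by simp)] at this
    simpa [setReg_register] using this
  refine ⟨fun v hv => ?_, hx⟩
  by_cases h1 : 1 + k ≤ v.1
  · rw [hm.zero v h1, hm'.zero v h1]
  by_cases h2 : v.1 = 0 ∧ v.2.1 = 0 ∧ v.2.2 ≤ 2 * n
  · by_cases hcc : searchMem f l a k m x (1 + k, 0, qbits n l) = true
    · obtain ⟨-, hf⟩ := e2.1 hcc
      obtain ⟨-, hf'⟩ := e2'.1 (hc ▸ hcc)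
      obtain ⟨r, i, b⟩ := v
      obtain ⟨rfl, rfl, hb⟩ := h2
      rcases hb.lt_or_eq with hb | hb
      · rw [hm.out hf b hb, hm'.out hf' b hb]
      · simp only at hb
        rw [hb, hf, hf']
    · rw [Bool.not_eq_true] at hcc
      have := h v hv
      rw [e3 hcc, e3' (hc ▸ hcc), setReg_of_ne x (by omega), setReg_of_ne x' (by omega)] at this
      exact this
  · have := h v hv
    rw [e1 v (by rintro rfl; simp only at h1; omega) h2,
      e1' v (by rintro rfl; simp only at h1; omega) h2, setReg_of_ne x (by omega),
      setReg_of_ne x' (by omega)] at this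
    exact this

end Step

open Classical in
/-- The states between the searches. -/
def StateOK (f : Bits n → Bits n) (l a w k : ℕ) (ψ : State w) : Prop :=
  ∃ (ι : Type) (_ : Fintype ι) (α : ι → ℂ) (m : ι → Mem),
    ψ = ∑ i, α i • memKet (2 ^ (l + 1)) (nCols n a) w (m i) ∧
    (∀ i j, (∀ v, Bdd (nRegions n l) (2 ^ (l + 1)) (nCols n a) v → m i v = m j v) → i = j) ∧
    ∑ i, ‖α i‖ ^ 2 = 1 ∧ (∀ i, MemOK f k (m i)) ∧
    ∀ j < k, (∑ x, if x ∈ markedSet f l then ‖searchAmp f l j x‖ ^ 2 else 0) ≤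
      ∑ i, if m i (0, 0, 2 * n) = true then ‖α i‖ ^ 2 else 0

variable {C : Circuit (n + n + a)}

/-- Every branch splits along the contents of the fresh register, with the same amplitudes in each
branch. Squared amplitudes multiply, so the old flagged weight persists and the marked contents
carry the success probability of the new search. -/
theorem StateOK.step (hC : C.Computes f) (hl : l ≤ n) (hk : k < n - l + 2)
    (hw : w = nRegions n l * 2 ^ (l + 1) * nCols n a) {ψ : State w} (h : StateOK f l a w k ψ) :
    StateOK f l a w (k + 1) (runProg C (2 ^ (l + 1)) (nCols n a) w (searchRun n l a k) ψ) := by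
  classical
  obtain ⟨ι, _, α, m, rfl, hinj, hsum, hm, hW⟩ := h
  have hamp := sum_norm_searchAmp f l k
  refine ⟨ι × Bits (qbits n l), inferInstance, fun p => α p.1 * searchAmp f l k p.2,
    fun p => searchMem f l a k (m p.1) p.2, ?_,
    ?_, ?_, fun p => searchMem_ok hl hk (hm p.1) p.2, ?_⟩
  · rw [map_sum_smul_of_isLinearMap (isLinearMap_runProg _ _ _ _ _), Fintype.sum_prod_type]
    refine Finset.sum_congr rfl fun i _ => ?_
    rw [runProg_searchRun hC hl hk hw (hm i).zero, Finset.smul_sum]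
    exact Finset.sum_congr rfl fun x _ => smul_smul _ _ _
  · rintro ⟨i, x⟩ ⟨j, y⟩ h
    obtain ⟨h1, h2⟩ := searchMem_inj hl hk (hm i) x (hm j) h
    rw [Prod.mk.injEq]
    exact ⟨hinj i j h1, h2⟩
  · rw [Fintype.sum_prod_type, ← hsum]
    refine Finset.sum_congr rfl fun i _ => ?_
    simp only [norm_mul, mul_pow, ← Finset.mul_sum, hamp, mul_one]
  -- Any family of branch and content pairs that end up flagged bounds the new flagged weight from
  -- below. It is used for the branches flagged before and for the marked contents.
  · have hle : ∀ F : ι → Bits (qbits n l) → Prop, (∀ i x, F i x → m i (0, 0, 2 * n) = true ∨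
        x ∈ markedSet f l) → (∑ i, ∑ x, if F i x then ‖α i‖ ^ 2 * ‖searchAmp f l k x‖ ^ 2 else 0) ≤
        ∑ p : ι × Bits (qbits n l), if searchMem f l a k (m p.1) p.2 (0, 0, 2 * n) = true then
          ‖α p.1 * searchAmp f l k p.2‖ ^ 2 else 0 := by
      intro F hF
      rw [Fintype.sum_prod_type]
      refine Finset.sum_le_sum fun i _ => Finset.sum_le_sum fun x _ => ?_
      simp only [norm_mul, mul_pow]
      by_cases hFx : F i x
      · rw [if_pos hFx, if_pos (searchMem_flag hl hk (hm i) x (hF i x hFx))]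
      · rw [if_neg hFx]
        split_ifs
        · positivity
        · exact le_rfl
    intro j hj
    rcases Nat.lt_succ_iff_lt_or_eq.1 hj with hj | rfl
    · refine (hW j hj).trans (le_trans (le_of_eq ?_) (hle (fun i _ => m i (0, 0, 2 * n) = true)
        fun i x h => Or.inl h))
      refine Finset.sum_congr rfl fun i _ => ?_
      split_ifs
      · rw [← Finset.mul_sum, hamp, mul_one]
      · simp
    · refine le_trans (le_of_eq ?_) (hle (fun _ x => x ∈ markedSet f l) fun i x h => Or.inr h)
      rw [Finset.sum_comm]
      refine Finset.sum_congr rfl fun x _ => ?_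
      split_ifs
      · rw [← Finset.sum_mul, hsum, one_mul]
      · simp

theorem stateOK_program (hC : C.Computes f) (hl : l ≤ n)
    (hw : w = nRegions n l * 2 ^ (l + 1) * nCols n a) :
    StateOK f l a w (n - l + 2)
      (runProg C (2 ^ (l + 1)) (nCols n a) w (program n l a) (ket fun _ => false)) := by
  have key : ∀ j ≤ n - l + 2, StateOK f l a w j (runProg C (2 ^ (l + 1)) (nCols n a) w
      ((List.range j).flatMap (searchRun n l a)) (ket fun _ => false)) := by
    intro j
    induction j with
    | zero =>
      intro _
      refine ⟨Unit, inferInstance, fun _ => 1, fun _ _ => false, ?_, fun _ _ _ => rfl, by simp,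
        fun _ => ⟨fun _ _ => rfl, fun h => by simp at h, fun _ _ _ => rfl⟩, fun j hj => by omega⟩
      simp [memKet, runProg]
      rfl
    | succ j ih =>
      intro hj
      rw [List.range_succ, List.flatMap_append, runProg_append, List.flatMap_cons,
        List.flatMap_nil, List.append_nil]
      exact (ih (by omega)).step hC hl (by omega) hw
  exact key _ le_rfl

end Invariant

/-! ### The template and its success probability. -/

section Template

variable {n l a : ℕ}

/-- The subtraction in `workWires` is not truncated, so the physical wires are exactly the encodings
of the logical wires in use. -/
theorem workWires_add (n l a : ℕ) :
    n + n + 1 + workWires n l a = nRegions n l * 2 ^ (l + 1) * nCols n a := by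
  have h1 : n + n + 1 ≤ nCols n a := by unfold nCols; omega
  have h2 : 0 < nRegions n l * 2 ^ (l + 1) := by unfold nRegions; positivity
  have h3 : nCols n a ≤ nRegions n l * 2 ^ (l + 1) * nCols n a := Nat.le_mul_of_pos_left _ h2
  unfold workWires
  omega

/-- The template for the given block length. -/
def searchTemplate (n l a : ℕ) : Template n a where
  work := workWires n l a
  steps := (stepCodes n l a).map (mkStep (n + n + a) (n + n + 1 + workWires n l a))

theorem code_searchTemplate (hl : l ≤ n) :
    (searchTemplate n l a).code = (workWires n l a, stepCodes n l a) := by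
  have h : ∀ s ∈ stepCodes n l a,
      Step.code (mkStep (n + n + a) (n + n + 1 + workWires n l a) s) = s := fun s hs => by
    obtain ⟨ℓ, hℓ, hs⟩ := List.mem_flatMap.1 hs
    exact code_mkStep ((ok_program hl ℓ hℓ).isSome_of_mem_layerCode (workWires_add n l a) s hs)
  simp only [Template.code, searchTemplate, List.map_map, Prod.mk.injEq, true_and]
  exact (List.map_congr_left h).trans (List.map_id _)

variable {C : Circuit (n + n + a)}

theorem wellFormed_searchTemplate (hl : l ≤ n) (hC : C.WellFormed) :
    Circuit.WellFormed ((searchTemplate n l a).instantiate C) := by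
  intro L hL
  obtain ⟨_, hs, hL⟩ := List.mem_flatMap.1 hL
  obtain ⟨s, hs', rfl⟩ := List.mem_map.1 hs
  obtain ⟨ℓ, hℓ, hs''⟩ := List.mem_flatMap.1 hs'
  exact (ok_program hl ℓ hℓ).wellFormed (workWires_add n l a) hC s hs'' L hL

/-- A flagged branch holds a genuine collision, so for injective f every branch is correct.
Otherwise the flagged weight is at least 3/4, by the search that reaches this bound. -/
theorem solvesED_searchTemplate {f : Bits n → Bits n} (hl : l ≤ n) (hC : C.Computes f) :
    SolvesED ((searchTemplate n l a).instantiate C) f := by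
  classical
  have hw := workWires_add n l a
  have hrun : Circuit.run ((searchTemplate n l a).instantiate C) (ket fun _ => false) =
      runProg C (2 ^ (l + 1)) (nCols n a) (n + n + 1 + workWires n l a) (program n l a)
        (ket fun _ => false) := run_program C _ _ _ _ _
  obtain ⟨ι, _, α, m, hψ, hinj, hsum, hm, hW⟩ := stateOK_program hC hl hw
  rw [← hrun] at hψ
  unfold SolvesED
  rw [hψ]
  set R := 2 ^ (l + 1)
  set W := nCols n a
  set w := n + n + 1 + workWires n l a
  have hB : ∀ b ≤ 2 * n, Bdd (nRegions n l) R W (0, 0, b) := fun b hb => by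
    have : 0 < R := by positivity
    refine ⟨by unfold nRegions; simp, this, ?_⟩
    simp only [W, nCols]
    omega
  -- Region 0, row 0 comes first in the enumeration of the wires, so its leading columns are the two
  -- output registers and the flag.
  have hbit : ∀ i (j : Fin w), j.val ≤ 2 * n → bitsOf R W w (m i) j = m i (0, 0, j.val) := by
    intro i j hj
    have h1 := bitsOf_enc hw (hB j hj) (m i)
    have h2 : enc R W (0, 0, j.val) = j.val := by simp [enc]
    simp only [h2] at h1
    exact h1
  have hbinj : Function.Injective fun i => bitsOf R W w (m i) := by
    intro i j h
    refine hinj i j fun v hv => ?_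
    rw [← bitsOf_enc hw hv (m i), ← bitsOf_enc hw hv (m j)]
    exact congrFun h _
  have hval : ∀ i, (∑ j, α j • memKet R W w (m j)) (bitsOf R W w (m i)) = α i := by
    intro i
    rw [Finset.sum_apply, Finset.sum_eq_single i]
    · simp [memKet, ket]
    · intro j _ hj
      have : bitsOf R W w (m i) ≠ bitsOf R W w (m j) := fun h => hj (hbinj h).symm
      simp [memKet, ket, this]
    · simp
  have hfst : ∀ i (b : Fin n), outFst (r := workWires n l a) (bitsOf R W w (m i)) b =
      m i (0, 0, b) := fun i b => hbit i _ (by simp; omega)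
  have hsnd : ∀ i (b : Fin n), outSnd (r := workWires n l a) (bitsOf R W w (m i)) b =
      m i (0, 0, n + b) := fun i b => hbit i _ (by simp; omega)
  have hflag : ∀ i, outFlag (r := workWires n l a) (bitsOf R W w (m i)) = m i (0, 0, 2 * n) :=
    fun i => (hbit i _ (by simp; omega)).trans (by simp [two_mul])
  have hcorr : ∀ i, (Function.Injective f ∨ m i (0, 0, 2 * n) = true) →
      CorrectAnswer (r := workWires n l a) f (bitsOf R W w (m i)) := by
    intro i hi
    by_cases ht : m i (0, 0, 2 * n) = true
    · obtain ⟨y, y', h1, h2, h3⟩ := (hm i).pair ht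
      have e1 : outFst (r := workWires n l a) (bitsOf R W w (m i)) = y :=
        funext fun b => (hfst i b).trans (h3 b).1
      have e2 : outSnd (r := workWires n l a) (bitsOf R W w (m i)) = y' :=
        funext fun b => (hsnd i b).trans (h3 b).2
      exact Or.inr ⟨(hflag i).trans ht, by rw [e1, e2]; exact h1, by rw [e1, e2]; exact h2⟩
    · exact Or.inl ⟨(hflag i).trans (by simpa using ht), hi.resolve_right ht⟩
  have hlow : (∑ i, if Function.Injective f ∨ m i (0, 0, 2 * n) = true then ‖α i‖ ^ 2 else 0) ≤
      ∑ z : Bits w, if CorrectAnswer (r := workWires n l a) f z then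
        ‖(∑ j, α j • memKet R W w (m j)) z‖ ^ 2 else 0 := by
    -- Branches have distinct bit strings, so the sum over branches is a partial sum over
    -- measurement outcomes.
    refine le_trans (b := ∑ i, if CorrectAnswer (r := workWires n l a) f (bitsOf R W w (m i)) then
        ‖(∑ j, α j • memKet R W w (m j)) (bitsOf R W w (m i))‖ ^ 2 else 0)
      (Finset.sum_le_sum fun i _ => ?_) ?_
    · rw [hval]
      by_cases hi : Function.Injective f ∨ m i (0, 0, 2 * n) = true
      · rw [if_pos hi, if_pos (hcorr i hi)]
      · rw [if_neg hi]
        split_ifs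
        · positivity
        · exact le_rfl
    · rw [← Finset.sum_image (s := Finset.univ) (g := fun i => bitsOf R W w (m i))
        (f := fun z => if CorrectAnswer (r := workWires n l a) f z then
          ‖(∑ j, α j • memKet R W w (m j)) z‖ ^ 2 else 0) (fun i _ j _ h => hbinj h)]
      refine Finset.sum_le_sum_of_subset_of_nonneg (Finset.subset_univ _) fun z _ _ => ?_
      split_ifs
      · positivity
      · exact le_rfl
  refine le_trans ?_ hlow
  by_cases hf : Function.Injective f
  · simp only [hf, true_or, if_true, hsum]
    norm_num
  · obtain ⟨k, hk, hk'⟩ := exists_searchAmp_ge hl hf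
    have := hW k hk
    simp only [hf, false_or]
    linarith

end Template

/-! ### Size of the circuits -/

theorem length_flatMap_le {α β : Type*} {L : List α} {g : α → List β} {D : ℕ}
    (h : ∀ x ∈ L, (g x).length ≤ D) : (L.flatMap g).length ≤ L.length * D := by
  induction L with
  | nil => simp
  | cons x L ih =>
    have h1 := h x List.mem_cons_self
    have h2 := ih fun y hy => h y (List.mem_cons_of_mem _ hy)
    rw [List.flatMap_cons, List.length_append, List.length_cons]
    linarith

@[simp] theorem length_loop (κ w cnt : ℕ) (F : ℕ → ℕ → List Addr) :
    (loop κ w cnt F).length = w := by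
  simp [loop]

theorem length_sortProg_le (ρ w h : ℕ) (sts : List (Bool × ℕ)) :
    (sortProg ρ w h sts).length ≤ sts.length * (3 * w) := by
  refine (length_flatMap_le (D := 3 * w) fun t _ => ?_).trans (by rw [List.length_range])
  simp only [stageProg, List.length_append, length_loop]
  omega

theorem nStages_le (l : ℕ) : nStages l ≤ (l + 1) * (l + 1) := by
  unfold nStages stages
  refine (length_flatMap_le (D := l + 1) fun p hp => ?_).trans (by rw [List.length_range])
  rw [List.mem_range] at hp
  simp
  omega

section Length

variable {n l : ℕ} (hl : l ≤ n) (a k : ℕ)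
include hl

theorem length_oracle_le : (oracle n l a k).length ≤ 26 * (n + 1) ^ 3 := by
  have hT : nStages l ≤ (n + 1) ^ 2 :=
    (nStages_le l).trans (by rw [sq]; exact Nat.mul_le_mul (by omega) (by omega))
  have h1 := length_sortProg_le (workBase n + 1) (2 * n) (2 ^ l) (stages (l + 1))
  have h2 := length_sortProg_le (sortedReg n l + 2) (2 * n + 1) (2 ^ l) (stages (l + 1))
  change _ ≤ nStages l * _ at h1
  change _ ≤ nStages l * _ at h2
  have h3 : (fanProg n l k).length ≤ 2 * (n + 1) + (n + 1) * (2 * (n + 1)) := by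
    rw [fanProg, List.length_append, length_loop]
    refine add_le_add (by unfold qbits; omega)
      ((length_flatMap_le (D := 2 * (n + 1)) fun j _ => ?_).trans ?_)
    · rw [length_loop]; unfold qbits; omega
    · rw [List.length_range]
      exact Nat.mul_le_mul_right _ (by omega)
  simp only [oracle, loadProg, adjProg, List.length_append, length_loop, List.length_singleton]
  have h4 := Nat.mul_le_mul_right (3 * (2 * n)) hT
  have h5 := Nat.mul_le_mul_right (3 * (2 * n + 1)) hT
  have h6 : l + (n - l) = n := by omega
  nlinarith [Nat.zero_le n, Nat.zero_le (n ^ 2), Nat.zero_le (n ^ 3)]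

theorem length_searchRun_le : (searchRun n l a k).length ≤ 2 ^ k * (120 * (n + 1) ^ 3) := by
  have h1 := length_oracle_le hl a k
  have hN : 1 ≤ (n + 1) ^ 3 := Nat.one_le_pow _ _ (by omega)
  have hN' : n + 1 ≤ (n + 1) ^ 3 := Nat.le_self_pow (by norm_num) _
  have hG : (groverIter n l a k).length ≤ 62 * (n + 1) ^ 3 := by
    simp only [groverIter, zeroTest, List.length_append, List.length_reverse, List.length_singleton,
      length_loop, qbits]
    omega
  have hI := length_flatMap_le (L := List.range (2 ^ k)) (g := fun _ => groverIter n l a k)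
    fun _ _ => hG
  have h2k : 1 ≤ 2 ^ k := Nat.one_le_two_pow
  have h3 : (n + 1) ^ 3 ≤ 2 ^ k * (n + 1) ^ 3 := Nat.le_mul_of_pos_left _ h2k
  rw [List.length_range] at hI
  simp only [searchRun, extract, List.length_append, List.length_reverse, List.length_singleton,
    length_loop]
  nlinarith

/-- The numbers of iterations form a geometric progression; its sum is below the next power of two.
-/
theorem length_program_le : (program n l a).length ≤ 2 ^ (n - l + 2) * (120 * (n + 1) ^ 3) := by
  have key : ∀ j, ((List.range j).flatMap (searchRun n l a)).length ≤
      2 ^ j * (120 * (n + 1) ^ 3) := by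
    intro j
    induction j with
    | zero => simp
    | succ j ih =>
      have := length_searchRun_le hl a j
      rw [List.range_succ, List.flatMap_append, List.length_append, List.flatMap_cons,
        List.flatMap_nil, List.append_nil, pow_succ]
      linarith
  exact key _

end Length

/-- The longest pattern belongs to `gt`: three monomials of degree two at 34 gates each and two of
degree one, 104 gates in all. -/
theorem Kind.length_pats_le {κ : ℕ} (h : κ < 12) : (Kind.pats κ).length ≤ 128 := by
  interval_cases κ <;> decide

/-- Slices are non-empty, so the size bound on the given circuit also bounds the time of a call. -/
theorem Circuit.WellFormed.depth_le_size {w : ℕ} {C : Circuit w} (h : C.WellFormed) :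
    C.depth ≤ C.size := by
  have := List.length_le_sum_of_one_le (C.map List.length) fun i hi => by
    obtain ⟨L, hL, rfl⟩ := List.mem_map.1 hi
    exact List.length_pos_iff.2 (h L hL).1
  simpa [Circuit.depth, Circuit.size] using this

/-- A layer costs either one run of `C`, all copies being simultaneous, or one slice for each gate
of its pattern. -/
theorem depth_searchTemplate_le {n l a : ℕ} (hl : l ≤ n) {C : Circuit (n + n + a)} {D : ℕ}
    (hC : C.length ≤ D) : Circuit.depth ((searchTemplate n l a).instantiate C) ≤
      2 ^ (n - l + 2) * (120 * (n + 1) ^ 3) * (128 + D) := by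
  have h1 : (searchTemplate n l a).instantiate C = (program n l a).flatMap fun ℓ =>
      (layerCode (2 ^ (l + 1)) (nCols n a) ℓ).flatMap fun s =>
        (mkStep (n + n + a) (n + n + 1 + workWires n l a) s).instantiate C := by
    simp only [Template.instantiate, searchTemplate, stepCodes, List.flatMap_map,
      List.flatMap_assoc]
  rw [Circuit.depth, h1]
  refine (length_flatMap_le (D := 128 + D) fun ℓ hℓ => ?_).trans
    (Nat.mul_le_mul_right _ (length_program_le hl a))
  have hk := (ok_program hl ℓ hℓ).kind
  unfold layerCode
  split_ifs with h0
  · simp only [List.flatMap_cons, List.flatMap_nil, List.append_nil, mkStep, if_true,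
      Step.instantiate]
    exact (List.length_map _).le.trans (hC.trans (Nat.le_add_left _ _))
  · refine (length_flatMap_le (D := 1) fun s hs => ?_).trans ?_
    · obtain ⟨p, -, rfl⟩ := List.mem_map.1 hs
      simp only [mkStep, Bool.false_eq_true, if_false, Step.instantiate]
      exact le_rfl
    · rw [List.length_map, mul_one]
      exact (Kind.length_pats_le hk).trans (Nat.le_add_right _ _)

theorem width_searchTemplate_le {n l a : ℕ} (hl : l ≤ n) :
    n + n + 1 + workWires n l a ≤ 2 ^ (l + 1) * (10 * (n + 1) ^ 2 * (4 * (n + 1) + a)) := by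
  have hT : nStages l ≤ (n + 1) ^ 2 :=
    (nStages_le l).trans (by rw [sq]; exact Nat.mul_le_mul (by omega) (by omega))
  have h1 : nRegions n l ≤ 10 * (n + 1) ^ 2 := by unfold nRegions; nlinarith
  have h2 : nCols n a ≤ 4 * (n + 1) + a := by unfold nCols; omega
  rw [workWires_add, mul_comm (nRegions n l), mul_assoc]
  exact Nat.mul_le_mul_left _ (Nat.mul_le_mul h1 h2)

theorem logBlock_le (n S : ℕ) : logBlock n S ≤ n := Nat.findGreatest_le n

theorem two_pow_logBlock_le {n S : ℕ} (h : 1 ≤ S) : 2 ^ logBlock n S ≤ S :=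
  Nat.findGreatest_spec (P := fun i => 2 ^ i ≤ S) (Nat.zero_le n) (by simpa using h)

theorem le_two_pow_logBlock {n S : ℕ} (h : S ≤ 2 ^ n) : S ≤ 2 ^ (logBlock n S + 1) := by
  rcases (logBlock_le n S).lt_or_eq with hl | hl
  · by_contra! hcon
    exact Nat.findGreatest_is_greatest (P := fun i => 2 ^ i ≤ S) (Nat.lt_succ_self _) hl hcon.le
  · rw [hl, pow_succ]
    omega

/-- S is at most 2^(l+1) for the block exponent l, and (n - l + 2) + (l + 1) = n + 3 gives the
factor 8. -/
theorem two_pow_sub_logBlock_le {n S : ℕ} (h1 : 1 ≤ S) (h : S ≤ 2 ^ n) :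
    (2 : ℝ) ^ (n - logBlock n S + 2) ≤ 8 * (2 ^ n / S) := by
  have hS : (0 : ℝ) < S := by exact_mod_cast h1
  have h2 : (S : ℝ) ≤ 2 ^ (logBlock n S + 1) := by exact_mod_cast le_two_pow_logBlock h
  rw [← mul_div_assoc, le_div_iff₀ hS]
  calc (2 : ℝ) ^ (n - logBlock n S + 2) * S
      ≤ 2 ^ (n - logBlock n S + 2) * 2 ^ (logBlock n S + 1) := by gcongr
    _ = 8 * 2 ^ n := by
      rw [← pow_add, show n - logBlock n S + 2 + (logBlock n S + 1) = n + 3 by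
        have := logBlock_le n S; omega, pow_add]
      norm_num [mul_comm]

theorem width_le {n S a c : ℕ} (h1 : 1 ≤ S) (ha : a ≤ c * (n + 1) ^ c) (C : Circuit (n + n + a)) :
    (((searchTemplate n (logBlock n S) a).instantiate C).width : ℝ) ≤
      S * ((20 * (4 + c) : ℕ) * ((n : ℝ) + 1) ^ (c + 3)) := by
  have hN1 : (1 : ℝ) ≤ (n : ℝ) + 1 := by linarith [(Nat.cast_nonneg n : (0 : ℝ) ≤ n)]
  have hNc : (1 : ℝ) ≤ ((n : ℝ) + 1) ^ c := one_le_pow₀ hN1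
  have h2 : (2 : ℝ) ^ logBlock n S ≤ S := by exact_mod_cast two_pow_logBlock_le h1
  have h3 : (n + n + 1 + workWires n (logBlock n S) a : ℝ) ≤ 2 ^ (logBlock n S + 1) *
      (10 * ((n : ℝ) + 1) ^ 2 * (4 * ((n : ℝ) + 1) + a)) := by
    exact_mod_cast width_searchTemplate_le (logBlock_le n S)
  have h4 : (a : ℝ) ≤ c * ((n : ℝ) + 1) ^ c := by exact_mod_cast ha
  have h5 : 4 * ((n : ℝ) + 1) + a ≤ (4 + c) * ((n : ℝ) + 1) ^ (c + 1) := by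
    rw [pow_succ]
    have : (c : ℝ) * ((n : ℝ) + 1) ^ c ≤ c * ((n : ℝ) + 1) ^ c * ((n : ℝ) + 1) :=
      le_mul_of_one_le_right (by positivity) hN1
    nlinarith
  have h6 : (((searchTemplate n (logBlock n S) a).instantiate C).width : ℝ) =
      n + n + 1 + workWires n (logBlock n S) a := by
    simp [Circuit.width, searchTemplate]
  rw [h6]
  refine h3.trans ?_
  rw [pow_succ]
  calc (2 : ℝ) ^ logBlock n S * 2 * (10 * ((n : ℝ) + 1) ^ 2 * (4 * ((n : ℝ) + 1) + a))
      ≤ S * 2 * (10 * ((n : ℝ) + 1) ^ 2 * ((4 + c) * ((n : ℝ) + 1) ^ (c + 1))) := by gcongr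
    _ = S * ((20 * (4 + c) : ℕ) * ((n : ℝ) + 1) ^ (c + 3)) := by push_cast; ring

theorem depth_le {n S a c : ℕ} (h1 : 1 ≤ S) (hS : S ≤ 2 ^ n) {C : Circuit (n + n + a)}
    (hC : C.WellFormed) (hsize : C.size ≤ c * (n + 1) ^ c) :
    (((searchTemplate n (logBlock n S) a).instantiate C).depth : ℝ) ≤
      2 ^ n / S * ((960 * (128 + c) : ℕ) * ((n : ℝ) + 1) ^ (c + 3)) := by
  have hN1 : (1 : ℝ) ≤ (n : ℝ) + 1 := by linarith [(Nat.cast_nonneg n : (0 : ℝ) ≤ n)]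
  have hNc : (1 : ℝ) ≤ ((n : ℝ) + 1) ^ c := one_le_pow₀ hN1
  have h2 := two_pow_sub_logBlock_le h1 hS
  have h4 : (((searchTemplate n (logBlock n S) a).instantiate C).depth : ℝ) ≤
      2 ^ (n - logBlock n S + 2) * (120 * ((n : ℝ) + 1) ^ 3) * (128 + c * ((n : ℝ) + 1) ^ c) := by
    exact_mod_cast depth_searchTemplate_le (logBlock_le n S) (hC.depth_le_size.trans hsize)
  have h5 : 128 + c * ((n : ℝ) + 1) ^ c ≤ (128 + c) * ((n : ℝ) + 1) ^ c := by linarith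
  calc _ ≤ _ := h4
    _ ≤ 8 * (2 ^ n / S) * (120 * ((n : ℝ) + 1) ^ 3) * ((128 + c) * ((n : ℝ) + 1) ^ c) := by gcongr
    _ = 2 ^ n / S * ((960 * (128 + c) : ℕ) * ((n : ℝ) + 1) ^ (c + 3)) := by push_cast; ring

end QC
end

theorem theorem6 :
    ∃ A : (n S a : ℕ) → QC.Template n a,
      Computable (fun p : ℕ × ℕ × ℕ => (A p.1 p.2.1 p.2.2).code) ∧
      ∀ c : ℕ, ∃ k : ℕ, ∀ (n S a : ℕ) (f : QC.Bits n → QC.Bits n) (C : QC.Circuit (n + n + a)),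
        1 ≤ S → S ≤ 2 ^ n →
        C.WellFormed → C.Computes f →
        C.size ≤ c * (n + 1) ^ c → a ≤ c * (n + 1) ^ c →
        ((A n S a).instantiate C).WellFormed ∧
        QC.SolvesED ((A n S a).instantiate C) f ∧
        (((A n S a).instantiate C).width : ℝ) ≤ k * (S : ℝ) * ((n : ℝ) + 1) ^ k ∧
        (((A n S a).instantiate C).depth : ℝ) ≤ k * ((2 : ℝ) ^ n / S) * ((n : ℝ) + 1) ^ k ∧
        (((A n S a).instantiate C).width : ℝ) * ((A n S a).instantiate C).depth ≤
          k * (2 : ℝ) ^ n * ((n : ℝ) + 1) ^ k := by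
  refine ⟨fun n S a => QC.searchTemplate n (QC.logBlock n S) a, ?_, fun c => ?_⟩
  · refine QC.computable_template_code.of_eq fun p => ?_
    exact (QC.code_searchTemplate (QC.logBlock_le _ _)).symm
  obtain ⟨A, hA⟩ : ∃ A, A = 20 * (4 + c) := ⟨_, rfl⟩
  obtain ⟨B, hB⟩ : ∃ B, B = 960 * (128 + c) := ⟨_, rfl⟩
  -- The product `A * B` bounds the constants of width, depth and their product, and `2 * c + 6` is
  -- the exponent of n + 1 in the product.
  obtain ⟨k, hk⟩ : ∃ k, k = A * B + (2 * c + 6) := ⟨_, rfl⟩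
  have hAk : A ≤ k := by nlinarith
  have hBk : B ≤ k := by nlinarith
  have hABk : A * B ≤ k := hk ▸ Nat.le_add_right _ _
  have hck : 2 * c + 6 ≤ k := hk ▸ Nat.le_add_left _ _
  refine ⟨k, fun n S a f C h1 hS hC hf hsize ha => ?_⟩
  have hl := QC.logBlock_le n S
  have hS0 : (0 : ℝ) < S := by exact_mod_cast h1
  have hN1 : (1 : ℝ) ≤ (n : ℝ) + 1 := by linarith [(Nat.cast_nonneg n : (0 : ℝ) ≤ n)]
  have hwidth := QC.width_le h1 ha C
  have hdepth := QC.depth_le h1 hS hC hsize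
  rw [← hA] at hwidth
  rw [← hB] at hdepth
  have hpow : ((n : ℝ) + 1) ^ (c + 3) ≤ ((n : ℝ) + 1) ^ k := pow_le_pow_right₀ hN1 (by omega)
  have hpow2 : ((n : ℝ) + 1) ^ (c + 3) * ((n : ℝ) + 1) ^ (c + 3) ≤ ((n : ℝ) + 1) ^ k := by
    rw [← pow_add]
    exact pow_le_pow_right₀ hN1 (by omega)
  have hAk' : (A : ℝ) ≤ k := by exact_mod_cast hAk
  have hBk' : (B : ℝ) ≤ k := by exact_mod_cast hBk
  have hABk' : (A : ℝ) * B ≤ k := by exact_mod_cast hABk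
  refine ⟨QC.wellFormed_searchTemplate hl hC, QC.solvesED_searchTemplate hl hf, ?_, ?_, ?_⟩
  · refine hwidth.trans ?_
    rw [mul_comm (k : ℝ), mul_assoc]
    gcongr
  · refine hdepth.trans ?_
    rw [mul_comm (k : ℝ), mul_assoc]
    gcongr
  · refine (mul_le_mul hwidth hdepth (Nat.cast_nonneg _) (by positivity)).trans ?_
    generalize ((n : ℝ) + 1) ^ (c + 3) = P at hpow2
    calc (S : ℝ) * (A * P) * (2 ^ n / S * (B * P)) = A * B * 2 ^ n * (P * P) := by field_simp
      _ ≤ _ := by gcongr; exact mul_self_nonneg P
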